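/- Let $d\ge 1$, let $\Omega\subset\mathbb R^d$ be non-empty, open and bounded, and let $\nu:\mathbb R^d\setminus\{0\}\to[0,\infty)$ be measurable with $\nu(h)=\nu(-h)$, $\int_{\mathbb R^d}(1\wedge|h|^2)\,\nu(h)\,dh<\infty$ and $\int_{\mathbb R^d}\nu(h)\,dh=\infty$, and assume that the measure $\nu(h)\,dh$ has full support (its closed support is $\mathbb R^d$). Let $\Lambda\ge 1$ and let $k:\mathbb R^d\times\mathbb R^d\setminus\mathrm{diag}\to[0,\infty)$ be measurable and symmetric with $\Lambda^{-1}\nu(y-x)\le k(x,y)\le\Lambda\,\nu(y-x)$ for all $x\ne y$. Let $H_\nu(\Omega)$ be the space of all $u\in L^2(\Omega)$ with $\|u\|_{H_\nu(\Omega)}^2=\|u\|_{L^2(\Omega)}^2+\iint_{\Omega\times\Omega}(u(x)-u(y))^2\nu(x-y)\,dx\,dy<\infty$. Assume that one of the following holds: - $(\mathscr A_1)$ there are an operator $E:H_\nu(\Omega)\to H_\nu(\mathbb R^d)$ and $C>0$ with $Eu|_\Omega=u$ and $\|Eu\|_{H_\nu(\mathbb R^d)}\le C\|u\|_{H_\nu(\Omega)}$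 for all $u\in H_\nu(\Omega)$; - $(\mathscr A_2)$ $\Omega$ has Lipschitz boundary, $\nu$ is radial, and $\delta^{-2}\int_{B_\delta(0)}|h|^2\nu(h)\,dh\to\infty$ as $\delta\to0+$; - $(\mathscr A_3)$ $\inf_{a\in\partial\Omega}\int_{\Omega_\delta}\nu(h-a)\,dh\to\infty$ as $\delta\to0+$, where $\Omega_\delta=\{x\in\Omega:\operatorname{dist}(x,\partial\Omega)>\delta\}$. Let $V_\nu(\Omega|\mathbb R^d)$ be the space of measurable $u:\mathbb R^d\to\mathbb R$ (modulo equality a.e.) with $u|_\Omega\in L^2(\Omega)$ and $\iint_{\Omega\times\mathbb R^d}(u(x)-u(y))^2\nu(x-y)\,dx\,dy<\infty$, and for $u,v$ in it put $$\mathcal E(u,v)=\frac12\iint_{(\Omega^c\times\Omega^c)^c}(u(x)-u(y))(v(x)-v(y))\,k(x,y)\,dx\,dy .$$ A non-zero $u\in V_\nu(\Omega|\mathbb R^d)$ is called a Neumann eigenfunction of $L$ (the operator with kernel $k$) with eigenvalue $\mu\in\mathbb R$ if $\mathcal E(u,v)=\mu\int_\Omega uv\,dx$ for all $v\in V_\nu(\Omega|\mathbb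 R^d)$. Then there are a sequence $(\phi_n)_{n\ge0}$ in $V_\nu(\Omega|\mathbb R^d)$ whose restrictions to $\Omega$ form an orthonormal basis of $L^2(\Omega)$, and real numbers $0=\mu_0<\mu_1\le\mu_2\le\cdots$ with $\mu_n\to\infty$, such that each $\phi_n$ is a Neumann eigenfunction of $L$ with eigenvalue $\mu_n$. Moreover each eigenvalue is repeated according to its geometric multiplicity: for every $r\in\mathbb R$, the space spanned by the Neumann eigenfunctions with eigenvalue $r$ is finite-dimensional, and its dimension equals the number of $n\ge 0$ with $\mu_n=r$. -/

import Mathlib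

open MeasureTheory Set Filter Topology
open scoped ENNReal NNReal

namespace NonlocalNeumann

noncomputable section

/-- Euclidean space `ℝ^d`. -/
abbrev Space (d : ℕ) : Type := EuclideanSpace ℝ (Fin d)

/-- `ν` is the density of a symmetric Lévy measure: a measurable function with `ν(h) = ν(-h)` and
`∫ (1 ∧ |h|²) ν(h) dh < ∞`. (The value at the origin never matters; "measurable" means
Lebesgue-measurable, i.e. almost everywhere equal to a Borel function.) -/
structure IsLevyDensity {d : ℕ} (ν : Space d → ℝ≥0) : Prop where
  aemeasurable : AEMeasurable ν volume
  symm : ∀ h, ν (-h) = ν h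
  levy : ∫⁻ h, ENNReal.ofReal (min 1 (‖h‖ ^ 2)) * (ν h : ℝ≥0∞) < ∞

/-- The (closed) support of the measure `ν(h) dh` is all of `ℝ^d`. -/
def HasFullSupport {d : ℕ} (ν : Space d → ℝ≥0) : Prop :=
  (volume.withDensity (fun h => (ν h : ℝ≥0∞))).support = univ

/-- `∬_{A × B} (u(x) - u(y))² ν(x - y) dx dy`, with values in `[0, ∞]`. -/
def energyOn {d : ℕ} (ν : Space d → ℝ≥0) (A B : Set (Space d)) (u : Space d → ℝ) : ℝ≥0∞ :=
  ∫⁻ p in A ×ˢ B, ENNReal.ofReal ((u p.1 - u p.2) ^ 2) * (ν (p.1 - p.2) : ℝ≥0∞)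
    ∂((volume : Measure (Space d)).prod volume)

/-- `u|_Ω` belongs to `H_ν(Ω)`; only the values of `u` on `Ω` matter. -/
def MemH {d : ℕ} (ν : Space d → ℝ≥0) (Ω : Set (Space d)) (u : Space d → ℝ) : Prop :=
  MemLp u 2 (volume.restrict Ω) ∧ energyOn ν Ω Ω u < ∞

/-- The squared norm of `H_ν(Ω)`. -/
def normSqH {d : ℕ} (ν : Space d → ℝ≥0) (Ω : Set (Space d)) (u : Space d → ℝ) : ℝ≥0∞ :=
  (∫⁻ x in Ω, ENNReal.ofReal (u x ^ 2)) + energyOn ν Ω Ω u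

/-- `u` belongs to the energy space `V_ν(Ω|ℝ^d)`: a measurable function on all of `ℝ^d`, square
integrable on `Ω`, with `∬_{Ω × ℝ^d} (u(x) - u(y))² ν(x - y) dx dy < ∞`. -/
def MemV {d : ℕ} (ν : Space d → ℝ≥0) (Ω : Set (Space d)) (u : Space d → ℝ) : Prop :=
  AEMeasurable u volume ∧ MemLp u 2 (volume.restrict Ω) ∧ energyOn ν Ω univ u < ∞

/-- The boundary of `Ω` is Lipschitz: near each boundary point `a`, and in Cartesian coordinates
`x = (x', x_d)` with `x_d`-axis in a suitable unit direction `e`, the set `Ω` is the set of points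
lying strictly above the graph of a Lipschitz function `γ` of `x' ∈ e^⊥`. -/
def HasLipschitzBoundary {d : ℕ} (Ω : Set (Space d)) : Prop :=
  ∀ a ∈ frontier Ω, ∃ r > (0 : ℝ), ∃ e : Space d, ‖e‖ = 1 ∧
    ∃ (K : ℝ≥0) (γ : (Submodule.span ℝ {e})ᗮ → ℝ), LipschitzWith K γ ∧
      Ω ∩ Metric.ball a r =
        {x | γ ((Submodule.span ℝ {e})ᗮ.orthogonalProjectionOnto x) < inner ℝ e x} ∩ Metric.ball a r

/-- `ν` is radial. -/
def IsRadial {d : ℕ} (ν : Space d → ℝ≥0) : Prop :=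
  ∀ x y, ‖x‖ = ‖y‖ → ν x = ν y

/-- `Ω_δ = {x ∈ Ω : dist(x, ∂Ω) > δ}`. -/
def innerPart {d : ℕ} (Ω : Set (Space d)) (δ : ℝ) : Set (Space d) :=
  {x ∈ Ω | δ < Metric.infDist x (frontier Ω)}

/-- `q(δ) = δ⁻² ∫_{B_δ(0)} |h|² ν(h) dh`. -/
def q {d : ℕ} (ν : Space d → ℝ≥0) (δ : ℝ) : ℝ≥0∞ :=
  ENNReal.ofReal ((δ ^ 2)⁻¹) *
    ∫⁻ h in Metric.ball (0 : Space d) δ, ENNReal.ofReal (‖h‖ ^ 2) * (ν h : ℝ≥0∞)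

/-- `q̃(δ) = inf_{a ∈ ∂Ω} ∫_{Ω_δ} ν(h - a) dh`. -/
def qTilde {d : ℕ} (ν : Space d → ℝ≥0) (Ω : Set (Space d)) (δ : ℝ) : ℝ≥0∞ :=
  ⨅ a ∈ frontier Ω, ∫⁻ h in innerPart Ω δ, (ν (h - a) : ℝ≥0∞)

/-- The standing requirements of the classes `A₁`, `A₂`, `A₃`: `Ω` is open and bounded, `ν` is the
density of a symmetric Lévy measure, and `∫ ν(h) dh = ∞`. -/
structure ClassBase {d : ℕ} (ν : Space d → ℝ≥0) (Ω : Set (Space d)) : Prop where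
  isOpen : IsOpen Ω
  isBounded : Bornology.IsBounded Ω
  levyDensity : IsLevyDensity ν
  nonintegrable : ∫⁻ h, (ν h : ℝ≥0∞) = ∞

/-- Class `A₁`: there is a bounded extension operator `E : H_ν(Ω) → H_ν(ℝ^d)`. -/
structure ClassA1 {d : ℕ} (ν : Space d → ℝ≥0) (Ω : Set (Space d)) : Prop
    extends ClassBase ν Ω where
  extension : ∃ (C : ℝ≥0) (E : (Space d → ℝ) → (Space d → ℝ)), 0 < C ∧
    ∀ u, MemH ν Ω u →
      MemH ν univ (E u) ∧ normSqH ν univ (E u) ≤ (C : ℝ≥0∞) ^ 2 * normSqH ν Ω u ∧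
        E u =ᵐ[volume.restrict Ω] u

/-- Class `A₂`: Lipschitz boundary, radial `ν`, and `q(δ) → ∞` as `δ → 0+`. -/
structure ClassA2 {d : ℕ} (ν : Space d → ℝ≥0) (Ω : Set (Space d)) : Prop
    extends ClassBase ν Ω where
  lipschitzBoundary : HasLipschitzBoundary Ω
  radial : IsRadial ν
  tendsto_q : Tendsto (q ν) (𝓝[>] 0) (𝓝 ∞)

/-- Class `A₃`: `q̃(δ) → ∞` as `δ → 0+`. -/
structure ClassA3 {d : ℕ} (ν : Space d → ℝ≥0) (Ω : Set (Space d)) : Prop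
    extends ClassBase ν Ω where
  tendsto_qTilde : Tendsto (qTilde ν Ω) (𝓝[>] 0) (𝓝 ∞)

/-- `k : ℝ^d × ℝ^d ∖ diag → [0, ∞)` is measurable, symmetric and satisfies
`Λ⁻¹ ν(y - x) ≤ k(x, y) ≤ Λ ν(y - x)`. (Values on the diagonal, a null set, are unconstrained.) -/
structure IsEllipticKernel {d : ℕ} (ν : Space d → ℝ≥0) (Λ : ℝ≥0)
    (k : Space d → Space d → ℝ≥0) : Prop where
  aemeasurable : AEMeasurable (fun p : Space d × Space d => k p.1 p.2)
    ((volume : Measure (Space d)).prod volume)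
  symm : ∀ x y, x ≠ y → k x y = k y x
  lower : ∀ x y, x ≠ y → Λ⁻¹ * ν (y - x) ≤ k x y
  upper : ∀ x y, x ≠ y → k x y ≤ Λ * ν (y - x)

/-- The bilinear form
`𝓔(u, v) = ½ ∬_{(Ωᶜ × Ωᶜ)ᶜ} (u(x) - u(y)) (v(x) - v(y)) k(x, y) dx dy`. The integrand is integrable
for `u`, `v` in the energy space when `k(x, y) ≤ Λ ν(y - x)`. -/
def form {d : ℕ} (k : Space d → Space d → ℝ≥0) (Ω : Set (Space d)) (u v : Space d → ℝ) : ℝ :=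
  (1 / 2) * ∫ p in (Ωᶜ ×ˢ Ωᶜ)ᶜ, (u p.1 - u p.2) * (v p.1 - v p.2) * (k p.1 p.2 : ℝ)
    ∂((volume : Measure (Space d)).prod volume)

/-- `u` is a Neumann eigenfunction, with eigenvalue `μ`, of the operator `L` with kernel `k`:
a non-zero element of the energy space with `𝓔(u, v) = μ ∫_Ω u v` for all `v` in that space. -/
def IsNeumannEigenfunction {d : ℕ} (ν : Space d → ℝ≥0) (k : Space d → Space d → ℝ≥0)
    (Ω : Set (Space d)) (μ : ℝ) (u : Space d → ℝ) : Prop :=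
  MemV ν Ω u ∧ ¬ (u =ᵐ[volume] 0) ∧
    ∀ v, MemV ν Ω v → form k Ω u v = μ * ∫ x in Ω, u x * v x

/-- The eigenspace of `μ`: the linear span, among functions modulo almost everywhere equality on
`ℝ^d`, of the Neumann eigenfunctions with eigenvalue `μ`. Its dimension is the geometric
multiplicity of `μ` (zero if `μ` is not an eigenvalue). -/
def eigenspace {d : ℕ} (ν : Space d → ℝ≥0) (k : Space d → Space d → ℝ≥0)
    (Ω : Set (Space d)) (μ : ℝ) : Submodule ℝ (Space d →ₘ[volume] ℝ) :=
  Submodule.span ℝ {u | IsNeumannEigenfunction ν k Ω μ u}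

end

end NonlocalNeumann

/-! Equip the energy space `V` with the inner product `∫_Ω u v + 𝓔(u, v)` and let `J : V → L²(Ω)` be
restriction. The Neumann problem for `μ` becomes `⟪w, v⟫ = (1 + μ) ⟪J w, J v⟫` for all `v`. If `V`
is complete and `J` is compact with dense range, then `J J*` is compact and positive definite on the
infinite-dimensional space `L²(Ω)`. Its orthonormal eigenbasis `b n`, with eigenvalues `l n ↓ 0`,
yields `w n = (l n)⁻¹ J* (b n)` and `μ n = (l n)⁻¹ - 1` (`exists_hilbertBasis_weak_eigenvectors`).

Completeness (`isClosed_energySpace`): the map `u ↦ (u|_Ω, u x - u y)` embeds `V` isometrically in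
`L²(Ω) × L²(½ k)`. Full support of `ν` makes every point of `ℝ^d` interact with `Ω`, so convergence
on `Ω` together with convergence of the differences forces convergence almost everywhere
(`ae_of_ae_formMeasure`).

Compactness (`totallyBounded_of_class`): inside `Ω` it comes from `∫ ν = ∞`. Averaging `u` against a
truncation of `ν` of large mass changes `u` little in terms of the energy, and the averages are
pairings with a compact family of `L²` functions (`finitelyColourable_of_isCompact`). Up to the
boundary, class `A₁` extends `u` past `∂Ω`, while `A₂` and `A₃` satisfy `NoBoundaryConcentration`:
for `A₃` because points near `∂Ω` interact strongly with the inner part, for `A₂` because one can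
walk from the boundary into the interior along a cone of directions.

Constants have eigenvalue `0`. Zero energy forces a function to be constant on `Ω`, connected or not
(`exists_ae_eq_const`), so `0` is simple. Expansion in the basis gives the multiplicities
(`weak_eigenvector_mem_span`). -/

namespace NonlocalNeumann

/-! ### Spectral theory of compact positive operators on a real Hilbert space. -/

section Spectral

open Module

variable {H : Type*} [NormedAddCommGroup H] [InnerProductSpace ℝ H] [CompleteSpace H]

/-- The norm of a nonzero compact positive symmetric operator is an eigenvalue. -/
theorem hasEigenvalue_norm_of_isCompactOperator {T : H →L[ℝ] H} (hc : IsCompactOperator T)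
    (hs : T.IsSymmetric) (hpos : ∀ x, 0 ≤ inner ℝ (T x) x) (h0 : T ≠ 0) :
    End.HasEigenvalue (T : End ℝ H) ‖T‖ := by
  have hnt : Nontrivial H := by
    by_contra h
    rw [not_nontrivial_iff_subsingleton] at h
    exact h0 (Subsingleton.elim _ _)
  rw [hc.hasEigenvalue_iff_mem_spectrum (norm_ne_zero_iff.2 h0)]
  -- Were `‖T‖` in the resolvent set, the Rayleigh quotients would stay below `‖T‖ - ε`; but for a
  -- symmetric operator the supremum of their absolute values is `‖T‖`.
  by_contra hn
  have hn' : algebraMap ℝ ℝ ‖T‖ ∈ resolventSet ℝ T := by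
    simpa [spectrum] using hn
  obtain ⟨ε, hε, h⟩ := T.rayleighQuotient_le_of_norm_mem_resolventSet hn'
  have h1 : ‖T‖ ≤ ‖T‖ - ε := by
    conv_lhs => rw [T.norm_eq_iSup_rayleighQuotient hs]
    refine ciSup_le fun x => ?_
    rw [abs_of_nonneg]
    · exact h x
    · simp only [ContinuousLinearMap.rayleighQuotient, ContinuousLinearMap.reApplyInnerSelf_apply]
      exact div_nonneg (hpos x) (by positivity)
  linarith

/-- On the orthogonal complement of a finite-dimensional invariant subspace, the Rayleigh quotient
of a compact positive definite operator attains its maximum at an eigenvector. -/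
theorem exists_maximal_eigenvector {T : H →L[ℝ] H} (hc : IsCompactOperator T)
    (hs : T.IsSymmetric) (hpos : ∀ x, x ≠ 0 → 0 < inner ℝ (T x) x)
    (hinf : ¬ FiniteDimensional ℝ H) (F : Submodule ℝ H) [FiniteDimensional ℝ F]
    (hF : ∀ x ∈ F, T x ∈ F) :
    ∃ e ∈ Fᗮ, ‖e‖ = 1 ∧ ∃ l : ℝ, T e = l • e ∧ ∀ x ∈ Fᗮ, inner ℝ (T x) x ≤ l * ‖x‖ ^ 2 := by
  have hinv : ∀ x ∈ Fᗮ, T x ∈ Fᗮ := by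
    intro x hx
    rw [Submodule.mem_orthogonal] at hx ⊢
    intro u hu
    have := hs u x
    simp only [ContinuousLinearMap.coe_coe] at this
    rw [← this]
    exact hx _ (hF u hu)
  have hpos' : ∀ x, 0 ≤ inner ℝ (T x) x := by
    intro x
    by_cases hx : x = 0
    · simp [hx]
    · exact (hpos x hx).le
  let S : Fᗮ →L[ℝ] Fᗮ := T.restrict hinv
  have hSc : IsCompactOperator S := hc.restrict' (f := (T : H →ₗ[ℝ] H)) hinv
  have hSs : S.IsSymmetric := hs.restrict_invariant hinv
  have hSv : ∀ x : Fᗮ, ((S x : Fᗮ) : H) = T x := fun x => rfl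
  have hFt : Fᗮ ≠ ⊥ := by
    intro h
    rw [Submodule.orthogonal_eq_bot_iff] at h
    subst h
    exact hinf (Module.Finite.equiv (Submodule.topEquiv (R := ℝ) (M := H)))
  obtain ⟨z, hzF, hz⟩ := Submodule.exists_mem_ne_zero_of_ne_bot hFt
  have hS0 : S ≠ 0 := by
    intro h
    have : T z = 0 := by
      rw [← hSv ⟨z, hzF⟩, h]; rfl
    have h2 := hpos z hz
    rw [this] at h2
    simp at h2
  have hev := hasEigenvalue_norm_of_isCompactOperator hSc hSs (fun x => hpos' x) hS0
  obtain ⟨v, hv⟩ := hev.exists_hasEigenvector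
  have hv0 : ‖v‖ ≠ 0 := norm_ne_zero_iff.2 hv.2
  have hTv : T (v : H) = ‖S‖ • (v : H) := by
    have := hv.apply_eq_smul
    exact congrArg Subtype.val this
  refine ⟨‖v‖⁻¹ • (v : H), Fᗮ.smul_mem _ v.2, ?_, ‖S‖, ?_, ?_⟩
  · rw [norm_smul, norm_inv, norm_norm]
    exact inv_mul_cancel₀ hv0
  · rw [map_smul, hTv, smul_comm]
  · intro x hx
    have h1 : inner ℝ (T x) x ≤ ‖T x‖ * ‖x‖ := real_inner_le_norm _ _
    have h2 : ‖T x‖ ≤ ‖S‖ * ‖x‖ := S.le_opNorm ⟨x, hx⟩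
    nlinarith [norm_nonneg x]

/-- **Spectral theorem** for a compact positive definite operator on an infinite-dimensional real
Hilbert space, with the eigenvalues listed in decreasing order. -/
theorem exists_hilbertBasis_antitone_eigenvalues {T : H →L[ℝ] H} (hc : IsCompactOperator T)
    (hs : T.IsSymmetric) (hpos : ∀ x, x ≠ 0 → 0 < inner ℝ (T x) x)
    (hinf : ¬ FiniteDimensional ℝ H) :
    ∃ (b : HilbertBasis ℕ ℝ H) (l : ℕ → ℝ), (∀ n, T (b n) = l n • b n) ∧ (∀ n, 0 < l n) ∧
      Antitone l ∧ Tendsto l atTop (𝓝 0) := by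
  -- The states of a greedy recursion: finite-dimensional invariant subspaces, each enlarged by a
  -- maximal eigenvector of its orthogonal complement.
  let St := {F : Submodule ℝ H // FiniteDimensional ℝ F ∧ ∀ x ∈ F, T x ∈ F}
  have step : ∀ F : St, ∃ e ∈ F.1ᗮ, ‖e‖ = 1 ∧ ∃ l : ℝ, T e = l • e ∧
      ∀ x ∈ F.1ᗮ, inner ℝ (T x) x ≤ l * ‖x‖ ^ 2 := by
    intro F
    have := F.2.1
    exact exists_maximal_eigenvector hc hs hpos hinf F.1 F.2.2
  choose e heF he1 l hel hmax using step
  have nextP : ∀ F : St, FiniteDimensional ℝ (F.1 ⊔ Submodule.span ℝ {e F} : Submodule ℝ H) ∧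
      ∀ x ∈ F.1 ⊔ Submodule.span ℝ {e F}, T x ∈ F.1 ⊔ Submodule.span ℝ {e F} := by
    intro F
    have := F.2.1
    refine ⟨inferInstance, fun x hx => ?_⟩
    obtain ⟨y, hy, z, hz, rfl⟩ := Submodule.mem_sup.1 hx
    obtain ⟨c, rfl⟩ := Submodule.mem_span_singleton.1 hz
    rw [map_add]
    refine Submodule.add_mem_sup (F.2.2 y hy) ?_
    rw [map_smul, hel]
    exact Submodule.smul_mem _ _ (Submodule.smul_mem _ _ (Submodule.mem_span_singleton_self _))
  let next : St → St := fun F => ⟨_, nextP F⟩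
  let G : ℕ → St := fun n => Nat.rec (motive := fun _ => St) ⟨⊥, inferInstance, by simp⟩
    (fun _ F => next F) n
  have hG : ∀ n, (G (n + 1)).1 = (G n).1 ⊔ Submodule.span ℝ {e (G n)} := fun n => rfl
  have hmono : Monotone fun n => (G n).1 := monotone_nat_of_le_succ fun n => by
    rw [hG]; exact le_sup_left
  have hmem : ∀ m n, m < n → e (G m) ∈ (G n).1 := by
    intro m n hmn
    refine hmono (Nat.succ_le_of_lt hmn) ?_
    change e (G m) ∈ (G (m + 1)).1
    rw [hG]
    exact Submodule.mem_sup_right (Submodule.mem_span_singleton_self _)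
  have horth : ∀ m n, m < n → inner ℝ (e (G m)) (e (G n)) = 0 := fun m n hmn =>
    (Submodule.mem_orthogonal _ _).1 (heF (G n)) _ (hmem m n hmn)
  have hon : Orthonormal ℝ fun n => e (G n) := by
    refine ⟨fun n => he1 _, fun m n hmn => ?_⟩
    rcases lt_or_gt_of_ne hmn with h | h
    · exact horth m n h
    · change inner ℝ (e (G m)) (e (G n)) = 0
      rw [real_inner_comm]; exact horth n m h
  have hval : ∀ n, inner ℝ (T (e (G n))) (e (G n)) = l (G n) := by
    intro n
    rw [hel, real_inner_smul_left, real_inner_self_eq_norm_sq, he1]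
    ring
  have hlpos : ∀ n, 0 < l (G n) := by
    intro n
    rw [← hval]
    refine hpos _ fun h => ?_
    have := he1 (G n)
    rw [h] at this
    simp at this
  have hanti : Antitone fun n => l (G n) := by
    intro m n hmn
    have h1 : e (G n) ∈ (G m).1ᗮ := Submodule.orthogonal_le (hmono hmn) (heF (G n))
    have h2 := hmax (G m) _ h1
    rw [hval, he1] at h2
    simpa using h2
  have hlim : Tendsto (fun n => l (G n)) atTop (𝓝 0) := by
    have hbdd : BddBelow (range fun n => l (G n)) :=
      ⟨0, by rintro _ ⟨n, rfl⟩; exact (hlpos n).le⟩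
    have hti := tendsto_atTop_ciInf hanti hbdd
    set c := ⨅ n, l (G n)
    have hc0 : 0 ≤ c := le_ciInf fun n => (hlpos n).le
    rcases hc0.eq_or_lt with h | h
    · rwa [← h] at hti
    exfalso
    -- If the eigenvalues stay above `c > 0`, the orthogonal images `T e_n` are at mutual distance
    -- at least `c`, which rules out a convergent subsequence.
    obtain ⟨K, hK, hKs⟩ := hc.image_closedBall_subset_compact (f := (T : H →ₗ[ℝ] H)) 1
    have hin : ∀ n, T (e (G n)) ∈ K := fun n =>
      hKs ⟨e (G n), by simp [he1], rfl⟩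
    obtain ⟨a, -, s, hsm, hsa⟩ := hK.tendsto_subseq hin
    have hcau := hsa.cauchySeq
    obtain ⟨N, hN⟩ := Metric.cauchySeq_iff'.1 hcau c h
    have h1 := hN (N + 1) (Nat.le_succ N)
    have hlt : s N < s (N + 1) := hsm (Nat.lt_succ_self N)
    rw [dist_eq_norm] at h1
    have h2 : ‖T (e (G (s (N + 1)))) - T (e (G (s N)))‖ ^ 2 =
        l (G (s (N + 1))) ^ 2 + l (G (s N)) ^ 2 := by
      have hz := horth _ _ hlt
      rw [hel, hel, @norm_sub_sq_real, norm_smul, norm_smul, he1, he1, real_inner_smul_left,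
        real_inner_smul_right, real_inner_comm, hz]
      simp
    have h3 : c ≤ l (G (s N)) := ciInf_le hbdd _
    have h4 : ‖T (e (G (s (N + 1)))) - T (e (G (s N)))‖ ^ 2 < c ^ 2 :=
      pow_lt_pow_left₀ h1 (norm_nonneg _) two_ne_zero
    nlinarith [sq_nonneg (l (G (s (N + 1))))]
  -- A vector orthogonal to all `e_n` has Rayleigh quotient at most `l_n` for every `n`, hence at
  -- most `0`, against positive definiteness.
  have hbot : (Submodule.span ℝ (range fun n => e (G n)))ᗮ = ⊥ := by
    rw [Submodule.eq_bot_iff]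
    intro x hx
    have hG0 : ∀ n, x ∈ (G n).1ᗮ := by
      intro n
      refine Submodule.orthogonal_le ?_ hx
      induction n with
      | zero => exact bot_le
      | succ n ih =>
        rw [hG]
        refine sup_le ih (Submodule.span_mono ?_)
        rintro _ rfl
        exact ⟨n, rfl⟩
    by_contra h0
    have h1 : ∀ n, inner ℝ (T x) x ≤ l (G n) * ‖x‖ ^ 2 := fun n => hmax _ _ (hG0 n)
    have h2 : inner ℝ (T x) x ≤ 0 * ‖x‖ ^ 2 :=
      ge_of_tendsto' (hlim.mul_const _) h1
    linarith [hpos x h0]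
  refine ⟨HilbertBasis.mkOfOrthogonalEqBot hon hbot, fun n => l (G n), fun n => ?_, hlpos, hanti,
    hlim⟩
  rw [HilbertBasis.coe_mkOfOrthogonalEqBot]
  exact hel _

end Spectral

/-! ### Cauchy–Schwarz, translations in `L²`, and finite colourings. -/

section Basic

variable {d : ℕ}

theorem ofReal_sq_eq_enorm_sq (t : ℝ) : ENNReal.ofReal (t ^ 2) = ‖t‖ₑ ^ 2 := by
  rw [← sq_abs, ENNReal.ofReal_pow (abs_nonneg t), Real.enorm_eq_ofReal_abs]

theorem ofReal_sq_add_le (a b : ℝ) :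
    ENNReal.ofReal ((a + b) ^ 2) ≤ 2 * ENNReal.ofReal (a ^ 2) + 2 * ENNReal.ofReal (b ^ 2) := by
  rw [← ENNReal.ofReal_ofNat, ← ENNReal.ofReal_mul (by norm_num), ← ENNReal.ofReal_mul (by norm_num),
    ← ENNReal.ofReal_add (by positivity) (by positivity)]
  exact ENNReal.ofReal_le_ofReal (by nlinarith [sq_nonneg (a - b)])

theorem ofReal_sq_sub_le (a b : ℝ) :
    ENNReal.ofReal ((a - b) ^ 2) ≤ 2 * ENNReal.ofReal (a ^ 2) + 2 * ENNReal.ofReal (b ^ 2) := by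
  simpa [sub_eq_add_neg] using ofReal_sq_add_le a (-b)

theorem sq_lintegral_le {α : Type*} [MeasurableSpace α] (σ : Measure α) {f : α → ℝ≥0∞}
    (hf : AEMeasurable f σ) : (∫⁻ x, f x ∂σ) ^ 2 ≤ σ univ * ∫⁻ x, f x ^ 2 ∂σ := by
  have h := ENNReal.lintegral_mul_le_Lp_mul_Lq σ (Real.HolderConjugate.two_two)
    (aemeasurable_const (b := (1 : ℝ≥0∞))) hf
  simp only [Pi.mul_apply, one_mul, ENNReal.one_rpow, lintegral_const] at h
  calc (∫⁻ x, f x ∂σ) ^ 2 ≤ (σ univ ^ (1 / (2 : ℝ)) *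
        (∫⁻ x, f x ^ (2 : ℝ) ∂σ) ^ (1 / (2 : ℝ))) ^ 2 := by gcongr
    _ = σ univ * ∫⁻ x, f x ^ 2 ∂σ := by
      rw [mul_pow, ← ENNReal.rpow_natCast, ← ENNReal.rpow_natCast, ← ENNReal.rpow_mul,
        ← ENNReal.rpow_mul]
      simp

theorem sq_lintegral_mul_le {α : Type*} [MeasurableSpace α] {σ : Measure α} {r f : α → ℝ≥0∞}
    (hr : AEMeasurable r σ) (hf : AEMeasurable f σ) :
    (∫⁻ x, r x * f x ∂σ) ^ 2 ≤ (∫⁻ x, r x ∂σ) * ∫⁻ x, r x * f x ^ 2 ∂σ := by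
  have h := sq_lintegral_le (σ.withDensity r) (hf.mono_ac (withDensity_absolutelyContinuous σ r))
  rw [lintegral_withDensity_eq_lintegral_mul₀ hr hf,
    lintegral_withDensity_eq_lintegral_mul₀ hr (hf.pow_const 2), withDensity_apply _ MeasurableSet.univ,
    Measure.restrict_univ] at h
  exact h

/-- The translates `y ↦ g (y - x)` of a function `g` in `L²`. -/
noncomputable def translate (g : Lp ℝ 2 (volume : Measure (Space d))) (x : Space d) :
    Lp ℝ 2 (volume : Measure (Space d)) :=
  DomAddAct.mk (-x) +ᵥ g

theorem continuous_translate (g : Lp ℝ 2 (volume : Measure (Space d))) :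
    Continuous (translate g) := by
  have h : Continuous fun x : Space d => DomAddAct.mk (-x) :=
    DomAddAct.continuous_mk.comp continuous_neg
  have : Fact ((2 : ℝ≥0∞) ≠ ∞) := ⟨by norm_num⟩
  exact h.vadd continuous_const

theorem translate_ae_eq {g : Space d → ℝ} (hg : MemLp g 2 volume) (x : Space d) :
    translate (hg.toLp g) x =ᵐ[volume] fun y => g (y - x) := by
  have h1 : translate (hg.toLp g) x =ᵐ[volume] fun y => (hg.toLp g) (-x + y) :=
    DomAddAct.vadd_Lp_ae_eq _ _
  have h2 : (fun y => (hg.toLp g) (-x + y)) =ᵐ[volume] fun y => g (-x + y) :=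
    (quasiMeasurePreserving_add_left volume (-x)).ae_eq_comp hg.coeFn_toLp
  filter_upwards [h1, h2] with y h1 h2
  rw [h1, h2, sub_eq_neg_add]

theorem inner_translate {f g : Space d → ℝ} (hf : MemLp f 2 volume) (hg : MemLp g 2 volume)
    (x : Space d) : inner ℝ (translate (hg.toLp g) x) (hf.toLp f) = ∫ y, g (y - x) * f y := by
  rw [L2.inner_def]
  refine integral_congr_ae ?_
  filter_upwards [translate_ae_eq hg x, hf.coeFn_toLp] with y h1 h2
  rw [h1, h2]
  simp [mul_comm]

/-- Translation is continuous in `L²`. The resulting continuity of correlations gives the openness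
of superlevel sets of `x ↦ ∫_A ν(h - x) dh` and the rigidity of zero energy. -/
theorem continuous_integral_mul_translate {f g : Space d → ℝ} (hf : MemLp f 2 volume)
    (hg : MemLp g 2 volume) : Continuous fun x => ∫ y, g (y - x) * f y := by
  simp_rw [← inner_translate hf hg]
  exact (continuous_translate _).inner continuous_const

/-- Two functions in `S` of the same colour have small distance in `L²(A)`, for suitable finite
colourings: the set `S` is totally bounded for the `L²(A)`-distance. -/
def FinitelyColourable (S : Set (Space d → ℝ)) (A : Set (Space d)) : Prop :=
  ∀ ε : ℝ≥0∞, 0 < ε → ∃ (ι : Type) (_ : Finite ι) (c : (Space d → ℝ) → ι), ∀ u ∈ S, ∀ v ∈ S,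
    c u = c v → ∫⁻ x in A, ENNReal.ofReal ((u x - v x) ^ 2) ≤ ε

/-- Bounded sets in a proper space have finite `δ/2`-nets; the colour of `u` is a net point near `L
u`. -/
theorem exists_colouring_of_bounded {α H : Type*} [PseudoMetricSpace H] [ProperSpace H]
    (S : Set α) (L : α → H) (hL : Bornology.IsBounded (L '' S)) {δ : ℝ} (hδ : 0 < δ) :
    ∃ (n : ℕ) (c : α → Fin (n + 1)), ∀ u ∈ S, ∀ v ∈ S, c u = c v → dist (L u) (L v) < δ := by
  obtain ⟨t, ht, hcov⟩ := Metric.totallyBounded_iff.1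
    ((Metric.isCompact_of_isClosed_isBounded isClosed_closure hL.closure).totallyBounded.subset
      subset_closure) (δ / 2) (half_pos hδ)
  -- The extra colour `none` serves points outside `S` and keeps the colour set nonempty even when
  -- the net is empty.
  have : ∀ u, ∃ i : Option t, u ∈ S → ∃ y : t, i = some y ∧ dist (L u) (y : H) < δ / 2 := by
    intro u
    by_cases hu : u ∈ S
    · obtain ⟨y, hy, hd⟩ := mem_iUnion₂.1 (hcov (mem_image_of_mem L hu))
      exact ⟨some ⟨y, hy⟩, fun _ => ⟨⟨y, hy⟩, rfl, hd⟩⟩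
    · exact ⟨none, fun h => absurd h hu⟩
  choose c hc using this
  have := ht.to_subtype
  have e := Finite.equivFin (Option t)
  have hpos : 0 < Nat.card (Option t) := Nat.card_pos
  obtain ⟨n, hn⟩ := Nat.exists_eq_succ_of_ne_zero hpos.ne'
  rw [hn] at e
  refine ⟨n, fun u => e (c u), fun u hu v hv h => ?_⟩
  obtain ⟨y, hy, h1⟩ := hc u hu
  obtain ⟨z, hz, h2⟩ := hc v hv
  have h' := e.injective h
  rw [hy, hz, Option.some_inj] at h'
  subst h'
  calc dist (L u) (L v) ≤ dist (L u) y + dist (L v) y := dist_triangle_right _ _ _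
    _ < δ := by linarith

/-- A bounded set in a Hilbert space is totally bounded for the seminorm
`w ↦ sup_{x ∈ K} |⟨Φ x, w⟩|` when `Φ` is continuous and `K` is compact. -/
theorem exists_colouring_inner {α X H : Type*} [TopologicalSpace X] [NormedAddCommGroup H]
    [InnerProductSpace ℝ H] (S : Set α) (L : α → H) {R : ℝ} (hL : ∀ u ∈ S, ‖L u‖ ≤ R)
    {Φ : X → H} (hΦ : Continuous Φ) {K : Set X} (hK : IsCompact K) {δ : ℝ} (hδ : 0 < δ) :
    ∃ (n : ℕ) (c : α → Fin (n + 1)), ∀ u ∈ S, ∀ v ∈ S, c u = c v →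
      ∀ x ∈ K, |inner ℝ (Φ x) (L u - L v)| ≤ δ := by
  rcases S.eq_empty_or_nonempty with rfl | ⟨u₀, hu₀⟩
  · exact ⟨0, fun _ => 0, by simp⟩
  have hR : 0 ≤ R := (norm_nonneg _).trans (hL u₀ hu₀)
  -- Replacing `Φ x` by a net point costs at most `η * 2R ≤ δ / 2`; the other `δ / 2` comes from
  -- colouring the finitely many coordinates.
  set η := δ / (4 * (R + 1)) with hη
  have hη0 : 0 < η := by positivity
  obtain ⟨t, ht, hcov⟩ := Metric.totallyBounded_iff.1 (hK.image hΦ).totallyBounded η hη0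
  have := ht.fintype
  have hbd : Bornology.IsBounded ((fun u => fun y : t => inner ℝ (y : H) (L u)) '' S) := by
    rw [Bornology.forall_isBounded_image_eval_iff.symm]
    intro y
    rw [isBounded_iff_forall_norm_le]
    refine ⟨‖(y : H)‖ * R, ?_⟩
    rintro _ ⟨_, ⟨u, hu, rfl⟩, rfl⟩
    exact (norm_inner_le_norm _ _).trans (mul_le_mul_of_nonneg_left (hL u hu) (norm_nonneg _))
  obtain ⟨n, c, hc⟩ := exists_colouring_of_bounded S _ hbd (half_pos hδ)
  refine ⟨n, c, fun u hu v hv h x hx => ?_⟩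
  obtain ⟨y, hy, hxy⟩ := mem_iUnion₂.1 (hcov (mem_image_of_mem Φ hx))
  have h1 := (dist_pi_lt_iff (half_pos hδ)).1 (hc u hu v hv h) ⟨y, hy⟩
  rw [Real.dist_eq] at h1
  have h2 : ‖L u - L v‖ ≤ 2 * R := (norm_sub_le _ _).trans (by linarith [hL u hu, hL v hv])
  have h3 : |inner ℝ (Φ x - y) (L u - L v)| ≤ η * (2 * R) :=
    (abs_real_inner_le_norm _ _).trans (by
      rw [Metric.mem_ball, dist_eq_norm] at hxy
      gcongr)
  have h4 : η * (2 * R) ≤ δ / 2 := by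
    rw [hη, div_mul_eq_mul_div, div_le_div_iff₀ (by positivity) (by norm_num)]
    nlinarith
  have h5 : inner ℝ (Φ x) (L u - L v) = inner ℝ (Φ x - y) (L u - L v) +
      (inner ℝ y (L u) - inner ℝ y (L v)) := by
    rw [inner_sub_left, ← inner_sub_right]; ring
  rw [h5]
  calc _ ≤ _ := abs_add_le _ _
    _ ≤ δ := by linarith

end Basic

/-! ### Compactness away from the boundary. -/

section LocalCompactness

variable {d : ℕ} {ν : Space d → ℝ≥0} {U A B : Set (Space d)} {u v : Space d → ℝ}

theorem aemeasurable_comp_sub {β : Type*} [MeasurableSpace β] {f : Space d → β}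
    (hf : AEMeasurable f volume) :
    AEMeasurable (fun p : Space d × Space d => f (p.1 - p.2))
      ((volume : Measure (Space d)).prod volume) :=
  hf.comp_quasiMeasurePreserving (quasiMeasurePreserving_sub volume volume)

theorem aemeasurable_energy (hν : AEMeasurable ν volume)
    (hA : AEMeasurable u (volume.restrict A)) (hB : AEMeasurable u (volume.restrict B)) :
    AEMeasurable (fun p : Space d × Space d =>
      ENNReal.ofReal ((u p.1 - u p.2) ^ 2) * (ν (p.1 - p.2) : ℝ≥0∞))
      (((volume : Measure (Space d)).prod volume).restrict (A ×ˢ B)) := by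
  refine AEMeasurable.mul ?_ (aemeasurable_comp_sub hν).restrict.coe_nnreal_ennreal
  rw [← Measure.prod_restrict]
  refine ENNReal.measurable_ofReal.comp_aemeasurable (AEMeasurable.pow_const ?_ 2)
  exact (hA.comp_quasiMeasurePreserving Measure.quasiMeasurePreserving_fst).sub
    (hB.comp_quasiMeasurePreserving Measure.quasiMeasurePreserving_snd)

theorem energyOn_eq_lintegral (hν : AEMeasurable ν volume)
    (hA : AEMeasurable u (volume.restrict A)) (hB : AEMeasurable u (volume.restrict B)) :
    energyOn ν A B u = ∫⁻ x in A, ∫⁻ y in B,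
      ENNReal.ofReal ((u x - u y) ^ 2) * (ν (x - y) : ℝ≥0∞) := by
  have h := aemeasurable_energy hν hA hB
  rw [energyOn]
  rw [← Measure.prod_restrict] at h ⊢
  exact lintegral_prod _ h

theorem energyOn_mono {A' B' : Set (Space d)} (hA : A ⊆ A') (hB : B ⊆ B') :
    energyOn ν A B u ≤ energyOn ν A' B' u :=
  lintegral_mono_set (prod_mono hA hB)

theorem energyOn_sub_le (hν : AEMeasurable ν volume)
    (hA : AEMeasurable u (volume.restrict A)) (hB : AEMeasurable u (volume.restrict B)) :
    energyOn ν A B (fun x => u x - v x) ≤ 2 * energyOn ν A B u + 2 * energyOn ν A B v := by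
  simp only [energyOn]
  rw [← lintegral_const_mul' _ _ (by norm_num), ← lintegral_const_mul' _ _ (by norm_num),
    ← lintegral_add_left' ((aemeasurable_energy hν hA hB).const_mul 2)]
  refine lintegral_mono fun p => ?_
  rw [← mul_assoc, ← mul_assoc, ← add_mul]
  gcongr
  refine le_trans (le_of_eq ?_) (ofReal_sq_sub_le (u p.1 - u p.2) (v p.1 - v p.2))
  congr 2
  ring

theorem energyOn_congr (hA : u =ᵐ[volume.restrict A] v) (hB : u =ᵐ[volume.restrict B] v) :
    energyOn ν A B u = energyOn ν A B v := by
  simp only [energyOn]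
  rw [← Measure.prod_restrict]
  refine lintegral_congr_ae ?_
  filter_upwards [Measure.quasiMeasurePreserving_fst.ae hA,
    Measure.quasiMeasurePreserving_snd.ae hB] with p h1 h2
  rw [h1, h2]

theorem lintegral_sq_eq {α : Type*} [MeasurableSpace α] (σ : Measure α) (f : α → ℝ) :
    ∫⁻ x, ENNReal.ofReal (f x ^ 2) ∂σ = eLpNorm f 2 σ ^ 2 := by
  simp_rw [ofReal_sq_eq_enorm_sq]
  rw [eLpNorm_eq_lintegral_rpow_enorm_toReal (by norm_num) (by norm_num), ← ENNReal.rpow_natCast,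
    ← ENNReal.rpow_mul]
  simp

theorem lintegral_nu_ball_compl_lt_top (hν : IsLevyDensity ν) {r : ℝ} (hr : 0 < r) :
    ∫⁻ h in (Metric.ball 0 r)ᶜ, (ν h : ℝ≥0∞) < ∞ := by
  have hc : 0 < min 1 (r ^ 2) := by positivity
  have h1 : ∫⁻ h in (Metric.ball 0 r)ᶜ, ENNReal.ofReal (min 1 (r ^ 2)) * (ν h : ℝ≥0∞) < ∞ := by
    refine lt_of_le_of_lt ?_ hν.levy
    refine le_trans (setLIntegral_mono' Metric.isOpen_ball.measurableSet.compl fun h hh => ?_)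
      (setLIntegral_le_lintegral _ _)
    simp only [mem_compl_iff, Metric.mem_ball, dist_zero_right, not_lt] at hh
    gcongr
  rw [lintegral_const_mul' _ _ ENNReal.ofReal_ne_top] at h1
  exact (ENNReal.mul_lt_top_iff.1 h1).elim (fun h => h.2) fun h => by
    rcases h with h | h
    · exact absurd h (ENNReal.ofReal_pos.2 hc).ne'
    · rw [h]; exact ENNReal.zero_lt_top

/-- The Lévy condition makes the tail finite, so the infinite mass sits at the origin. Truncations
of large mass can therefore have arbitrarily small support. -/
theorem lintegral_nu_ball_eq_top (hν : IsLevyDensity ν) (htop : ∫⁻ h, (ν h : ℝ≥0∞) = ∞) {r : ℝ}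
    (hr : 0 < r) : ∫⁻ h in Metric.ball 0 r, (ν h : ℝ≥0∞) = ∞ := by
  rw [← lintegral_add_compl _ (Metric.isOpen_ball (x := (0 : Space d)) (ε := r)).measurableSet] at htop
  exact (ENNReal.add_eq_top.1 htop).resolve_right (lintegral_nu_ball_compl_lt_top hν hr).ne

theorem memLp_truncation (hν : AEMeasurable ν volume) (r : ℝ) (j : ℕ) (p : ℝ≥0∞) :
    MemLp (fun h => (((Metric.ball 0 r).indicator (fun h => min (ν h) (j : ℝ≥0)) h : ℝ≥0) : ℝ)) p
      volume := by
  have hball := (Metric.isOpen_ball (x := (0 : Space d)) (ε := r)).measurableSet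
  have h1 : MemLp ((Metric.ball (0 : Space d) r).indicator fun _ => (j : ℝ)) p volume :=
    memLp_indicator_const p hball _ (Or.inr Metric.isBounded_ball.measure_lt_top.ne)
  refine h1.mono ((hν.min aemeasurable_const).indicator
    hball).coe_nnreal_real.aestronglyMeasurable (ae_of_all _ fun h => ?_)
  by_cases hh : h ∈ Metric.ball 0 r
  · rw [indicator_of_mem hh, indicator_of_mem hh, Real.norm_of_nonneg (NNReal.coe_nonneg _),
      Real.norm_of_nonneg (Nat.cast_nonneg _)]
    exact_mod_cast min_le_right _ _
  · simp [indicator_of_notMem hh]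

/-- Truncations of `ν`: bounded, supported in a small ball, of large mass. -/
theorem exists_truncation (hν : IsLevyDensity ν) (htop : ∫⁻ h, (ν h : ℝ≥0∞) = ∞) {r : ℝ}
    (hr : 0 < r) (N : ℝ≥0) : ∃ ρ : Space d → ℝ≥0, AEMeasurable ρ volume ∧ ρ ≤ ν ∧
      (∀ h, r ≤ ‖h‖ → ρ h = 0) ∧ (N : ℝ≥0∞) < ∫⁻ h, (ρ h : ℝ≥0∞) ∧
      MemLp (fun h => (ρ h : ℝ)) 2 volume ∧ Integrable (fun h => (ρ h : ℝ)) volume := by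
  have hball := (Metric.isOpen_ball (x := (0 : Space d)) (ε := r)).measurableSet
  let τ : ℕ → Space d → ℝ≥0 := fun j => (Metric.ball 0 r).indicator fun h => min (ν h) j
  have hτm : ∀ j, AEMeasurable (τ j) volume := fun j =>
    (hν.aemeasurable.min aemeasurable_const).indicator hball
  have hlim : ∫⁻ h, ⨆ j, (τ j h : ℝ≥0∞) = ⨆ j, ∫⁻ h, (τ j h : ℝ≥0∞) := by
    refine lintegral_iSup' (fun j => (hτm j).coe_nnreal_ennreal) (ae_of_all _ fun h i j hij => ?_)
    simp only [τ, indicator]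
    split_ifs
    · exact ENNReal.coe_le_coe.2 (min_le_min_left _ (by exact_mod_cast hij))
    · exact le_rfl
  have hsup : ∫⁻ h, ⨆ j, (τ j h : ℝ≥0∞) = ∞ := by
    rw [eq_top_iff, ← lintegral_nu_ball_eq_top hν htop hr, ← lintegral_indicator hball]
    refine lintegral_mono fun h => ?_
    simp only [τ, indicator]
    split_ifs
    · obtain ⟨j, hj⟩ := exists_nat_ge (ν h)
      refine le_iSup_of_le j ?_
      rw [min_eq_left hj]
    · exact zero_le
  rw [hsup] at hlim
  obtain ⟨j, hj⟩ := lt_iSup_iff.1 (hlim ▸ ENNReal.coe_lt_top (r := N))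
  refine ⟨τ j, hτm j, fun h => ?_, fun h hh => ?_, hj,
    memLp_truncation hν.aemeasurable r j 2,
    memLp_one_iff_integrable.1 (memLp_truncation hν.aemeasurable r j 1)⟩
  · simp only [τ, indicator]
    split_ifs
    · exact min_le_left _ _
    · exact zero_le
  · simp [τ, hh]

/-- The mean value of `u` near `x` approximates `u x` up to the energy density. -/
theorem sq_mul_le_energy_add_mean {ρ : Space d → ℝ≥0} (hν : IsLevyDensity ν)
    (hρm : AEMeasurable ρ volume) (hρν : ρ ≤ ν)
    (hρ2 : MemLp (fun h => (ρ h : ℝ)) 2 volume) (hρ1 : Integrable (fun h => (ρ h : ℝ)) volume)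
    {r : ℝ} (hρr : ∀ h, r ≤ ‖h‖ → ρ h = 0) (hU : MeasurableSet U)
    (hu : MemLp u 2 (volume.restrict U)) {x : Space d} (hx : Metric.ball x r ⊆ U) :
    (∫⁻ h, (ρ h : ℝ≥0∞)) ^ 2 * ENNReal.ofReal (u x ^ 2) ≤
      2 * ((∫⁻ h, (ρ h : ℝ≥0∞)) *
        ∫⁻ y in U, ENNReal.ofReal ((u x - u y) ^ 2) * (ν (x - y) : ℝ≥0∞)) +
      2 * ENNReal.ofReal ((∫ y, ρ (y - x) * U.indicator u y) ^ 2) := by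
  set N := ∫⁻ h, (ρ h : ℝ≥0∞) with hN
  have huI : MemLp (U.indicator u) 2 volume := (memLp_indicator_iff_restrict hU).2 hu
  have hρx1 : Integrable (fun y => (ρ (y - x) : ℝ)) volume := hρ1.comp_sub_right x
  have hρx2 : MemLp (fun y => (ρ (y - x) : ℝ)) 2 volume :=
    hρ2.comp_measurePreserving (measurePreserving_sub_right volume x)
  have hρxm : AEMeasurable (fun y => ρ (y - x)) volume :=
    hρm.comp_quasiMeasurePreserving (measurePreserving_sub_right volume x).quasiMeasurePreserving
  have hint : Integrable (fun y => (ρ (y - x) : ℝ) * U.indicator u y) volume :=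
    hρx2.integrable_mul huI
  have hNx : ∫⁻ y, (ρ (y - x) : ℝ≥0∞) = N := lintegral_sub_right_eq_self (fun y => (ρ y : ℝ≥0∞)) x
  have hNr : ENNReal.ofReal (∫ y, (ρ (y - x) : ℝ)) = N := by
    rw [ofReal_integral_eq_lintegral_ofReal hρx1 (ae_of_all _ fun y => NNReal.coe_nonneg _), ← hNx]
    simp
  set Nr := ∫ y, (ρ (y - x) : ℝ) with hNrdef
  have hNr0 : 0 ≤ Nr := integral_nonneg fun y => NNReal.coe_nonneg _
  set m := ∫ y, ρ (y - x) * U.indicator u y with hm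
  -- Cauchy–Schwarz with weight `ρ (y - x)` then bounds the square of this error by the mass times
  -- the energy density at `x`. Extending `u` by zero off `U` is harmless, since `ρ (y - x)`
  -- vanishes there.
  have hdiff : Nr * u x - m = ∫ y, (ρ (y - x) : ℝ) * (u x - U.indicator u y) := by
    simp_rw [mul_sub]
    rw [integral_sub (hρx1.mul_const _) hint, integral_mul_const]
  have h1 : ENNReal.ofReal ((Nr * u x - m) ^ 2) ≤
      N * ∫⁻ y in U, ENNReal.ofReal ((u x - u y) ^ 2) * (ν (x - y) : ℝ≥0∞) := by
    rw [ofReal_sq_eq_enorm_sq, hdiff]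
    calc _ ≤ (∫⁻ y, ‖(ρ (y - x) : ℝ) * (u x - U.indicator u y)‖ₑ) ^ 2 := by
          gcongr; exact enorm_integral_le_lintegral_enorm _
      _ = (∫⁻ y, (ρ (y - x) : ℝ≥0∞) * ‖u x - U.indicator u y‖ₑ) ^ 2 := by
          simp_rw [enorm_mul]
          simp [Real.enorm_of_nonneg]
      _ ≤ (∫⁻ y, (ρ (y - x) : ℝ≥0∞)) * ∫⁻ y, (ρ (y - x) : ℝ≥0∞) * ‖u x - U.indicator u y‖ₑ ^ 2 :=
          sq_lintegral_mul_le hρxm.coe_nnreal_ennreal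
            (aemeasurable_const.sub huI.1.aemeasurable).enorm
      _ ≤ _ := by
          rw [hNx, ← lintegral_indicator hU]
          refine mul_le_mul_right (lintegral_mono fun y => ?_) _
          by_cases hy : y ∈ U
          · rw [indicator_of_mem hy, indicator_of_mem hy, ofReal_sq_eq_enorm_sq, mul_comm]
            have : ρ (y - x) ≤ ν (x - y) := by
              rw [← hν.symm, neg_sub]; exact hρν _
            gcongr
          · have : ρ (y - x) = 0 := by
              refine hρr _ ?_
              by_contra hlt
              exact hy (hx (by rw [Metric.mem_ball, dist_eq_norm]; exact not_le.1 hlt))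
            simp [this]
  calc N ^ 2 * ENNReal.ofReal (u x ^ 2) = ENNReal.ofReal (((Nr * u x - m) + m) ^ 2) := by
        rw [sub_add_cancel, mul_pow, ENNReal.ofReal_mul (by positivity), ENNReal.ofReal_pow hNr0,
          hNr]
    _ ≤ _ := ofReal_sq_add_le _ _
    _ ≤ _ := by gcongr

/-- **Local compactness**: sets that are bounded in `H_ν(U)` are totally bounded in `L²(K)` for
compact `K ⊆ U`, because `ν` is not integrable. -/
theorem finitelyColourable_of_isCompact (hν : IsLevyDensity ν) (htop : ∫⁻ h, (ν h : ℝ≥0∞) = ∞)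
    (hU : IsOpen U) {K : Set (Space d)} (hK : IsCompact K) (hKU : K ⊆ U) {R : ℝ≥0∞} (hR : R ≠ ∞) :
    FinitelyColourable {u | MemH ν U u ∧ normSqH ν U u ≤ R} K := by
  intro ε hε
  obtain ⟨r, hr, hrU⟩ := hK.exists_thickening_subset_open hU hKU
  by_cases hεt : ε = ∞
  · exact ⟨Unit, inferInstance, fun _ => (), by simp [hεt]⟩
  lift R to ℝ≥0 using hR
  lift ε to ℝ≥0 using hεt
  have hε' : 0 < ε := by exact_mod_cast hε
  -- A difference of two members has energy at most `4R`, contributing `2N * 4R`. A mass `N ≥ 16R /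
  -- ε` makes this at most half of `N² ε`.
  obtain ⟨ρ, hρm, hρν, hρr, hρN, hρ2, hρ1⟩ := exists_truncation hν htop hr (16 * R / ε + 1)
  set N := ∫⁻ h, (ρ h : ℝ≥0∞) with hN
  have hNt : N ≠ ∞ := by
    have := hρ1.2
    simp only [HasFiniteIntegral] at this
    simpa [Real.enorm_of_nonneg, hN] using this.ne
  have hN0 : 0 < N := lt_of_le_of_lt zero_le hρN
  classical
  let L : (Space d → ℝ) → Lp ℝ 2 (volume : Measure (Space d)) := fun u =>
    if h : MemLp (U.indicator u) 2 volume then h.toLp _ else 0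
  set S := {u | MemH ν U u ∧ normSqH ν U u ≤ R}
  have hmem : ∀ u : Space d → ℝ, MemLp u 2 (volume.restrict U) → MemLp (U.indicator u) 2 volume := fun u hu =>
    (memLp_indicator_iff_restrict hU.measurableSet).2 hu
  have hLu : ∀ u ∈ S, ‖L u‖ ≤ Real.sqrt R := by
    intro u hu
    have h := hmem u hu.1.1
    simp only [L, dif_pos h, Lp.norm_toLp]
    refine Real.le_sqrt_of_sq_le ?_
    have h2 : eLpNorm (U.indicator u) 2 volume ^ 2 ≤ R := by
      rw [eLpNorm_indicator_eq_eLpNorm_restrict hU.measurableSet, ← lintegral_sq_eq]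
      exact le_self_add.trans hu.2
    rw [← ENNReal.toReal_pow]
    exact ENNReal.toReal_le_coe_of_le_coe h2
  have hKfin : volume K ≠ ∞ := hK.measure_lt_top.ne
  -- The tolerance for the averages, chosen after `N`, so that they contribute the other half of `N²
  -- ε`.
  obtain ⟨δ, hδ0, hδ⟩ : ∃ δ : ℝ, 0 < δ ∧ 2 * ENNReal.ofReal (δ ^ 2) * volume K ≤ ε / 2 * N ^ 2 := by
    have hpos : 0 < (ε / 2 * N ^ 2 : ℝ≥0∞) := by
      refine ENNReal.mul_pos (ENNReal.half_pos hε.ne').ne' (pow_ne_zero 2 hN0.ne')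
    have hlim : Tendsto (fun δ : ℝ => 2 * ENNReal.ofReal (δ ^ 2) * volume K) (𝓝[>] 0) (𝓝 0) := by
      have h0 : Tendsto (fun δ : ℝ => ENNReal.ofReal (δ ^ 2)) (𝓝 0) (𝓝 0) := by
        have : Continuous fun δ : ℝ => ENNReal.ofReal (δ ^ 2) :=
          ENNReal.continuous_ofReal.comp (continuous_pow 2)
        simpa using this.tendsto 0
      have h1 := ENNReal.Tendsto.mul_const (ENNReal.Tendsto.const_mul h0 (a := 2)
        (Or.inr (by norm_num))) (b := volume K) (Or.inr hKfin)
      simp only [mul_zero, zero_mul] at h1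
      exact h1.mono_left nhdsWithin_le_nhds
    obtain ⟨δ, hδ1, hδ2⟩ := ((hlim.eventually_lt_const hpos).and self_mem_nhdsWithin).exists
    exact ⟨δ, hδ2, hδ1.le⟩
  -- The average of `u` around `x` is the pairing of `L u` with the translate of `ρ` by `x`, and
  -- these translates over `K` form a compact set.
  obtain ⟨n, c, hc⟩ := exists_colouring_inner S L hLu
    (continuous_translate (hρ2.toLp _)) hK hδ0
  refine ⟨Fin (n + 1), inferInstance, c, fun u hu v hv huv => ?_⟩
  have hw2 : MemLp (fun x => u x - v x) 2 (volume.restrict U) := hu.1.1.sub hv.1.1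
  have hmean : ∀ x ∈ K, ENNReal.ofReal ((∫ y, ρ (y - x) *
      U.indicator (fun x => u x - v x) y) ^ 2) ≤ ENNReal.ofReal (δ ^ 2) := by
    intro x hx
    have h1 := hc u hu v hv huv x hx
    have h2 : L u - L v = (hmem _ hw2).toLp _ := by
      simp only [L, dif_pos (hmem u hu.1.1), dif_pos (hmem v hv.1.1)]
      rw [← MemLp.toLp_sub]
      refine MemLp.toLp_congr _ _ (ae_of_all _ fun y => ?_)
      by_cases hy : y ∈ U <;> simp [hy]
    rw [h2, inner_translate] at h1
    rw [← sq_abs]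
    exact ENNReal.ofReal_le_ofReal (pow_le_pow_left₀ (abs_nonneg _) h1 2)
  have hen : energyOn ν U U (fun x => u x - v x) ≤ 4 * R := by
    refine (energyOn_sub_le hν.aemeasurable hu.1.1.1.aemeasurable hu.1.1.1.aemeasurable).trans ?_
    have h1 : energyOn ν U U u ≤ R := le_add_self.trans hu.2
    have h2 : energyOn ν U U v ≤ R := le_add_self.trans hv.2
    calc _ ≤ 2 * (R : ℝ≥0∞) + 2 * R := by gcongr
      _ = 4 * R := by rw [← add_mul]; norm_num
  have hmain : N ^ 2 * ∫⁻ x in K, ENNReal.ofReal ((u x - v x) ^ 2) ≤ N ^ 2 * ε := by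
    rw [← lintegral_const_mul' _ _ (ENNReal.pow_ne_top hNt)]
    calc ∫⁻ x in K, N ^ 2 * ENNReal.ofReal ((u x - v x) ^ 2)
        ≤ ∫⁻ x in K, (2 * N * ∫⁻ y in U, ENNReal.ofReal (((u x - v x) - (u y - v y)) ^ 2) *
            (ν (x - y) : ℝ≥0∞)) + 2 * ENNReal.ofReal (δ ^ 2) := by
          refine setLIntegral_mono' hK.measurableSet fun x hx => ?_
          refine (sq_mul_le_energy_add_mean hν hρm hρν hρ2 hρ1 hρr hU.measurableSet hw2
            ((Metric.ball_subset_thickening hx r).trans hrU)).trans ?_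
          exact add_le_add (mul_assoc _ _ _).ge (mul_le_mul_right (hmean x hx) _)
      _ = 2 * N * (∫⁻ x in K, ∫⁻ y in U, ENNReal.ofReal (((u x - v x) - (u y - v y)) ^ 2) *
            (ν (x - y) : ℝ≥0∞)) + 2 * ENNReal.ofReal (δ ^ 2) * volume K := by
          rw [lintegral_add_right _ measurable_const, lintegral_const_mul' _ _
            (ENNReal.mul_ne_top (by norm_num) hNt)]
          simp
      _ ≤ 2 * N * (4 * R) + ε / 2 * N ^ 2 := by
          gcongr
          refine le_trans (lintegral_mono_set hKU) ?_
          rw [← energyOn_eq_lintegral hν.aemeasurable hw2.1.aemeasurable hw2.1.aemeasurable]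
          exact hen
      _ ≤ ε / 2 * N ^ 2 + ε / 2 * N ^ 2 := by
          refine add_le_add ?_ le_rfl
          have h8 : (16 * R : ℝ≥0∞) ≤ ε * N := by
            have : (16 * R / ε : ℝ≥0) ≤ N := by
              refine le_trans ?_ hρN.le
              exact_mod_cast le_self_add
            calc (16 * R : ℝ≥0∞) = ((ε * (16 * R / ε) : ℝ≥0) : ℝ≥0∞) := by
                  rw [mul_div_cancel₀ _ hε'.ne']; push_cast; rfl
              _ ≤ ε * N := by push_cast at this ⊢; gcongr
          calc 2 * N * (4 * R) = 16 * R * N / 2 := by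
                rw [ENNReal.div_eq_inv_mul, show (16 : ℝ≥0∞) = 2 * 8 by norm_num]
                rw [show (2 : ℝ≥0∞)⁻¹ * (2 * 8 * R * N) = (2⁻¹ * 2) * (8 * R * N) by ring,
                  ENNReal.inv_mul_cancel (by norm_num) (by norm_num)]
                ring
            _ ≤ (ε * N) * N / 2 := by gcongr
            _ = _ := by simp only [ENNReal.div_eq_inv_mul]; ring
      _ = N ^ 2 * ε := by rw [← add_mul, ENNReal.add_halves, mul_comm]
  exact (ENNReal.mul_le_mul_iff_right (pow_ne_zero 2 hN0.ne') (ENNReal.pow_ne_top hNt)).1 hmain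

end LocalCompactness

/-! ### Absence of concentration at the boundary: class `A₃`. -/

section Boundary

variable {d : ℕ} {ν : Space d → ℝ≥0} {Ω A : Set (Space d)} {u : Space d → ℝ}

/-- The `L²(Ω)`-norm is controlled by a small multiple of the energy and the `L²`-norm on a compact
subset of `Ω`: no mass concentrates at the boundary. -/
def NoBoundaryConcentration (ν : Space d → ℝ≥0) (Ω : Set (Space d)) : Prop :=
  ∀ η : ℝ≥0, 0 < η → ∃ K, IsCompact K ∧ K ⊆ Ω ∧ ∃ C : ℝ≥0, ∀ u, MemH ν Ω u →
    ∫⁻ x in Ω, ENNReal.ofReal (u x ^ 2) ≤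
      η * energyOn ν Ω Ω u + C * ∫⁻ x in K, ENNReal.ofReal (u x ^ 2)

/-- The integral is lower semicontinuous in `x`: it is the supremum over bounded, compactly cut-off
truncations of `ν`, each giving a continuous correlation. This turns a bound on `∂Ω` into a bound on
a neighbourhood. -/
theorem isOpen_setOf_lt_lintegral_translate (hν : AEMeasurable ν volume) (hA : MeasurableSet A)
    (hAfin : volume A ≠ ∞) (M : ℝ≥0∞) :
    IsOpen {x | M < ∫⁻ h in A, (ν (h - x) : ℝ≥0∞)} := by
  let τ : ℕ → Space d → ℝ≥0 := fun j => (Metric.ball 0 j).indicator fun h => min (ν h) j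
  have hτm : ∀ j, AEMeasurable (τ j) volume := fun j =>
    (hν.min aemeasurable_const).indicator Metric.isOpen_ball.measurableSet
  have hτ2 : ∀ j, MemLp (fun h => (τ j h : ℝ)) 2 volume := fun j => memLp_truncation hν _ j 2
  have hA2 : MemLp (A.indicator fun _ => (1 : ℝ)) 2 volume :=
    memLp_indicator_const 2 hA _ (Or.inr hAfin)
  have heq : ∀ x j, ∫⁻ h in A, (τ j (h - x) : ℝ≥0∞) =
      ENNReal.ofReal (∫ h, (τ j (h - x) : ℝ) * A.indicator (fun _ => (1 : ℝ)) h) := by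
    intro x j
    have h2 : MemLp (fun h => (τ j (h - x) : ℝ)) 2 volume :=
      (hτ2 j).comp_measurePreserving (measurePreserving_sub_right volume x)
    rw [ofReal_integral_eq_lintegral_ofReal (show Integrable (fun h =>
      (τ j (h - x) : ℝ) * A.indicator (fun _ => (1 : ℝ)) h) volume from h2.integrable_mul hA2) (ae_of_all _ fun h =>
      mul_nonneg (NNReal.coe_nonneg _) (indicator_nonneg (fun _ _ => zero_le_one) _)),
      ← lintegral_indicator hA]
    refine lintegral_congr fun h => ?_
    by_cases hh : h ∈ A <;> simp [hh]
  have hsup : ∀ x, ∫⁻ h in A, (ν (h - x) : ℝ≥0∞) = ⨆ j, ∫⁻ h in A, (τ j (h - x) : ℝ≥0∞) := by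
    intro x
    rw [← lintegral_iSup']
    · refine lintegral_congr fun h => le_antisymm ?_ (iSup_le fun j => ?_)
      · obtain ⟨j, hj⟩ := exists_nat_gt (max (ν (h - x) : ℝ) ‖h - x‖)
        rw [max_lt_iff] at hj
        refine le_iSup_of_le j ?_
        have : h - x ∈ Metric.ball (0 : Space d) j := by simpa using hj.2
        simp only [τ, indicator_of_mem this]
        rw [min_eq_left]
        exact_mod_cast hj.1.le
      · simp only [τ, indicator]
        split_ifs
        · exact_mod_cast min_le_left _ _
        · exact zero_le
    · exact fun j => ((hτm j).comp_quasiMeasurePreserving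
        (measurePreserving_sub_right volume x).quasiMeasurePreserving).restrict.coe_nnreal_ennreal
    · refine ae_of_all _ fun h i j hij => ?_
      have hsub : Metric.ball (0 : Space d) i ⊆ Metric.ball 0 j :=
        Metric.ball_subset_ball (by exact_mod_cast hij)
      simp only [τ, indicator]
      split_ifs with h1 h2 h2
      · exact ENNReal.coe_le_coe.2 (min_le_min_left _ (by exact_mod_cast hij))
      · exact absurd (hsub h1) h2
      · exact zero_le
      · exact le_rfl
  have : {x | M < ∫⁻ h in A, (ν (h - x) : ℝ≥0∞)} =
      ⋃ j, {x | M < ENNReal.ofReal (∫ h, (τ j (h - x) : ℝ) * A.indicator (fun _ => (1 : ℝ)) h)} := by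
    ext x
    simp only [mem_ofPred_eq, mem_iUnion, hsup, lt_iSup_iff, heq]
  rw [this]
  exact isOpen_iUnion fun j => isOpen_lt continuous_const
    (ENNReal.continuous_ofReal.comp (continuous_integral_mul_translate hA2 (hτ2 j)))

theorem closure_diff_subset_of_frontier_subset {O : Set (Space d)}
    (h : frontier Ω ⊆ O) : closure Ω \ O ⊆ Ω := by
  rintro x ⟨hx, hxO⟩
  by_contra hn
  exact hxO (h ⟨hx, fun hi => hn (interior_subset hi)⟩)

/-- For `x` near `∂Ω`, integrate `u(x)² ≤ 2 (u(x) - u(y))² + 2 u(y)²` against `ν(y - x)` over `y` in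
the inner part. The left side gains a large factor `M`; on the right stand the energy and the norm
of `u` on the inner part. -/
theorem ClassA3.noBoundaryConcentration (h : ClassA3 ν Ω) : NoBoundaryConcentration ν Ω := by
  intro η hη
  have hν := h.levyDensity
  have hΩm := h.isOpen.measurableSet
  -- Dividing by `M` at the end turns the factor `2` in front of the energy into `η`.
  set M : ℝ≥0 := 2 / η with hM
  have hM0 : 0 < M := by positivity
  obtain ⟨δ, hδM, hδ⟩ := ((h.tendsto_qTilde.eventually_const_lt
    (ENNReal.coe_lt_top (r := M))).and self_mem_nhdsWithin).exists
  have hδ : 0 < δ := hδ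
  have hcd : Continuous fun x => Metric.infDist x (frontier Ω) := Metric.continuous_infDist_pt _
  have hIm : MeasurableSet (innerPart Ω δ) := hΩm.inter (isOpen_lt continuous_const hcd).measurableSet
  have hIΩ : innerPart Ω δ ⊆ Ω := fun x hx => hx.1
  have hIfin : volume (innerPart Ω δ) ≠ ∞ := (h.isBounded.subset hIΩ).measure_lt_top.ne
  -- The second condition keeps `O` at distance at least `δ / 2` from the inner part, so that only
  -- the finite tail mass `C₁` of `ν` enters in the term with `u(y)²`.
  set O := {x | (M : ℝ≥0∞) < ∫⁻ y in innerPart Ω δ, (ν (y - x) : ℝ≥0∞)} ∩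
    {x | Metric.infDist x (frontier Ω) < δ / 2} with hO
  have hOo : IsOpen O := (isOpen_setOf_lt_lintegral_translate hν.aemeasurable hIm hIfin _).inter
    (isOpen_lt hcd continuous_const)
  have hfO : frontier Ω ⊆ O := by
    intro a ha
    refine ⟨lt_of_lt_of_le hδM (iInf₂_le a ha), ?_⟩
    simp only [mem_ofPred_eq, Metric.infDist_zero_of_mem ha]
    positivity
  have hcc : IsCompact (closure Ω) := h.isBounded.isCompact_closure
  set K₂ := closure Ω ∩ {x | δ ≤ Metric.infDist x (frontier Ω)}
  have hK₂ : IsCompact K₂ := hcc.inter_right (isClosed_le continuous_const hcd)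
  have hK₂Ω : K₂ ⊆ Ω := by
    refine Subset.trans ?_ (closure_diff_subset_of_frontier_subset hfO)
    rintro x ⟨hx, hxδ⟩
    refine ⟨hx, fun hxO => ?_⟩
    have : Metric.infDist x (frontier Ω) < δ / 2 := hxO.2
    simp only [mem_ofPred_eq] at hxδ
    linarith
  set C₁ := ∫⁻ z in (Metric.ball (0 : Space d) (δ / 2))ᶜ, (ν z : ℝ≥0∞) with hC₁
  have hC₁t : C₁ ≠ ∞ := (lintegral_nu_ball_compl_lt_top hν (half_pos hδ)).ne
  refine ⟨(closure Ω \ O) ∪ K₂, (hcc.diff hOo).union hK₂,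
    union_subset (closure_diff_subset_of_frontier_subset hfO) hK₂Ω,
    1 + η * C₁.toNNReal, fun u hu => ?_⟩
  set Y := ∫⁻ x in (closure Ω \ O) ∪ K₂, ENNReal.ofReal (u x ^ 2) with hY
  have hum : AEMeasurable u (volume.restrict Ω) := hu.1.1.aemeasurable
  have humI : AEMeasurable u (volume.restrict (innerPart Ω δ)) := hum.mono_set hIΩ
  have humO : AEMeasurable u (volume.restrict (Ω ∩ O)) := hum.mono_set inter_subset_left
  have h1 : ∫⁻ x in Ω, ENNReal.ofReal (u x ^ 2) ≤
      (∫⁻ x in Ω ∩ O, ENNReal.ofReal (u x ^ 2)) + Y := by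
    refine (lintegral_mono_set (t := (Ω ∩ O) ∪ ((closure Ω \ O) ∪ K₂)) fun x hx => ?_).trans
      (lintegral_union_le _ _ _)
    by_cases hxO : x ∈ O
    · exact Or.inl ⟨hx, hxO⟩
    · exact Or.inr (Or.inl ⟨subset_closure hx, hxO⟩)
  have hpm : AEMeasurable (fun p : Space d × Space d =>
      ENNReal.ofReal (u p.2 ^ 2) * (ν (p.2 - p.1) : ℝ≥0∞))
      ((volume.restrict (Ω ∩ O)).prod (volume.restrict (innerPart Ω δ))) := by
    have hs : AEMeasurable (fun p : Space d × Space d => ν (p.2 - p.1))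
        ((volume : Measure (Space d)).prod volume) := by
      have := aemeasurable_comp_sub hν.aemeasurable
      simp_rw [← hν.symm (_ - _), neg_sub] at this
      exact this
    rw [Measure.prod_restrict]
    refine AEMeasurable.mul ?_ hs.restrict.coe_nnreal_ennreal
    rw [← Measure.prod_restrict]
    exact ENNReal.measurable_ofReal.comp_aemeasurable
      ((humI.comp_quasiMeasurePreserving Measure.quasiMeasurePreserving_snd).pow_const 2)
  have h2 : M * ∫⁻ x in Ω ∩ O, ENNReal.ofReal (u x ^ 2) ≤
      2 * energyOn ν Ω Ω u + 2 * (C₁ * Y) := by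
    calc M * ∫⁻ x in Ω ∩ O, ENNReal.ofReal (u x ^ 2)
        = ∫⁻ x in Ω ∩ O, M * ENNReal.ofReal (u x ^ 2) :=
          (lintegral_const_mul' _ _ ENNReal.coe_ne_top).symm
      _ ≤ ∫⁻ x in Ω ∩ O, ∫⁻ y in innerPart Ω δ,
            (2 * (ENNReal.ofReal ((u x - u y) ^ 2) * (ν (x - y) : ℝ≥0∞)) +
              2 * (ENNReal.ofReal (u y ^ 2) * (ν (y - x) : ℝ≥0∞))) := by
          refine setLIntegral_mono' (hΩm.inter hOo.measurableSet) fun x hx => ?_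
          have hM' : (M : ℝ≥0∞) ≤ ∫⁻ y in innerPart Ω δ, (ν (y - x) : ℝ≥0∞) := hx.2.1.le
          calc _ ≤ (∫⁻ y in innerPart Ω δ, (ν (y - x) : ℝ≥0∞)) * ENNReal.ofReal (u x ^ 2) := by
                gcongr
            _ = ∫⁻ y in innerPart Ω δ, (ν (y - x) : ℝ≥0∞) * ENNReal.ofReal (u x ^ 2) :=
                (lintegral_mul_const' _ _ ENNReal.ofReal_ne_top).symm
            _ ≤ _ := by
                refine lintegral_mono fun y => ?_
                have : ν (x - y) = ν (y - x) := by rw [← hν.symm, neg_sub]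
                rw [this, mul_comm, ← mul_assoc, ← mul_assoc, ← add_mul]
                gcongr
                simpa using ofReal_sq_add_le (u x - u y) (u y)
      _ = 2 * energyOn ν (Ω ∩ O) (innerPart Ω δ) u +
          2 * ∫⁻ p, ENNReal.ofReal (u p.2 ^ 2) * (ν (p.2 - p.1) : ℝ≥0∞)
            ∂((volume.restrict (Ω ∩ O)).prod (volume.restrict (innerPart Ω δ))) := by
          have hem := aemeasurable_energy hν.aemeasurable humO humI
          rw [energyOn]
          rw [← Measure.prod_restrict] at hem ⊢
          rw [← lintegral_const_mul' _ _ (by norm_num), ← lintegral_const_mul' _ _ (by norm_num),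
            ← lintegral_add_left' (hem.const_mul 2), lintegral_prod]
          exact (hem.const_mul 2).add (hpm.const_mul 2)
      _ ≤ 2 * energyOn ν Ω Ω u + 2 * (C₁ * Y) := by
          gcongr
          · exact energyOn_mono inter_subset_left hIΩ
          · rw [lintegral_prod_symm _ hpm]
            calc _ ≤ ∫⁻ y in innerPart Ω δ, C₁ * ENNReal.ofReal (u y ^ 2) := by
                  refine setLIntegral_mono' hIm fun y hy => ?_
                  change ∫⁻ x in Ω ∩ O, ENNReal.ofReal (u y ^ 2) * (ν (y - x) : ℝ≥0∞) ≤ _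
                  rw [lintegral_const_mul' _ _ ENNReal.ofReal_ne_top, mul_comm]
                  gcongr
                  rw [hC₁, ← lintegral_indicator (hΩm.inter hOo.measurableSet),
                    ← lintegral_indicator Metric.isOpen_ball.measurableSet.compl,
                    ← lintegral_sub_left_eq_self ((Metric.ball (0 : Space d) (δ / 2))ᶜ.indicator
                      fun z => (ν z : ℝ≥0∞)) y]
                  refine lintegral_mono fun x => ?_
                  by_cases hx : x ∈ Ω ∩ O
                  · have hxy : y - x ∈ (Metric.ball (0 : Space d) (δ / 2))ᶜ := by
                      have h3 := Metric.infDist_le_infDist_add_dist (s := frontier Ω) (x := y) (y := x)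
                      have h4 : δ < Metric.infDist y (frontier Ω) := hy.2
                      have h5 : Metric.infDist x (frontier Ω) < δ / 2 := hx.2.2
                      rw [dist_eq_norm] at h3
                      simp only [mem_compl_iff, Metric.mem_ball, dist_zero_right, not_lt]
                      linarith
                    rw [indicator_of_mem hx, indicator_of_mem hxy]
                  · rw [indicator_of_notMem hx]
                    exact zero_le
              _ = C₁ * ∫⁻ y in innerPart Ω δ, ENNReal.ofReal (u y ^ 2) :=
                  lintegral_const_mul' _ _ hC₁t
              _ ≤ C₁ * Y := by
                  gcongr
                  exact lintegral_mono_set fun y hy => Or.inr ⟨subset_closure hy.1, hy.2.le⟩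
  have h3 : ∫⁻ x in Ω ∩ O, ENNReal.ofReal (u x ^ 2) ≤ η * energyOn ν Ω Ω u + η * (C₁ * Y) := by
    have hkey : (η / 2 * M : ℝ≥0) = 1 := by
      rw [hM]; field_simp
    have hkey' : ((η / 2 : ℝ≥0) : ℝ≥0∞) * M = 1 := by
      rw [← ENNReal.coe_mul, hkey]; rfl
    have hkey2 : ((η / 2 : ℝ≥0) : ℝ≥0∞) * 2 = η := by
      have : η / 2 * 2 = η := div_mul_cancel₀ _ two_ne_zero
      exact_mod_cast congrArg ENNReal.ofNNReal this
    calc _ = ((η / 2 : ℝ≥0) : ℝ≥0∞) * (M * ∫⁻ x in Ω ∩ O, ENNReal.ofReal (u x ^ 2)) := by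
          rw [← mul_assoc, hkey', one_mul]
      _ ≤ ((η / 2 : ℝ≥0) : ℝ≥0∞) * (2 * energyOn ν Ω Ω u + 2 * (C₁ * Y)) := by gcongr
      _ = _ := by rw [mul_add, ← mul_assoc, ← mul_assoc, hkey2]
  calc _ ≤ _ := h1
    _ ≤ (η * energyOn ν Ω Ω u + η * (C₁ * Y)) + Y := by gcongr
    _ = _ := by
      push_cast
      rw [ENNReal.coe_toNNReal hC₁t]
      ring

end Boundary

/-! ### Walks inside `Ω` and integrals over cones. -/

section Lipschitz

variable {d : ℕ} {ν : Space d → ℝ≥0} {Ω S K : Set (Space d)} {u : Space d → ℝ}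

theorem sq_le_walk (f : ℕ → ℝ) (m : ℕ) :
    f 0 ^ 2 ≤ 2 * f m ^ 2 + 2 * (m * ∑ j ∈ Finset.range m, (f j - f (j + 1)) ^ 2) := by
  have h1 : f 0 = f m + ∑ j ∈ Finset.range m, (f j - f (j + 1)) := by
    rw [Finset.sum_range_sub']; ring
  have h2 := sq_sum_le_card_mul_sum_sq (s := Finset.range m) (f := fun j => f j - f (j + 1))
  rw [Finset.card_range] at h2
  set s := ∑ j ∈ Finset.range m, (f j - f (j + 1))
  rw [h1]
  nlinarith [sq_nonneg (f m - s)]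

/-- The energy of `u` on `Ω` in the direction `h`. -/
noncomputable def directionalEnergy (Ω : Set (Space d)) (u : Space d → ℝ) (h : Space d) : ℝ≥0∞ :=
  ∫⁻ y, (Ω ∩ (fun y => y + h) ⁻¹' Ω).indicator
    (fun y => ENNReal.ofReal ((u y - u (y + h)) ^ 2)) y

/-- Walking from `S` into `K` with `m` steps of size `h` inside `Ω`. -/
theorem lintegral_sq_le_walk (hu : Measurable u) (hS : MeasurableSet S) (hK : MeasurableSet K)
    {h : Space d} {m : ℕ} (hSK : ∀ x ∈ S, x + (m : ℝ) • h ∈ K)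
    (hSΩ : ∀ x ∈ S, ∀ j ≤ m, x + (j : ℝ) • h ∈ Ω) :
    ∫⁻ x in S, ENNReal.ofReal (u x ^ 2) ≤ 2 * (∫⁻ x in K, ENNReal.ofReal (u x ^ 2)) +
      2 * (m : ℝ≥0∞) ^ 2 * directionalEnergy Ω u h := by
  have hstep : ∀ (x : Space d) (j : ℕ), x + ((j + 1 : ℕ) : ℝ) • h = x + (j : ℝ) • h + h := by
    intro x j; push_cast; module
  have hm1 : ∀ j : ℕ, Measurable fun x => u (x + (j : ℝ) • h) := fun j =>
    hu.comp (measurable_add_const _)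
  have hm2 : ∀ j : ℕ, Measurable fun x =>
      ENNReal.ofReal ((u (x + (j : ℝ) • h) - u (x + ((j + 1 : ℕ) : ℝ) • h)) ^ 2) := fun j =>
    ENNReal.measurable_ofReal.comp (((hm1 j).sub (hm1 (j + 1))).pow_const 2)
  calc ∫⁻ x in S, ENNReal.ofReal (u x ^ 2)
      ≤ ∫⁻ x in S, (2 * ENNReal.ofReal (u (x + (m : ℝ) • h) ^ 2) + 2 * (m * ∑ j ∈ Finset.range m,
          ENNReal.ofReal ((u (x + (j : ℝ) • h) - u (x + ((j + 1 : ℕ) : ℝ) • h)) ^ 2))) := by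
        refine lintegral_mono fun x => ?_
        have := sq_le_walk (fun j => u (x + (j : ℝ) • h)) m
        simp only [Nat.cast_zero, zero_smul, add_zero] at this
        refine (ENNReal.ofReal_le_ofReal this).trans (le_of_eq ?_)
        rw [ENNReal.ofReal_add (by positivity) (by positivity), ENNReal.ofReal_mul (by norm_num),
          ENNReal.ofReal_mul (by norm_num), ENNReal.ofReal_mul (by positivity),
          ENNReal.ofReal_sum_of_nonneg (fun _ _ => sq_nonneg _)]
        simp
    _ = 2 * (∫⁻ x in S, ENNReal.ofReal (u (x + (m : ℝ) • h) ^ 2)) + 2 * (m * ∑ j ∈ Finset.range m,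
          ∫⁻ x in S,
            ENNReal.ofReal ((u (x + (j : ℝ) • h) - u (x + ((j + 1 : ℕ) : ℝ) • h)) ^ 2)) := by
        rw [lintegral_add_right _ (((Finset.measurable_fun_sum _ fun j _ => hm2 j).const_mul _).const_mul
          _), lintegral_const_mul' _ _ (by norm_num), lintegral_const_mul' _ _ (by norm_num),
          lintegral_const_mul' _ _ (by simp), lintegral_finsetSum _ fun j _ => hm2 j]
    _ ≤ 2 * (∫⁻ x in K, ENNReal.ofReal (u x ^ 2)) + 2 * (m * ∑ j ∈ Finset.range m,
          directionalEnergy Ω u h) := by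
        refine add_le_add (mul_le_mul_right ?_ _) (mul_le_mul_right (mul_le_mul_right
          (Finset.sum_le_sum fun j hj => ?_) _) _)
        · rw [← lintegral_indicator hS, ← lintegral_indicator hK,
            ← lintegral_add_right_eq_self (K.indicator fun x => ENNReal.ofReal (u x ^ 2))
              ((m : ℝ) • h)]
          refine lintegral_mono fun x => ?_
          by_cases hx : x ∈ S
          · rw [indicator_of_mem hx, indicator_of_mem (hSK x hx)]
          · rw [indicator_of_notMem hx]; exact zero_le
        · rw [← lintegral_indicator hS, directionalEnergy,
            ← lintegral_add_right_eq_self ((Ω ∩ (fun y => y + h) ⁻¹' Ω).indicator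
              fun y => ENNReal.ofReal ((u y - u (y + h)) ^ 2)) ((j : ℝ) • h)]
          refine lintegral_mono fun x => ?_
          by_cases hx : x ∈ S
          · have hjm := Finset.mem_range.1 hj
            have hmem : x + (j : ℝ) • h ∈ Ω ∩ (fun y => y + h) ⁻¹' Ω :=
              ⟨hSΩ x hx j hjm.le, by
                rw [mem_preimage, ← hstep]; exact hSΩ x hx (j + 1) hjm⟩
            rw [indicator_of_mem hx, indicator_of_mem hmem, hstep]
          · rw [indicator_of_notMem hx]; exact zero_le
    _ = _ := by
        rw [Finset.sum_const, Finset.card_range, nsmul_eq_mul]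
        ring

/-- Tonelli and the substitution `z = y + h`: averaging directional energies over `ν` recovers the
energy, so estimates made for one step direction at a time can be integrated. -/
theorem lintegral_directionalEnergy_le (hν : IsLevyDensity ν) (hΩ : MeasurableSet Ω)
    (hu : Measurable u) :
    ∫⁻ h, (ν h : ℝ≥0∞) * directionalEnergy Ω u h ≤ energyOn ν Ω Ω u := by
  have hset : MeasurableSet {p : Space d × Space d | p.2 ∈ Ω ∧ p.2 + p.1 ∈ Ω} :=
    (measurable_snd hΩ).inter ((measurable_snd.add measurable_fst) hΩ)
  have hF : Measurable fun p : Space d × Space d =>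
      (Ω ∩ (fun y => y + p.1) ⁻¹' Ω).indicator
        (fun y => ENNReal.ofReal ((u y - u (y + p.1)) ^ 2)) p.2 := by
    refine Measurable.indicator (f := fun p : Space d × Space d =>
      ENNReal.ofReal ((u p.2 - u (p.2 + p.1)) ^ 2)) ?_ hset
    exact ENNReal.measurable_ofReal.comp (((hu.comp measurable_snd).sub
      (hu.comp (measurable_snd.add measurable_fst))).pow_const 2)
  rw [energyOn_eq_lintegral hν.aemeasurable hu.aemeasurable hu.aemeasurable]
  calc ∫⁻ h, (ν h : ℝ≥0∞) * directionalEnergy Ω u h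
      = ∫⁻ h, ∫⁻ y, (ν h : ℝ≥0∞) * (Ω ∩ (fun y => y + h) ⁻¹' Ω).indicator
          (fun y => ENNReal.ofReal ((u y - u (y + h)) ^ 2)) y := by
        refine lintegral_congr fun h => ?_
        rw [directionalEnergy, lintegral_const_mul' _ _ ENNReal.coe_ne_top]
    _ = ∫⁻ y, ∫⁻ h, (ν h : ℝ≥0∞) * (Ω ∩ (fun y => y + h) ⁻¹' Ω).indicator
          (fun y => ENNReal.ofReal ((u y - u (y + h)) ^ 2)) y := by
        refine lintegral_lintegral_swap ?_
        exact (hν.aemeasurable.comp_quasiMeasurePreserving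
          Measure.quasiMeasurePreserving_fst).coe_nnreal_ennreal.mul hF.aemeasurable
    _ ≤ _ := by
        rw [← lintegral_indicator hΩ]
        refine lintegral_mono fun y => ?_
        by_cases hy : y ∈ Ω
        · rw [indicator_of_mem hy, ← lintegral_indicator hΩ,
            ← lintegral_add_left_eq_self (Ω.indicator
              fun z => ENNReal.ofReal ((u y - u z) ^ 2) * (ν (y - z) : ℝ≥0∞)) y]
          refine lintegral_mono fun h => ?_
          by_cases hyh : y + h ∈ Ω
          · have hmem : y ∈ Ω ∩ (fun y => y + h) ⁻¹' Ω := ⟨hy, hyh⟩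
            rw [indicator_of_mem hmem, indicator_of_mem hyh, mul_comm, ← hν.symm h]
            simp
          · have hmem : y ∉ Ω ∩ (fun y => y + h) ⁻¹' Ω := fun hh => hyh hh.2
            rw [indicator_of_notMem hmem, mul_zero]
            exact zero_le
        · have : ∀ h, y ∉ Ω ∩ (fun y => y + h) ⁻¹' Ω := fun h hh => hy hh.1
          simp [indicator_of_notMem (this _)]

/-- For a radial density, the integral over a ball is controlled by the integral over its
intersection with an open cone. -/
theorem exists_lintegral_ball_le_cone {g : Space d → ℝ≥0∞} (hg : ∀ x y, ‖x‖ = ‖y‖ → g x = g y)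
    (hg0 : g 0 = 0) {C : Set (Space d)} (hC : IsOpen C) (hCc : ∀ x ∈ C, ∀ t : ℝ, 0 < t → t • x ∈ C)
    {e : Space d} (he : ‖e‖ = 1) (heC : e ∈ C) :
    ∃ N : ℕ, 0 < N ∧ ∀ δ : ℝ, ∫⁻ h in Metric.ball 0 δ, g h ≤ N * ∫⁻ h in C ∩ Metric.ball 0 δ, g h := by
  -- Reflected copies of the cone cover the unit sphere, hence finitely many do. A radial integrand
  -- has the same integral over each copy, so their number bounds the ratio.
  have hrot : ∀ s : Space d, ‖s‖ = 1 → ∃ I : Space d ≃ₗᵢ[ℝ] Space d, I e = s := by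
    intro s hs
    refine ⟨(ℝ ∙ (e - s))ᗮ.reflection, ?_⟩
    exact Submodule.reflection_sub (by rw [he, hs])
  choose! I hI using hrot
  have hcov : Metric.sphere (0 : Space d) 1 ⊆ ⋃ s ∈ Metric.sphere (0 : Space d) 1, (I s).symm ⁻¹' C := by
    intro s hs
    refine mem_iUnion₂.2 ⟨s, hs, ?_⟩
    have hs1 : ‖s‖ = 1 := by simpa using hs
    have h1 : (I s).symm s = e := by rw [LinearIsometryEquiv.symm_apply_eq, hI s hs1]
    rwa [mem_preimage, h1]
  obtain ⟨t, hts, htf, htc⟩ := (isCompact_sphere (0 : Space d) 1).elim_finite_subcover_image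
    (fun s _ => hC.preimage (I s).symm.continuous) hcov
  -- Adding one makes the constant positive, so that it can be cancelled later.
  refine ⟨htf.toFinset.card + 1, Nat.succ_pos _, fun δ => ?_⟩
  have hCb : MeasurableSet (C ∩ Metric.ball 0 δ) := (hC.inter Metric.isOpen_ball).measurableSet
  have hint : ∀ s, ∫⁻ h in (I s).symm ⁻¹' (C ∩ Metric.ball 0 δ), g h =
      ∫⁻ h in C ∩ Metric.ball 0 δ, g h := by
    intro s
    have hmp := (I s).symm.measurePreserving
    rw [← hmp.setLIntegral_comp_preimage_emb (I s).symm.toHomeomorph.measurableEmbedding g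
      (C ∩ Metric.ball 0 δ)]
    refine lintegral_congr fun h => hg _ _ ?_
    simp
  have hsub : Metric.ball (0 : Space d) δ ⊆
      {0} ∪ ⋃ s ∈ htf.toFinset, (I s).symm ⁻¹' (C ∩ Metric.ball 0 δ) := by
    intro h hh
    by_cases h0 : h = 0
    · exact Or.inl h0
    · refine Or.inr ?_
      have hn : 0 < ‖h‖ := norm_pos_iff.2 h0
      have hs : ‖h‖⁻¹ • h ∈ Metric.sphere (0 : Space d) 1 := by
        simp [norm_smul, hn.ne']
      obtain ⟨s, hst, hsC⟩ := mem_iUnion₂.1 (htc hs)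
      refine mem_iUnion₂.2 ⟨s, htf.mem_toFinset.2 hst, ?_, ?_⟩
      · have := hCc _ hsC ‖h‖ hn
        rwa [map_smul, smul_smul, mul_inv_cancel₀ hn.ne', one_smul] at this
      · simpa using hh
  calc ∫⁻ h in Metric.ball 0 δ, g h
      ≤ (∫⁻ h in {0}, g h) + ∫⁻ h in ⋃ s ∈ htf.toFinset, (I s).symm ⁻¹' (C ∩ Metric.ball 0 δ), g h :=
        (lintegral_mono_set hsub).trans (lintegral_union_le _ _ _)
    _ ≤ 0 + ∑ s ∈ htf.toFinset, ∫⁻ h in (I s).symm ⁻¹' (C ∩ Metric.ball 0 δ), g h := by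
        gcongr
        · rw [setLIntegral_congr_fun (g := fun _ => 0) (measurableSet_singleton 0)]
          · simp
          · rintro h rfl; exact hg0
        · rw [← withDensity_apply _ ((htf.toFinset.measurableSet_biUnion fun s _ =>
            (I s).symm.continuous.measurable hCb))]
          refine (measure_biUnion_finset_le _ _).trans (Finset.sum_le_sum fun s _ => ?_)
          rw [withDensity_apply _ ((I s).symm.continuous.measurable hCb)]
    _ = htf.toFinset.card * ∫⁻ h in C ∩ Metric.ball 0 δ, g h := by
        simp_rw [hint]
        simp
    _ ≤ _ := by
        push_cast
        gcongr
        exact le_self_add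

end Lipschitz

/-! ### Absence of concentration at the boundary: class `A₂`. -/

section Lipschitz

variable {d : ℕ} {ν : Space d → ℝ≥0} {Ω : Set (Space d)} {u : Space d → ℝ}

/-- Walks evaluate the function at translated points, for which an honestly measurable function on
the whole space is convenient. -/
theorem exists_measurable_representative (hu : MemH ν Ω u) :
    ∃ w : Space d → ℝ, Measurable w ∧ u =ᵐ[volume.restrict Ω] w ∧
      energyOn ν Ω Ω w = energyOn ν Ω Ω u := by
  refine ⟨hu.1.1.aemeasurable.mk u, hu.1.1.aemeasurable.measurable_mk,
    hu.1.1.aemeasurable.ae_eq_mk, ?_⟩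
  exact (energyOn_congr hu.1.1.aemeasurable.ae_eq_mk hu.1.1.aemeasurable.ae_eq_mk).symm

/-- Near a boundary point, the `L²`-norm is controlled by a small multiple of the energy and the
`L²`-norm on a compact subset of `Ω`. -/
theorem ClassA2.exists_patch (h : ClassA2 ν Ω) {a : Space d} (ha : a ∈ frontier Ω) :
    ∃ s > 0, ∀ η : ℝ≥0, 0 < η → ∃ K, IsCompact K ∧ K ⊆ Ω ∧ ∀ u, MemH ν Ω u →
      ∫⁻ x in Ω ∩ Metric.ball a s, ENNReal.ofReal (u x ^ 2) ≤
        η * energyOn ν Ω Ω u + 2 * ∫⁻ x in K, ENNReal.ofReal (u x ^ 2) := by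
  have hν := h.levyDensity
  have hΩm := h.isOpen.measurableSet
  obtain ⟨r, hr, e, he, L, γ, hγ, hgraph⟩ := h.lipschitzBoundary a ha
  set P := (Submodule.span ℝ {e})ᗮ.orthogonalProjectionOnto with hP
  have hin : ∀ x ∈ Metric.ball a r, x ∈ Ω ↔ γ (P x) < inner ℝ e x := by
    intro x hx
    have := Set.ext_iff.1 hgraph x
    simp only [mem_inter_iff, hx, and_true] at this
    exact this
  have hPe : P e = 0 := by
    rw [hP, Submodule.orthogonalProjectionOnto_eq_zero_iff]
    exact Submodule.le_orthogonal_orthogonal _ (Submodule.mem_span_singleton_self e)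
  have hcp : Continuous fun x : Space d => P x := P.continuous
  -- A step `h` in this cone raises the height above the Lipschitz graph by at least `‖h‖ / 2`.
  let C : Set (Space d) := {h | 1 / 2 * ‖h‖ < inner ℝ e h - L * ‖P h‖}
  have hCo : IsOpen C := isOpen_lt (by fun_prop) (by fun_prop)
  have hCc : ∀ x ∈ C, ∀ t : ℝ, 0 < t → t • x ∈ C := by
    intro x hx t ht
    simp only [C, mem_ofPred_eq] at hx ⊢
    rw [map_smul, norm_smul, norm_smul, inner_smul_right, Real.norm_of_nonneg ht.le]
    nlinarith
  have heC : e ∈ C := by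
    simp only [C, mem_ofPred_eq, hPe, he, real_inner_self_eq_norm_sq]
    norm_num
  let g : Space d → ℝ≥0∞ := fun h => ENNReal.ofReal (‖h‖ ^ 2) * (ν h : ℝ≥0∞)
  have hgm : AEMeasurable g volume :=
    (ENNReal.measurable_ofReal.comp (measurable_norm.pow_const 2)).aemeasurable.mul
      hν.aemeasurable.coe_nnreal_ennreal
  obtain ⟨N, hN0, hN⟩ := exists_lintegral_ball_le_cone (g := g)
    (fun x y hxy => by simp only [g, hxy, h.radial x y hxy]) (by simp [g]) hCo hCc he heC
  refine ⟨r / 4, by positivity, fun η hη => ?_⟩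
  -- With `q(δ)` above this level, the cone mass `p` satisfies `8 δ² ≤ η p`, which absorbs the
  -- constant `8 δ²` of the walk estimate.
  have hqM : ((8 * N / η : ℝ≥0) : ℝ≥0∞) < ∞ := ENNReal.coe_lt_top
  -- `δ < 1` makes `p` finite by the Lévy condition; `δ < r / 8` keeps walks of length below `2δ`
  -- from the `r / 4`-ball inside the `r / 2`-ball.
  have hsmall : ∀ᶠ δ : ℝ in 𝓝[>] 0, δ < min 1 (r / 8) :=
    nhdsWithin_le_nhds (gt_mem_nhds (by positivity))
  obtain ⟨δ, ⟨hqδ, hδs⟩, hδ⟩ := (((h.tendsto_q.eventually_const_lt hqM).and hsmall).and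
    self_mem_nhdsWithin).exists
  have hδ : 0 < δ := hδ
  rw [lt_min_iff] at hδs
  set p := ∫⁻ h in C ∩ Metric.ball 0 δ, g h with hp
  have hpt : p ≠ ∞ := by
    refine ne_of_lt (lt_of_le_of_lt ?_ hν.levy)
    refine le_trans (setLIntegral_mono' (hCo.inter Metric.isOpen_ball).measurableSet fun x hx => ?_)
      (setLIntegral_le_lintegral _ _)
    have hx1 : ‖x‖ < δ := by simpa using hx.2
    simp only [g]
    gcongr
    refine le_min ?_ le_rfl
    nlinarith [norm_nonneg x]
  have hpq : ENNReal.ofReal (8 * δ ^ 2) ≤ η * p := by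
    have h1 : ((8 * N / η : ℝ≥0) : ℝ≥0∞) ≤ ENNReal.ofReal ((δ ^ 2)⁻¹) * (N * p) := by
      refine hqδ.le.trans ?_
      rw [q]
      gcongr
      exact hN δ
    have h2 : ENNReal.ofReal (8 * δ ^ 2) * N ≤ η * p * N := by
      calc ENNReal.ofReal (8 * δ ^ 2) * N
          = η * ENNReal.ofReal (δ ^ 2) * ((8 * N / η : ℝ≥0) : ℝ≥0∞) := by
            have hcan : (η : ℝ≥0∞) * ((8 * N / η : ℝ≥0) : ℝ≥0∞) = 8 * N := by
              rw [← ENNReal.coe_mul, mul_div_cancel₀ _ hη.ne']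
              simp
            rw [mul_right_comm, hcan, ENNReal.ofReal_mul (by norm_num), ENNReal.ofReal_ofNat]
            ring
        _ ≤ η * ENNReal.ofReal (δ ^ 2) * (ENNReal.ofReal ((δ ^ 2)⁻¹) * (N * p)) := by gcongr
        _ = (ENNReal.ofReal (δ ^ 2) * ENNReal.ofReal ((δ ^ 2)⁻¹)) * (η * p * N) := by ring
        _ = η * p * N := by
            rw [← ENNReal.ofReal_mul (by positivity), mul_inv_cancel₀ (by positivity)]
            simp
    have hN' : (N : ℝ≥0∞) ≠ 0 := by exact_mod_cast hN0.ne'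
    exact (ENNReal.mul_le_mul_iff_left hN' (by simp)).1 h2
  have hp0 : p ≠ 0 := by
    intro h0
    rw [h0, mul_zero] at hpq
    have : 0 < ENNReal.ofReal (8 * δ ^ 2) := ENNReal.ofReal_pos.2 (by positivity)
    exact absurd hpq (not_le.2 this)
  let K := Metric.closedBall a (r / 2) ∩ {x | δ / 2 ≤ inner ℝ e x - γ (P x)}
  have hKc : IsCompact K := by
    refine (isCompact_closedBall _ _).inter_right (isClosed_le continuous_const ?_)
    exact (continuous_const.inner continuous_id).sub (hγ.continuous.comp hcp)
  have hKΩ : K ⊆ Ω := by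
    rintro x ⟨hx, hx2⟩
    have hxr : x ∈ Metric.ball a r := Metric.closedBall_subset_ball (by linarith) hx
    refine (hin x hxr).2 ?_
    simp only [mem_ofPred_eq] at hx2
    linarith
  refine ⟨K, hKc, hKΩ, fun u hu => ?_⟩
  obtain ⟨w, hw, huw, hew⟩ := exists_measurable_representative hu
  rw [← hew, lintegral_congr_ae (show (fun x => ENNReal.ofReal (u x ^ 2)) =ᵐ[volume.restrict K]
      fun x => ENNReal.ofReal (w x ^ 2) from (ae_restrict_of_ae_restrict_of_subset hKΩ huw).mono
      fun x hx => by simp only [hx]),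
    lintegral_congr_ae (show (fun x => ENNReal.ofReal (u x ^ 2))
      =ᵐ[volume.restrict (Ω ∩ Metric.ball a (r / 4))] fun x => ENNReal.ofReal (w x ^ 2) from
      (ae_restrict_of_ae_restrict_of_subset inter_subset_left huw).mono fun x hx => by simp only [hx])]
  set X := ∫⁻ x in Ω ∩ Metric.ball a (r / 4), ENNReal.ofReal (w x ^ 2)
  set Y := ∫⁻ x in K, ENNReal.ofReal (w x ^ 2)
  have hSm : MeasurableSet (Ω ∩ Metric.ball a (r / 4)) := hΩm.inter Metric.isOpen_ball.measurableSet
  -- The walk costs `2 m²` times the directional energy; since `m ‖h‖ < 2δ`, the weight `‖h‖²` in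
  -- `g` brings this down to `8 δ²`, whatever the step size.
  have hstep : ∀ h ∈ C ∩ Metric.ball 0 δ, g h * X ≤
      2 * Y * g h + ENNReal.ofReal (8 * δ ^ 2) * ((ν h : ℝ≥0∞) * directionalEnergy Ω w h) := by
    rintro z ⟨hzC, hzδ⟩
    have hzδ : ‖z‖ < δ := by simpa using hzδ
    rcases eq_or_ne z 0 with rfl | hz
    · simp [g]
    have hzn : 0 < ‖z‖ := norm_pos_iff.2 hz
    -- The total length lies in `[δ, 2δ)`: long enough to gain height `δ / 2` and land in `K`, short
    -- enough to stay in the chart.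
    set m := ⌈δ / ‖z‖⌉₊ with hm
    have hm1 : δ ≤ m * ‖z‖ := by
      rw [← div_le_iff₀ hzn]; exact Nat.le_ceil _
    have hm2 : m * ‖z‖ < 2 * δ := by
      have := Nat.ceil_lt_add_one (div_pos hδ hzn).le
      rw [← hm] at this
      calc m * ‖z‖ < (δ / ‖z‖ + 1) * ‖z‖ := by gcongr
        _ = δ + ‖z‖ := by field_simp
        _ < 2 * δ := by linarith
    have hball : ∀ x ∈ Metric.ball a (r / 4), ∀ j ≤ m, x + (j : ℝ) • z ∈ Metric.ball a (r / 2) := by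
      intro x hx j hj
      rw [Metric.mem_ball, dist_eq_norm] at hx ⊢
      have h1 : ‖(j : ℝ) • z‖ ≤ m * ‖z‖ := by
        rw [norm_smul, Real.norm_of_nonneg (Nat.cast_nonneg _)]
        gcongr
      calc ‖x + (j : ℝ) • z - a‖ = ‖(x - a) + (j : ℝ) • z‖ := by congr 1; abel
        _ ≤ ‖x - a‖ + ‖(j : ℝ) • z‖ := norm_add_le _ _
        _ < r / 2 := by linarith [hδs.2]
    have hheight : ∀ (x : Space d) (j : ℕ), (inner ℝ e x - γ (P x)) + j * (1 / 2 * ‖z‖) ≤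
        inner ℝ e (x + (j : ℝ) • z) - γ (P (x + (j : ℝ) • z)) := by
      intro x j
      have h1 := hγ.dist_le_mul (P (x + (j : ℝ) • z)) (P x)
      rw [Real.dist_eq, dist_eq_norm, ← map_sub, add_sub_cancel_left, map_smul, norm_smul,
        Real.norm_of_nonneg (Nat.cast_nonneg j)] at h1
      have h2 := le_abs_self (γ (P (x + (j : ℝ) • z)) - γ (P x))
      have h3 : 1 / 2 * ‖z‖ < inner ℝ e z - L * ‖P z‖ := hzC
      rw [inner_add_right, inner_smul_right]
      nlinarith [(Nat.cast_nonneg j : (0 : ℝ) ≤ j)]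
    have hpos : ∀ x ∈ Ω ∩ Metric.ball a (r / 4), 0 < inner ℝ e x - γ (P x) := by
      rintro x ⟨hxΩ, hxb⟩
      have := (hin x (Metric.ball_subset_ball (by linarith) hxb)).1 hxΩ
      linarith
    have hwalk := lintegral_sq_le_walk (Ω := Ω) (K := K) hw hSm hKc.measurableSet (h := z) (m := m)
      (fun x hx => ⟨Metric.ball_subset_closedBall (hball x hx.2 m le_rfl), by
        have h1 := hheight x m
        have h2 := hpos x hx
        simp only [mem_ofPred_eq]
        linarith⟩)
      (fun x hx j hj => by
        refine (hin _ (Metric.ball_subset_ball (by linarith) (hball x hx.2 j hj))).2 ?_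
        have h1 := hheight x j
        have h2 := hpos x hx
        have h3 : (0 : ℝ) ≤ j * (1 / 2 * ‖z‖) := by positivity
        linarith)
    calc g z * X ≤ g z * (2 * Y + 2 * (m : ℝ≥0∞) ^ 2 * directionalEnergy Ω w z) := by gcongr
      _ = 2 * Y * g z + (2 * (m : ℝ≥0∞) ^ 2 * ENNReal.ofReal (‖z‖ ^ 2)) *
          ((ν z : ℝ≥0∞) * directionalEnergy Ω w z) := by
          simp only [g]; ring
      _ ≤ _ := by
          gcongr
          have hm4 : 2 * (m : ℝ≥0∞) ^ 2 = ENNReal.ofReal (2 * (m : ℝ) ^ 2) := by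
            rw [ENNReal.ofReal_mul (by norm_num), ENNReal.ofReal_pow (by positivity)]
            simp
          rw [hm4, ← ENNReal.ofReal_mul (by positivity)]
          refine ENNReal.ofReal_le_ofReal ?_
          have : (m * ‖z‖) ^ 2 ≤ (2 * δ) ^ 2 := by gcongr
          nlinarith
  have hsum : p * X ≤ p * (η * energyOn ν Ω Ω w + 2 * Y) := by
    calc p * X = ∫⁻ z in C ∩ Metric.ball 0 δ, g z * X :=
          (lintegral_mul_const'' _ hgm.restrict).symm
      _ ≤ ∫⁻ z in C ∩ Metric.ball 0 δ, (2 * Y * g z +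
            ENNReal.ofReal (8 * δ ^ 2) * ((ν z : ℝ≥0∞) * directionalEnergy Ω w z)) :=
          setLIntegral_mono' (hCo.inter Metric.isOpen_ball).measurableSet hstep
      _ = 2 * Y * p + ENNReal.ofReal (8 * δ ^ 2) *
            ∫⁻ z in C ∩ Metric.ball 0 δ, (ν z : ℝ≥0∞) * directionalEnergy Ω w z := by
          rw [lintegral_add_left' (hgm.restrict.const_mul _), lintegral_const_mul'' _ hgm.restrict,
            lintegral_const_mul' _ _ ENNReal.ofReal_ne_top]
      _ ≤ 2 * Y * p + (η * p) * energyOn ν Ω Ω w := by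
          gcongr
          exact (setLIntegral_le_lintegral _ _).trans (lintegral_directionalEnergy_le hν hΩm hw)
      _ = _ := by ring
  exact (ENNReal.mul_le_mul_iff_right hp0 hpt).1 hsum

/-- By compactness finitely many patches cover `∂Ω`. Their radii do not depend on `η`, so the cover
can be fixed before `η` is shared among the patches. -/
theorem ClassA2.noBoundaryConcentration (h : ClassA2 ν Ω) : NoBoundaryConcentration ν Ω := by
  intro η hη
  have hfc : IsCompact (frontier Ω) :=
    h.isBounded.isCompact_closure.of_isClosed_subset isClosed_frontier frontier_subset_closure
  choose! s hs hpatch using fun a (ha : a ∈ frontier Ω) => h.exists_patch ha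
  obtain ⟨t, htΩ, htf, htc⟩ := hfc.elim_finite_subcover_image (b := frontier Ω)
    (c := fun a => Metric.ball a (s a)) (fun a _ => Metric.isOpen_ball)
    (fun a ha => mem_iUnion₂.2 ⟨a, ha, Metric.mem_ball_self (hs a ha)⟩)
  set T := htf.toFinset with hT
  set η' : ℝ≥0 := η / (T.card + 1) with hη'
  have hη'0 : 0 < η' := by positivity
  choose! K hKc hKΩ hK using fun a (ha : a ∈ frontier Ω) => hpatch a ha η' hη'0
  set O := ⋃ a ∈ T, Metric.ball a (s a) with hO
  have hOo : IsOpen O := isOpen_biUnion fun a _ => Metric.isOpen_ball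
  have hTf : ∀ a ∈ T, a ∈ frontier Ω := fun a ha => htΩ (htf.mem_toFinset.1 ha)
  have hfO : frontier Ω ⊆ O := by
    refine htc.trans fun x hx => ?_
    obtain ⟨a, ha, hxa⟩ := mem_iUnion₂.1 hx
    exact mem_iUnion₂.2 ⟨a, htf.mem_toFinset.2 ha, hxa⟩
  set K₁ := closure Ω \ O
  refine ⟨K₁ ∪ ⋃ a ∈ T, K a, (h.isBounded.isCompact_closure.diff hOo).union
    (T.isCompact_biUnion fun a ha => hKc a (hTf a ha)),
    union_subset (closure_diff_subset_of_frontier_subset hfO)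
      (iUnion₂_subset fun a ha => hKΩ a (hTf a ha)), 2 * T.card + 1, fun u hu => ?_⟩
  set Y := ∫⁻ x in K₁ ∪ ⋃ a ∈ T, K a, ENNReal.ofReal (u x ^ 2)
  have hcover : Ω ⊆ (⋃ a ∈ T, (Ω ∩ Metric.ball a (s a))) ∪ (K₁ ∪ ⋃ a ∈ T, K a) := by
    intro x hx
    by_cases hxO : x ∈ O
    · obtain ⟨a, ha, hxa⟩ := mem_iUnion₂.1 hxO
      exact Or.inl (mem_iUnion₂.2 ⟨a, ha, hx, hxa⟩)
    · exact Or.inr (Or.inl ⟨subset_closure hx, hxO⟩)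
  have hUm : ∀ a, MeasurableSet (Ω ∩ Metric.ball a (s a)) := fun a =>
    (h.isOpen.inter Metric.isOpen_ball).measurableSet
  calc ∫⁻ x in Ω, ENNReal.ofReal (u x ^ 2)
      ≤ (∫⁻ x in ⋃ a ∈ T, (Ω ∩ Metric.ball a (s a)), ENNReal.ofReal (u x ^ 2)) + Y :=
        (lintegral_mono_set hcover).trans (lintegral_union_le _ _ _)
    _ ≤ (∑ a ∈ T, ∫⁻ x in Ω ∩ Metric.ball a (s a), ENNReal.ofReal (u x ^ 2)) + Y := by
        gcongr
        rw [← withDensity_apply _ (T.measurableSet_biUnion fun a _ => hUm a)]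
        refine (measure_biUnion_finset_le _ _).trans (Finset.sum_le_sum fun a _ => ?_)
        rw [withDensity_apply _ (hUm a)]
    _ ≤ (∑ a ∈ T, (η' * energyOn ν Ω Ω u + 2 * Y)) + Y := by
        gcongr with a ha
        refine (hK a (hTf a ha) u hu).trans ?_
        gcongr
        exact lintegral_mono_set fun x hx => Or.inr (mem_iUnion₂.2 ⟨a, ha, hx⟩)
    _ = ((T.card * η' : ℝ≥0) : ℝ≥0∞) * energyOn ν Ω Ω u + ((2 * T.card + 1 : ℝ≥0) : ℝ≥0∞) * Y := by
        rw [Finset.sum_const, nsmul_eq_mul]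
        push_cast
        ring
    _ ≤ _ := by
        gcongr
        rw [hη', mul_div_assoc', div_le_iff₀ (by positivity), mul_comm]
        gcongr
        exact le_self_add

end Lipschitz

/-! ### Compact embedding of `H_ν(Ω)` into `L²(Ω)`. -/

section Compactness

variable {d : ℕ} {ν : Space d → ℝ≥0} {Ω : Set (Space d)} {u : Space d → ℝ}

/-- Local compactness in `ℝ^d` on the compact set `closure Ω`, pulled back along `E`. Colouring `u`
by the colour of `E u` compares `E u` with `E v` directly, so linearity of `E` plays no role. -/
theorem ClassA1.finitelyColourable (h : ClassA1 ν Ω) {R : ℝ≥0∞} (hR : R ≠ ∞) :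
    FinitelyColourable {u | MemH ν Ω u ∧ normSqH ν Ω u ≤ R} Ω := by
  obtain ⟨C, E, -, hE⟩ := h.extension
  intro ε hε
  obtain ⟨ι, hι, c, hc⟩ := finitelyColourable_of_isCompact h.levyDensity h.nonintegrable isOpen_univ
    h.isBounded.isCompact_closure (subset_univ _)
    (R := (C : ℝ≥0∞) ^ 2 * R) (ENNReal.mul_ne_top (ENNReal.pow_ne_top ENNReal.coe_ne_top) hR) ε hε
  refine ⟨ι, hι, fun u => c (E u), fun u hu v hv huv => ?_⟩
  have hmem : ∀ u, MemH ν Ω u ∧ normSqH ν Ω u ≤ R → E u ∈ {u | MemH ν univ u ∧ normSqH ν univ u ≤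
      (C : ℝ≥0∞) ^ 2 * R} := fun u hu => ⟨(hE u hu.1).1, (hE u hu.1).2.1.trans (by gcongr; exact hu.2)⟩
  refine le_trans ?_ (hc _ (hmem u hu) _ (hmem v hv) huv)
  calc ∫⁻ x in Ω, ENNReal.ofReal ((u x - v x) ^ 2)
      = ∫⁻ x in Ω, ENNReal.ofReal ((E u x - E v x) ^ 2) := by
        refine lintegral_congr_ae ?_
        filter_upwards [(hE u hu.1).2.2, (hE v hv.1).2.2] with x h1 h2
        rw [h1, h2]
    _ ≤ _ := lintegral_mono_set subset_closure

/-- Apply the boundary estimate to `u - v`, whose energy is at most `4R`: a small `η` handles the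
energy term, and a fine colouring on `K` handles the rest. -/
theorem NoBoundaryConcentration.finitelyColourable (h : NoBoundaryConcentration ν Ω)
    (hb : ClassBase ν Ω) {R : ℝ≥0∞} (hR : R ≠ ∞) :
    FinitelyColourable {u | MemH ν Ω u ∧ normSqH ν Ω u ≤ R} Ω := by
  intro ε hε
  by_cases hεt : ε = ∞
  · exact ⟨Unit, inferInstance, fun _ => (), by simp [hεt]⟩
  lift R to ℝ≥0 using hR
  lift ε to ℝ≥0 using hεt
  have hε' : 0 < ε := by exact_mod_cast hε
  obtain ⟨K, hK, hKΩ, C, hC⟩ := h (ε / (2 * (4 * R + 1))) (by positivity)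
  obtain ⟨ι, hι, c, hc⟩ := finitelyColourable_of_isCompact hb.levyDensity hb.nonintegrable hb.isOpen
    hK hKΩ (R := R) ENNReal.coe_ne_top ((ε / (2 * (C + 1)) : ℝ≥0) : ℝ≥0∞)
    (by exact_mod_cast (by positivity : 0 < ε / (2 * (C + 1))))
  refine ⟨ι, hι, c, fun u hu v hv huv => ?_⟩
  have hen : energyOn ν Ω Ω (fun x => u x - v x) ≤ ((4 * R : ℝ≥0) : ℝ≥0∞) := by
    refine (energyOn_sub_le hb.levyDensity.aemeasurable hu.1.1.1.aemeasurable
      hu.1.1.1.aemeasurable).trans ?_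
    have h1 : energyOn ν Ω Ω u ≤ R := le_add_self.trans hu.2
    have h2 : energyOn ν Ω Ω v ≤ R := le_add_self.trans hv.2
    calc _ ≤ 2 * (R : ℝ≥0∞) + 2 * R := by gcongr
      _ = _ := by rw [← add_mul]; norm_num
  refine (hC (fun x => u x - v x) ⟨hu.1.1.sub hv.1.1, hen.trans_lt ENNReal.coe_lt_top⟩).trans ?_
  calc _ ≤ ((ε / (2 * (4 * R + 1)) : ℝ≥0) : ℝ≥0∞) * ((4 * R : ℝ≥0) : ℝ≥0∞) +
        C * ((ε / (2 * (C + 1)) : ℝ≥0) : ℝ≥0∞) := by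
        gcongr
        exact hc u hu v hv huv
    _ ≤ ((ε / 2 + ε / 2 : ℝ≥0) : ℝ≥0∞) := by
        rw [← ENNReal.coe_mul, ← ENNReal.coe_mul, ← ENNReal.coe_add, ENNReal.coe_le_coe]
        refine add_le_add ?_ ?_
        · rw [div_mul_eq_mul_div, div_le_div_iff₀ (by positivity) (by positivity)]
          have : ε * (4 * R) * 2 ≤ ε * (2 * (4 * R)) + ε * 2 := by
            refine le_trans (le_of_eq (by ring)) le_self_add
          exact this.trans (le_of_eq (by ring))
        · rw [mul_div_assoc', div_le_div_iff₀ (by positivity) (by positivity)]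
          have : C * ε * 2 ≤ ε * (2 * C) + ε * 2 := by
            refine le_trans (le_of_eq (by ring)) le_self_add
          exact this.trans (le_of_eq (by ring))
    _ = ε := by rw [add_halves]

theorem finitelyColourable_of_class (h : ClassA1 ν Ω ∨ ClassA2 ν Ω ∨ ClassA3 ν Ω) {R : ℝ≥0∞}
    (hR : R ≠ ∞) : FinitelyColourable {u | MemH ν Ω u ∧ normSqH ν Ω u ≤ R} Ω := by
  rcases h with h | h | h
  · exact h.finitelyColourable hR
  · exact h.noBoundaryConcentration.finitelyColourable h.toClassBase hR
  · exact h.noBoundaryConcentration.finitelyColourable h.toClassBase hR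

/-- The embedding of `H_ν(Ω)` into `L²(Ω)` is compact. -/
theorem totallyBounded_of_class (h : ClassA1 ν Ω ∨ ClassA2 ν Ω ∨ ClassA3 ν Ω) {R : ℝ≥0∞}
    (hR : R ≠ ∞) :
    TotallyBounded {f : Lp ℝ 2 (volume.restrict Ω) | normSqH ν Ω f ≤ R} := by
  rw [Metric.totallyBounded_iff]
  intro ε hε
  obtain ⟨ι, hι, c, hc⟩ := finitelyColourable_of_class h hR (ENNReal.ofReal ((ε / 2) ^ 2))
    (ENNReal.ofReal_pos.2 (by positivity))
  classical
  set S := {f : Lp ℝ 2 (volume.restrict Ω) | normSqH ν Ω f ≤ R}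
  have hmem : ∀ f ∈ S, ((f : Space d → ℝ)) ∈ {u | MemH ν Ω u ∧ normSqH ν Ω u ≤ R} := fun f hf =>
    ⟨⟨Lp.memLp f, (le_add_self.trans hf).trans_lt (lt_top_iff_ne_top.2 hR)⟩, hf⟩
  -- One member of `S` for each colour that occurs; the value `0` for the other colours is never
  -- needed.
  let y : ι → Lp ℝ 2 (volume.restrict Ω) := fun i =>
    if hi : ∃ f ∈ S, c f = i then hi.choose else 0
  refine ⟨range y, finite_range y, fun f hf => ?_⟩
  have hi : ∃ g ∈ S, c g = c f := ⟨f, hf, rfl⟩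
  refine mem_iUnion₂.2 ⟨y (c f), mem_range_self _, ?_⟩
  simp only [y, dif_pos hi]
  set g := hi.choose
  have hgS : g ∈ S := hi.choose_spec.1
  have hgc : c g = c f := hi.choose_spec.2
  have h1 := hc _ (hmem f hf) _ (hmem g hgS) hgc.symm
  rw [lintegral_sq_eq (volume.restrict Ω) (fun x => f x - g x)] at h1
  rw [Metric.mem_ball, Lp.dist_def]
  have h2 : eLpNorm (fun x => f x - g x) 2 (volume.restrict Ω) ≤ ENNReal.ofReal (ε / 2) := by
    rw [ENNReal.ofReal_pow (by positivity)] at h1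
    exact (ENNReal.pow_le_pow_left_iff two_ne_zero).1 h1
  calc _ ≤ ε / 2 := ENNReal.toReal_le_of_le_ofReal (by positivity) h2
    _ < ε := half_lt_self hε

end Compactness

/-! ### The energy space as a closed subspace of a Hilbert space. -/

section EnergySpace

variable {d : ℕ} {ν : Space d → ℝ≥0} {Ω : Set (Space d)} {k : Space d → Space d → ℝ≥0} {Λ : ℝ≥0}
  {u v : Space d → ℝ}

/-- The measure `½ k(x, y) dx dy` on `(Ωᶜ × Ωᶜ)ᶜ`. -/
noncomputable def formMeasure (k : Space d → Space d → ℝ≥0) (Ω : Set (Space d)) :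
    Measure (Space d × Space d) :=
  (((volume : Measure (Space d)).prod volume).restrict (Ωᶜ ×ˢ Ωᶜ)ᶜ).withDensity
    fun p => ((k p.1 p.2 / 2 : ℝ≥0) : ℝ≥0∞)

/-- The difference `(x, y) ↦ u x - u y`. -/
def diff (u : Space d → ℝ) (p : Space d × Space d) : ℝ := u p.1 - u p.2

theorem formMeasure_absolutelyContinuous :
    formMeasure k Ω ≪ (volume : Measure (Space d)).prod volume :=
  (withDensity_absolutelyContinuous _ _).trans Measure.restrict_le_self.absolutelyContinuous

theorem aemeasurable_diff (hu : AEMeasurable u volume) :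
    AEMeasurable (diff u) ((volume : Measure (Space d)).prod volume) :=
  (hu.comp_quasiMeasurePreserving Measure.quasiMeasurePreserving_fst).sub
    (hu.comp_quasiMeasurePreserving Measure.quasiMeasurePreserving_snd)

theorem diff_congr (h : u =ᵐ[volume] v) :
    diff u =ᵐ[(volume : Measure (Space d)).prod volume] diff v := by
  filter_upwards [Measure.quasiMeasurePreserving_fst.ae h,
    Measure.quasiMeasurePreserving_snd.ae h] with p h1 h2
  simp only [diff, h1, h2]

theorem IsEllipticKernel.aemeasurable_half (hk : IsEllipticKernel ν Λ k)
    (s : Set (Space d × Space d)) :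
    AEMeasurable (fun p : Space d × Space d => k p.1 p.2 / 2)
      (((volume : Measure (Space d)).prod volume).restrict s) :=
  (hk.aemeasurable.div_const 2).restrict

theorem form_eq_integral (hk : IsEllipticKernel ν Λ k) (u v : Space d → ℝ) :
    form k Ω u v = ∫ p, diff u p * diff v p ∂(formMeasure k Ω) := by
  rw [formMeasure, integral_withDensity_eq_integral_smul₀ (hk.aemeasurable_half _), form,
    ← integral_const_mul]
  refine integral_congr_ae (ae_of_all _ fun p => ?_)
  simp only [diff, NNReal.smul_def, smul_eq_mul, NNReal.coe_div, NNReal.coe_ofNat]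
  ring

theorem compl_prod_compl_compl : (Ωᶜ ×ˢ Ωᶜ)ᶜ = Ω ×ˢ univ ∪ univ ×ˢ Ω := by
  ext p
  simp only [mem_compl_iff, mem_prod, mem_union, mem_univ, and_true, true_and]
  tauto

theorem energyOn_swap (hν : IsLevyDensity ν) (A B : Set (Space d)) :
    energyOn ν A B u = energyOn ν B A u := by
  have hmp : MeasurePreserving (Prod.swap : Space d × Space d → Space d × Space d)
      (volume.prod volume) (volume.prod volume) := Measure.measurePreserving_swap
  rw [energyOn, energyOn, ← hmp.setLIntegral_comp_preimage_emb
    MeasurableEquiv.prodComm.measurableEmbedding _ (A ×ˢ B)]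
  rw [show Prod.swap ⁻¹' (A ×ˢ B) = B ×ˢ A by ext; simp [and_comm]]
  refine lintegral_congr fun p => ?_
  rw [Prod.fst_swap, Prod.snd_swap, ← hν.symm, neg_sub]
  congr 2
  ring

theorem lintegral_diff_sq_eq (hk : IsEllipticKernel ν Λ k) (hu : AEMeasurable u volume) :
    ∫⁻ p, ENNReal.ofReal (diff u p ^ 2) ∂(formMeasure k Ω) =
      ∫⁻ p in (Ωᶜ ×ˢ Ωᶜ)ᶜ, ((k p.1 p.2 / 2 : ℝ≥0) : ℝ≥0∞) * ENNReal.ofReal (diff u p ^ 2)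
        ∂((volume : Measure (Space d)).prod volume) := by
  rw [formMeasure, lintegral_withDensity_eq_lintegral_mul₀
    (hk.aemeasurable_half _).coe_nnreal_ennreal]
  · rfl
  · exact (ENNReal.measurable_ofReal.comp_aemeasurable ((aemeasurable_diff hu).pow_const 2)).restrict

/-- `(Ωᶜ × Ωᶜ)ᶜ` is covered by `Ω × ℝ^d` and its mirror image, which carry the same energy by
symmetry of `ν`. -/
theorem lintegral_diff_sq_le (hν : IsLevyDensity ν) (hk : IsEllipticKernel ν Λ k)
    (hu : AEMeasurable u volume) :
    ∫⁻ p, ENNReal.ofReal (diff u p ^ 2) ∂(formMeasure k Ω) ≤ 2 * (Λ * energyOn ν Ω univ u) := by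
  have hpt : ∀ p : Space d × Space d, ((k p.1 p.2 / 2 : ℝ≥0) : ℝ≥0∞) *
      ENNReal.ofReal (diff u p ^ 2) ≤
      Λ * (ENNReal.ofReal ((u p.1 - u p.2) ^ 2) * (ν (p.1 - p.2) : ℝ≥0∞)) := by
    rintro ⟨x, y⟩
    simp only [diff]
    rcases eq_or_ne x y with rfl | hxy
    · simp
    have h1 : k x y / 2 ≤ Λ * ν (x - y) := by
      have h2 := hk.upper x y hxy
      rw [← hν.symm, neg_sub] at h2
      exact (half_le_self zero_le).trans h2
    calc _ ≤ ((Λ * ν (x - y) : ℝ≥0) : ℝ≥0∞) * ENNReal.ofReal ((u x - u y) ^ 2) := by gcongr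
      _ = _ := by push_cast; ring
  rw [lintegral_diff_sq_eq hk hu, compl_prod_compl_compl]
  calc _ ≤ _ := lintegral_union_le _ _ _
    _ ≤ Λ * energyOn ν Ω univ u + Λ * energyOn ν univ Ω u := by
      simp only [energyOn]
      rw [← lintegral_const_mul' _ _ ENNReal.coe_ne_top, ← lintegral_const_mul' _ _ ENNReal.coe_ne_top]
      exact add_le_add (lintegral_mono hpt) (lintegral_mono hpt)
    _ = _ := by rw [energyOn_swap hν univ Ω, two_mul]

theorem energyOn_le_lintegral_diff_sq (hν : IsLevyDensity ν) (hk : IsEllipticKernel ν Λ k)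
    (hΛ : 1 ≤ Λ) (hu : AEMeasurable u volume) :
    energyOn ν Ω univ u ≤ 2 * Λ * ∫⁻ p, ENNReal.ofReal (diff u p ^ 2) ∂(formMeasure k Ω) := by
  have hΛ0 : Λ ≠ 0 := (lt_of_lt_of_le one_pos hΛ).ne'
  rw [lintegral_diff_sq_eq hk hu, ← lintegral_const_mul' _ _ (by finiteness), energyOn]
  refine (lintegral_mono fun p => ?_).trans (lintegral_mono_set
    (compl_prod_compl_compl.symm ▸ subset_union_left))
  obtain ⟨x, y⟩ := p
  simp only [diff]
  rcases eq_or_ne x y with rfl | hxy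
  · simp
  have h1 : ν (x - y) ≤ 2 * Λ * (k x y / 2) := by
    have h2 := hk.lower x y hxy
    rw [← hν.symm, neg_sub] at h2
    calc ν (x - y) = Λ * (Λ⁻¹ * ν (x - y)) := by rw [mul_inv_cancel_left₀ hΛ0]
      _ ≤ Λ * k x y := by gcongr
      _ = _ := by ring
  calc _ ≤ ENNReal.ofReal ((u x - u y) ^ 2) * ((2 * Λ * (k x y / 2) : ℝ≥0) : ℝ≥0∞) := by gcongr
    _ = _ := by push_cast; ring

/-- Comparability of `k` and `ν` replaces finite energy by an `L²` condition linear in `u`, from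
which the vector space structure is immediate. -/
theorem memV_iff (hν : IsLevyDensity ν) (hk : IsEllipticKernel ν Λ k) (hΛ : 1 ≤ Λ) :
    MemV ν Ω u ↔ AEMeasurable u volume ∧ MemLp u 2 (volume.restrict Ω) ∧
      MemLp (diff u) 2 (formMeasure k Ω) := by
  refine and_congr_right fun hu => and_congr_right fun _ => ?_
  have hL : ∀ {c : ℝ≥0∞}, c ^ 2 < ∞ ↔ c < ∞ := by
    intro c
    simp [lt_top_iff_ne_top]
  have hm : AEStronglyMeasurable (diff u) (formMeasure k Ω) :=
    ((aemeasurable_diff hu).mono_ac formMeasure_absolutelyContinuous).aestronglyMeasurable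
  rw [MemLp, and_iff_right hm, ← hL (c := eLpNorm (diff u) 2 (formMeasure k Ω)), ← lintegral_sq_eq]
  constructor
  · intro h
    refine (lintegral_diff_sq_le hν hk hu).trans_lt ?_
    exact ENNReal.mul_lt_top (by norm_num) (ENNReal.mul_lt_top ENNReal.coe_lt_top h)
  · intro h
    refine (energyOn_le_lintegral_diff_sq hν hk hΛ hu).trans_lt ?_
    exact ENNReal.mul_lt_top (ENNReal.mul_lt_top (by norm_num) ENNReal.coe_lt_top) h

theorem MemV.congr (hu : MemV ν Ω u) (h : u =ᵐ[volume] v) : MemV ν Ω v := by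
  have h' : u =ᵐ[volume.restrict Ω] v := ae_restrict_of_ae h
  refine ⟨hu.1.congr h, hu.2.1.ae_eq h', ?_⟩
  rw [← energyOn_congr h' (by rw [Measure.restrict_univ]; exact h)]
  exact hu.2.2

theorem measure_withDensity_pos (hsupp : HasFullSupport ν) {U : Set (Space d)} (hU : IsOpen U)
    (hUn : U.Nonempty) : 0 < volume.withDensity (fun h => (ν h : ℝ≥0∞)) U := by
  obtain ⟨x, hx⟩ := hUn
  have : x ∈ (volume.withDensity fun h => (ν h : ℝ≥0∞)).support := by
    rw [HasFullSupport] at hsupp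
    rw [hsupp]; trivial
  exact (Measure.mem_support_iff_forall x).1 this U (hU.mem_nhds hx)

theorem not_ae_nu_sub_eq_zero (hsupp : HasFullSupport ν) (hΩ : IsOpen Ω) (hΩn : Ω.Nonempty)
    (y : Space d) : ¬ ∀ᵐ x ∂(volume.restrict Ω), ν (x - y) = 0 := by
  intro h
  have hU : IsOpen ((fun z => z + y) ⁻¹' Ω) := hΩ.preimage (by fun_prop)
  obtain ⟨x₀, hx₀⟩ := hΩn
  have hpos := measure_withDensity_pos hsupp hU ⟨x₀ - y, by simpa using hx₀⟩
  rw [withDensity_apply _ hU.measurableSet, ← lintegral_indicator hU.measurableSet,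
    ← lintegral_sub_right_eq_self _ y] at hpos
  refine hpos.ne' ?_
  rw [← lintegral_zero (μ := (volume : Measure (Space d)))]
  refine lintegral_congr_ae ?_
  rw [ae_restrict_iff' hΩ.measurableSet] at h
  filter_upwards [h] with x hx
  by_cases hxΩ : x ∈ Ω
  · simp [indicator, hx hxΩ]
  · simp [indicator, hxΩ]

/-- A property which holds almost everywhere on `Ω` and is transported along the kernel holds almost
everywhere on the whole space, since every point interacts with `Ω`. -/
theorem ae_of_ae_formMeasure (hk : IsEllipticKernel ν Λ k) (hΛ : 1 ≤ Λ)
    (hsupp : HasFullSupport ν) (hΩ : IsOpen Ω) (hΩn : Ω.Nonempty) {A : Space d → Prop}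
    {Q : Space d × Space d → Prop} (hQ : ∀ᵐ p ∂(formMeasure k Ω), Q p)
    (hA : ∀ᵐ x ∂(volume.restrict Ω), A x) (h : ∀ x y, A x → Q (y, x) → A y) :
    ∀ᵐ y ∂(volume : Measure (Space d)), A y := by
  have hΛ0 : 0 < Λ := lt_of_lt_of_le one_pos hΛ
  rw [formMeasure, ae_withDensity_iff' (hk.aemeasurable_half _).coe_nnreal_ennreal] at hQ
  have hQ2 := ae_restrict_of_ae_restrict_of_subset
    (compl_prod_compl_compl (Ω := Ω) ▸ subset_union_right :
      (univ : Set (Space d)) ×ˢ Ω ⊆ (Ωᶜ ×ˢ Ωᶜ)ᶜ) hQ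
  rw [← Measure.prod_restrict, Measure.restrict_univ] at hQ2
  filter_upwards [Measure.ae_ae_of_ae_prod hQ2] with y hy
  -- Otherwise `Q (y, x)` fails wherever `A x` holds, so `k y x`, and with it `ν (x - y)`, vanishes
  -- for almost every `x ∈ Ω`, contradicting full support.
  by_contra hAy
  refine not_ae_nu_sub_eq_zero hsupp hΩ hΩn y ?_
  filter_upwards [hy, hA] with x hx hAx
  by_contra hνx
  have hyx : y ≠ x := by rintro rfl; exact hAy hAx
  refine hAy (h x y hAx (hx ?_))
  have h1 := hk.lower y x hyx
  have h2 : 0 < k y x := lt_of_lt_of_le (mul_pos (inv_pos.2 hΛ0) (pos_iff_ne_zero.2 hνx)) h1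
  simp [h2.ne']

/-- The Hilbert space `L²(Ω) × L²(½ k)` in which the energy space embeds isometrically. -/
abbrev Ambient (k : Space d → Space d → ℝ≥0) (Ω : Set (Space d)) : Type :=
  WithLp 2 (Lp ℝ 2 (volume.restrict Ω) × Lp ℝ 2 (formMeasure k Ω))

/-- `w` represents the function `u` in the ambient Hilbert space. -/
def Represents (w : Ambient k Ω) (u : Space d → ℝ) : Prop :=
  w.fst =ᵐ[volume.restrict Ω] u ∧ w.snd =ᵐ[formMeasure k Ω] diff u

/-- The energy space as a subspace of the ambient Hilbert space. -/
def energySpace (ν : Space d → ℝ≥0) (k : Space d → Space d → ℝ≥0) (Ω : Set (Space d))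
    (Λ : ℝ≥0) (hν : IsLevyDensity ν) (hk : IsEllipticKernel ν Λ k) (hΛ : 1 ≤ Λ) :
    Submodule ℝ (Ambient k Ω) where
  carrier := {w | ∃ u, MemV ν Ω u ∧ Represents w u}
  zero_mem' := by
    refine ⟨0, (memV_iff hν hk hΛ).2 ⟨aemeasurable_const, MemLp.zero, ?_⟩, ?_, ?_⟩
    · have : diff (0 : Space d → ℝ) = 0 := by ext; simp [diff]
      rw [this]; exact MemLp.zero
    · exact Lp.coeFn_zero _ _ _
    · refine (Lp.coeFn_zero _ _ _).trans (ae_of_all _ fun p => ?_)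
      simp [diff]
  add_mem' := by
    rintro w w' ⟨u, hu, h1, h2⟩ ⟨u', hu', h1', h2'⟩
    obtain ⟨a, b, c⟩ := (memV_iff hν hk hΛ).1 hu
    obtain ⟨a', b', c'⟩ := (memV_iff hν hk hΛ).1 hu'
    have hd : diff (u + u') = diff u + diff u' := by ext; simp [diff]; ring
    refine ⟨u + u', (memV_iff hν hk hΛ).2 ⟨a.add a', b.add b', hd ▸ c.add c'⟩, ?_, ?_⟩
    · exact (Lp.coeFn_add _ _).trans (h1.add h1')
    · rw [hd]; exact (Lp.coeFn_add _ _).trans (h2.add h2')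
  smul_mem' := by
    rintro c w ⟨u, hu, h1, h2⟩
    obtain ⟨a, b, e⟩ := (memV_iff hν hk hΛ).1 hu
    have hd : diff (c • u) = c • diff u := by ext; simp [diff]; ring
    refine ⟨c • u, (memV_iff hν hk hΛ).2 ⟨a.const_smul c, b.const_smul c, hd ▸ e.const_smul c⟩,
      ?_, ?_⟩
    · exact (Lp.coeFn_smul _ _).trans (h1.const_smul c)
    · rw [hd]; exact (Lp.coeFn_smul _ _).trans (h2.const_smul c)

theorem exists_mem_energySpace (hν : IsLevyDensity ν) (hk : IsEllipticKernel ν Λ k) (hΛ : 1 ≤ Λ)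
    (hu : MemV ν Ω u) : ∃ w ∈ energySpace ν k Ω Λ hν hk hΛ, Represents w u := by
  obtain ⟨_, b, c⟩ := (memV_iff hν hk hΛ).1 hu
  refine ⟨WithLp.toLp 2 (b.toLp u, c.toLp (diff u)), ?_, b.coeFn_toLp, c.coeFn_toLp⟩
  exact ⟨u, hu, b.coeFn_toLp, c.coeFn_toLp⟩

/-- Along a subsequence both components converge almost everywhere. The limit of `u y` for `y`
outside `Ω` is recovered from `u y = (u y - u x) + u x` with `x ∈ Ω` interacting with `y`. -/
theorem isClosed_energySpace (hν : IsLevyDensity ν) (hk : IsEllipticKernel ν Λ k) (hΛ : 1 ≤ Λ)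
    (hsupp : HasFullSupport ν) (hΩ : IsOpen Ω) (hΩn : Ω.Nonempty) :
    IsClosed (energySpace ν k Ω Λ hν hk hΛ : Set (Ambient k Ω)) := by
  refine IsSeqClosed.isClosed fun w w₀ hw hlim => ?_
  choose u hu hwu using hw
  have hl1 : Tendsto (fun n => (w n).fst) atTop (𝓝 w₀.fst) :=
    ((WithLp.fstL 2 ℝ _ _).continuous.tendsto w₀).comp hlim
  have hl2 : Tendsto (fun n => (w n).snd) atTop (𝓝 w₀.snd) :=
    ((WithLp.sndL 2 ℝ _ _).continuous.tendsto w₀).comp hlim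
  obtain ⟨s, hs, hs1⟩ := (tendstoInMeasure_of_tendsto_Lp hl1).exists_seq_tendsto_ae
  obtain ⟨t, ht, ht1⟩ := (tendstoInMeasure_of_tendsto_Lp
    (hl2.comp hs.tendsto_atTop)).exists_seq_tendsto_ae
  set r := s ∘ t
  have h1 : ∀ᵐ x ∂(volume.restrict Ω), Tendsto (fun i => u (r i) x) atTop (𝓝 (w₀.fst x)) := by
    filter_upwards [hs1, ae_all_iff.2 fun n => (hwu n).1] with x hx hx2
    refine (hx.comp ht.tendsto_atTop).congr fun i => ?_
    exact hx2 _
  have h2 : ∀ᵐ p ∂(formMeasure k Ω), Tendsto (fun i => diff (u (r i)) p) atTop (𝓝 (w₀.snd p)) := by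
    filter_upwards [ht1, ae_all_iff.2 fun n => (hwu n).2] with x hx hx2
    exact hx.congr fun i => hx2 _
  have h3 : ∀ᵐ y ∂(volume : Measure (Space d)), ∃ l, Tendsto (fun i => u (r i) y) atTop (𝓝 l) := by
    refine ae_of_ae_formMeasure hk hΛ hsupp hΩ hΩn h2 (h1.mono fun x hx => ⟨_, hx⟩) ?_
    rintro x y ⟨l, hl⟩ hxy
    exact ⟨_, (hxy.add hl).congr fun i => by simp [diff]⟩
  obtain ⟨U, hUm, hU⟩ := measurable_limit_of_tendsto_metrizable_ae (fun i => (hu (r i)).1) h3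
  have e1 : w₀.fst =ᵐ[volume.restrict Ω] U := by
    filter_upwards [h1, ae_restrict_of_ae hU] with x hx hx2
    exact tendsto_nhds_unique hx hx2
  have e2 : w₀.snd =ᵐ[formMeasure k Ω] diff U := by
    filter_upwards [h2, formMeasure_absolutelyContinuous.ae_le
      (Measure.quasiMeasurePreserving_fst.ae hU), formMeasure_absolutelyContinuous.ae_le
      (Measure.quasiMeasurePreserving_snd.ae hU)] with p hp hp1 hp2
    exact tendsto_nhds_unique hp (hp1.sub hp2)
  exact ⟨U, (memV_iff hν hk hΛ).2 ⟨hUm.aemeasurable, (Lp.memLp _).ae_eq e1, (Lp.memLp _).ae_eq e2⟩,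
    e1, e2⟩

end EnergySpace

/-! ### Density of the energy space, rigidity of zero energy, and infinite dimension of `L²(Ω)`. -/

section EnergySpace

variable {d : ℕ} {ν : Space d → ℝ≥0} {Ω : Set (Space d)} {k : Space d → Space d → ℝ≥0} {Λ : ℝ≥0}
  {u v : Space d → ℝ}

/-- Bounded Lipschitz functions belong to the energy space. -/
theorem memV_of_lipschitz (hν : IsLevyDensity ν)
    (hΩb : Bornology.IsBounded Ω) {L : ℝ≥0} (hu : LipschitzWith L u) {M : ℝ} (hM : ∀ x, |u x| ≤ M) :
    MemV ν Ω u := by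
  have hum : AEMeasurable u volume := hu.continuous.aemeasurable
  have hΩt : volume Ω < ∞ := hΩb.measure_lt_top
  have : IsFiniteMeasure (volume.restrict Ω) := ⟨by simpa using hΩt⟩
  refine ⟨hum, ?_, ?_⟩
  · exact MemLp.of_bound hum.restrict.aestronglyMeasurable M (ae_of_all _ hM)
  · rw [energyOn_eq_lintegral hν.aemeasurable hum.restrict hum.restrict]
    -- The sup bound serves distant pairs and the Lipschitz bound close pairs; together they match
    -- the Lévy weight `1 ∧ ‖x - y‖²`.
    set c : ℝ := (2 * M) ^ 2 + L ^ 2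
    have hc : ∀ x y, (u x - u y) ^ 2 ≤ c * min 1 (‖x - y‖ ^ 2) := by
      intro x y
      have h1 : |u x - u y| ≤ 2 * M := (abs_sub _ _).trans (by linarith [hM x, hM y])
      have h2 : |u x - u y| ≤ L * ‖x - y‖ := by
        have := hu.dist_le_mul x y
        rwa [Real.dist_eq, dist_eq_norm] at this
      have h3 : (u x - u y) ^ 2 ≤ (2 * M) ^ 2 := by
        rw [← sq_abs]; exact pow_le_pow_left₀ (abs_nonneg _) h1 2
      have h4 : (u x - u y) ^ 2 ≤ L ^ 2 * ‖x - y‖ ^ 2 := by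
        rw [← sq_abs, ← mul_pow]; exact pow_le_pow_left₀ (abs_nonneg _) h2 2
      rcases min_cases 1 (‖x - y‖ ^ 2) with ⟨h, _⟩ | ⟨h, _⟩
      · rw [h]; simp only [c]; nlinarith [sq_nonneg (L : ℝ)]
      · rw [h]; simp only [c]; nlinarith [sq_nonneg (2 * M), sq_nonneg ‖x - y‖]
    have hc0 : 0 ≤ c := by positivity
    calc _ ≤ ∫⁻ x in Ω, ENNReal.ofReal c *
          ∫⁻ h, ENNReal.ofReal (min 1 (‖h‖ ^ 2)) * (ν h : ℝ≥0∞) := by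
          refine lintegral_mono fun x => ?_
          rw [Measure.restrict_univ, ← lintegral_const_mul' _ _ ENNReal.ofReal_ne_top,
            ← lintegral_sub_left_eq_self (fun h => ENNReal.ofReal c *
              (ENNReal.ofReal (min 1 (‖h‖ ^ 2)) * (ν h : ℝ≥0∞))) x]
          refine lintegral_mono fun y => ?_
          rw [← mul_assoc, ← ENNReal.ofReal_mul hc0]
          gcongr
          exact hc x y
      _ = _ := by rw [setLIntegral_const]
      _ < ∞ := ENNReal.mul_lt_top (ENNReal.mul_lt_top ENNReal.ofReal_lt_top hν.levy) hΩt

theorem memV_const (hν : IsLevyDensity ν) (hΩb : Bornology.IsBounded Ω) (c : ℝ) : MemV ν Ω fun _ => c :=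
  memV_of_lipschitz hν hΩb (LipschitzWith.const c) (M := |c|) fun _ => le_rfl

/-- The restrictions to `Ω` of elements of the energy space are dense in `L²(Ω)`. -/
theorem eq_zero_of_forall_integral_memV (hb : ClassBase ν Ω) (f : Lp ℝ 2 (volume.restrict Ω))
    (h : ∀ v, MemV ν Ω v → ∫ x in Ω, f x * v x = 0) : f = 0 := by
  have : IsFiniteMeasure (volume.restrict Ω) := ⟨by simpa using hb.isBounded.measure_lt_top⟩
  have hf : Integrable f (volume.restrict Ω) :=
    (Lp.memLp f).integrable (by norm_num)
  have h0 := hb.isOpen.ae_eq_zero_of_integral_contDiff_smul_eq_zero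
    (μ := (volume : Measure (Space d))) (IntegrableOn.locallyIntegrableOn hf) (by
      intro g hg hgc hgs
      obtain ⟨L, hL⟩ := hg.lipschitzWith_of_hasCompactSupport hgc (by simp)
      obtain ⟨M, hM⟩ := hgc.exists_bound_of_continuous hg.continuous
      have hv := h g (memV_of_lipschitz hb.levyDensity hb.isBounded hL hM)
      rw [← setIntegral_eq_integral_of_forall_compl_eq_zero (s := Ω), ← hv]
      · simp only [smul_eq_mul, mul_comm]
      · intro x hx
        rw [image_eq_zero_of_notMem_tsupport fun hx' => hx (hgs hx'), zero_smul])
  refine Lp.ext ?_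
  rw [← ae_restrict_iff' hb.isOpen.measurableSet] at h0
  filter_upwards [h0, Lp.coeFn_zero ℝ 2 (volume.restrict Ω)] with x hx hx2
  rw [hx, hx2]; rfl

/-- A measurable function which does not jump along `ν` inside `Ω` is constant on `Ω`. -/
theorem exists_ae_eq_const (hb : ClassBase ν Ω) (hsupp : HasFullSupport ν)
    (hu : AEMeasurable u volume) (h : energyOn ν Ω univ u = 0) :
    ∃ c : ℝ, u =ᵐ[volume.restrict Ω] fun _ => c := by
  have hν := hb.levyDensity
  have hΩm := hb.isOpen.measurableSet
  -- It suffices that for each measurable `s`, almost all of `Ω` is mapped into `s` or almost all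
  -- into `sᶜ`.
  refine Filter.exists_eventuallyEq_const_of_forall_separating MeasurableSet fun s hs => ?_
  let w := hu.mk u
  have hw : Measurable w := hu.measurable_mk
  have huw : u =ᵐ[volume.restrict Ω] w := ae_restrict_of_ae hu.ae_eq_mk
  set A := Ω ∩ w ⁻¹' s with hA
  set B := Ω ∩ w ⁻¹' sᶜ with hB
  have hAm : MeasurableSet A := hΩm.inter (hw hs)
  have hBm : MeasurableSet B := hΩm.inter (hw hs.compl)
  have hfin : ∀ C ⊆ Ω, volume C ≠ ∞ := fun C hC => (hb.isBounded.subset hC).measure_lt_top.ne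
  have hA2 : MemLp (A.indicator fun _ => (1 : ℝ)) 2 volume :=
    memLp_indicator_const 2 hAm _ (Or.inr (hfin A inter_subset_left))
  have hB2 : MemLp (B.indicator fun _ => (1 : ℝ)) 2 volume :=
    memLp_indicator_const 2 hBm _ (Or.inr (hfin B inter_subset_left))
  -- `g z` is the volume of `(A + z) ∩ B`. Zero energy gives `∫ ν g = 0`; continuity of `g` and full
  -- support give `g = 0`; and `∫ g` is the product of the volumes of `A` and `B`. Connectedness of
  -- `Ω` is not involved.
  let g : Space d → ℝ := fun z => ∫ y, A.indicator (fun _ => (1 : ℝ)) (y - z) *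
    B.indicator (fun _ => (1 : ℝ)) y
  have hg : Continuous g := continuous_integral_mul_translate hB2 hA2
  have hprodm : Measurable fun p : Space d × Space d =>
      A.indicator (fun _ => (1 : ℝ≥0∞)) (p.2 - p.1) * B.indicator (fun _ => (1 : ℝ≥0∞)) p.2 :=
    ((measurable_const.indicator hAm).comp (measurable_snd.sub measurable_fst)).mul
      ((measurable_const.indicator hBm).comp measurable_snd)
  have hgl : ∀ z, ENNReal.ofReal (g z) = ∫⁻ y, A.indicator (fun _ => (1 : ℝ≥0∞)) (y - z) *
      B.indicator (fun _ => (1 : ℝ≥0∞)) y := by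
    intro z
    have hA2z : MemLp (fun y => A.indicator (fun _ => (1 : ℝ)) (y - z)) 2 volume :=
      hA2.comp_measurePreserving (measurePreserving_sub_right volume z)
    rw [ofReal_integral_eq_lintegral_ofReal (show Integrable (fun y =>
      A.indicator (fun _ => (1 : ℝ)) (y - z) * B.indicator (fun _ => (1 : ℝ)) y) volume from
      hA2z.integrable_mul hB2) (ae_of_all _ fun y => mul_nonneg
        (indicator_nonneg (fun _ _ => zero_le_one) _) (indicator_nonneg (fun _ _ => zero_le_one) _))]
    refine lintegral_congr fun y => ?_
    by_cases h1 : y - z ∈ A <;> by_cases h2 : y ∈ B <;> simp [h1, h2]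
  have hν0 : ∫⁻ z, (ν z : ℝ≥0∞) * ENNReal.ofReal (g z) = 0 := by
    have hum : AEMeasurable u (volume.restrict Ω) := hu.restrict
    have hzero : ∀ᵐ p ∂((volume : Measure (Space d)).prod volume), p.1 ∈ A → p.2 ∈ B →
        ν (p.1 - p.2) = 0 := by
      have h1 := h
      rw [energyOn, lintegral_eq_zero_iff' (aemeasurable_energy hν.aemeasurable hu.restrict
        hu.restrict), EventuallyEq, ae_restrict_iff' (hΩm.prod MeasurableSet.univ)] at h1
      filter_upwards [h1, Measure.quasiMeasurePreserving_fst.ae hu.ae_eq_mk,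
        Measure.quasiMeasurePreserving_snd.ae hu.ae_eq_mk] with p hp h2 h3 hpA hpB
      have h4 := hp ⟨hpA.1, trivial⟩
      simp only [Pi.zero_apply, mul_eq_zero, ENNReal.ofReal_eq_zero, ENNReal.coe_eq_zero] at h4
      refine h4.resolve_left fun h5 => ?_
      have h6 : u p.1 - u p.2 = 0 := by
        have := le_antisymm h5 (sq_nonneg _)
        exact pow_eq_zero_iff two_ne_zero |>.1 this
      rw [h2, h3, sub_eq_zero] at h6
      refine hpB.2 ?_
      change hu.mk u p.2 ∈ s
      rw [← h6]
      exact hpA.2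
    calc ∫⁻ z, (ν z : ℝ≥0∞) * ENNReal.ofReal (g z)
        = ∫⁻ z, ∫⁻ y, (ν z : ℝ≥0∞) * (A.indicator (fun _ => (1 : ℝ≥0∞)) (y - z) *
            B.indicator (fun _ => (1 : ℝ≥0∞)) y) := by
          refine lintegral_congr fun z => ?_
          rw [hgl, lintegral_const_mul' _ _ ENNReal.coe_ne_top]
      _ = ∫⁻ y, ∫⁻ z, (ν z : ℝ≥0∞) * (A.indicator (fun _ => (1 : ℝ≥0∞)) (y - z) *
            B.indicator (fun _ => (1 : ℝ≥0∞)) y) := by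
          refine lintegral_lintegral_swap ?_
          exact (hν.aemeasurable.comp_quasiMeasurePreserving
            Measure.quasiMeasurePreserving_fst).coe_nnreal_ennreal.mul hprodm.aemeasurable
      _ = ∫⁻ y, ∫⁻ x, (ν (x - y) : ℝ≥0∞) * (A.indicator (fun _ => (1 : ℝ≥0∞)) x *
            B.indicator (fun _ => (1 : ℝ≥0∞)) y) := by
          refine lintegral_congr fun y => ?_
          rw [← lintegral_sub_left_eq_self _ y]
          refine lintegral_congr fun x => ?_
          rw [sub_sub_cancel, ← hν.symm, neg_sub]
      _ = 0 := by
          have hzero' : ∀ᵐ p ∂((volume : Measure (Space d)).prod volume), p.2 ∈ A → p.1 ∈ B →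
              ν (p.2 - p.1) = 0 := by
            have := Measure.measurePreserving_swap (μ := (volume : Measure (Space d)))
              (ν := (volume : Measure (Space d))) |>.quasiMeasurePreserving.ae hzero
            exact this
          rw [← lintegral_zero (μ := (volume : Measure (Space d)))]
          refine lintegral_congr_ae ?_
          filter_upwards [Measure.ae_ae_of_ae_prod hzero'] with y hy
          rw [← lintegral_zero (μ := (volume : Measure (Space d)))]
          refine lintegral_congr_ae ?_
          filter_upwards [hy] with x hx
          by_cases h1 : x ∈ A <;> by_cases h2 : y ∈ B <;> simp [h1, h2]
          exact hx h1 h2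
  have hgnn : ∀ z, 0 ≤ g z := fun z => integral_nonneg fun y => mul_nonneg
    (indicator_nonneg (fun _ _ => zero_le_one) _) (indicator_nonneg (fun _ _ => zero_le_one) _)
  have hg0 : ∀ z, g z = 0 := by
    intro z
    by_contra hz
    have hopen : IsOpen {z | 0 < g z} := isOpen_lt continuous_const hg
    have hpos := measure_withDensity_pos hsupp hopen ⟨z, lt_of_le_of_ne (hgnn z) (Ne.symm hz)⟩
    rw [withDensity_apply _ hopen.measurableSet] at hpos
    refine hpos.ne' ?_
    have hm : AEMeasurable (fun z => (ν z : ℝ≥0∞) * ENNReal.ofReal (g z)) volume :=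
      hν.aemeasurable.coe_nnreal_ennreal.mul
        (ENNReal.measurable_ofReal.comp hg.measurable).aemeasurable
    rw [lintegral_eq_zero_iff' hm] at hν0
    rw [lintegral_eq_zero_iff' hν.aemeasurable.coe_nnreal_ennreal.restrict, EventuallyEq,
      ae_restrict_iff' hopen.measurableSet]
    filter_upwards [hν0] with x hx hxg
    simp only [Pi.zero_apply, mul_eq_zero] at hx
    refine hx.resolve_right (ENNReal.ofReal_pos.2 hxg).ne'
  have hAB : volume A * volume B = 0 := by
    have h1 : ∫⁻ z, ENNReal.ofReal (g z) = 0 := by simp [hg0]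
    simp_rw [hgl] at h1
    rw [lintegral_lintegral_swap hprodm.aemeasurable] at h1
    rw [← h1]
    have h2 : ∀ y, ∫⁻ z, A.indicator (fun _ => (1 : ℝ≥0∞)) (y - z) *
        B.indicator (fun _ => (1 : ℝ≥0∞)) y = volume A * B.indicator (fun _ => (1 : ℝ≥0∞)) y := by
      intro y
      rw [lintegral_mul_const _ (show Measurable fun z => A.indicator (fun _ => (1 : ℝ≥0∞)) (y - z) from
        (measurable_const.indicator hAm).comp (measurable_const.sub measurable_id)), lintegral_sub_left_eq_self (A.indicator fun _ => (1 : ℝ≥0∞)) y,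
        lintegral_indicator hAm]
      simp
    simp_rw [h2]
    rw [lintegral_const_mul _ (measurable_const.indicator hBm), lintegral_indicator hBm]
    simp
  rcases mul_eq_zero.1 hAB with h0 | h0
  · refine Or.inr ?_
    rw [measure_eq_zero_iff_ae_notMem] at h0
    filter_upwards [huw, ae_restrict_of_ae h0, ae_restrict_mem hΩm] with x h1 h2 h3 h4
    exact h2 ⟨h3, by rw [mem_preimage, ← h1]; exact h4⟩
  · refine Or.inl ?_
    rw [measure_eq_zero_iff_ae_notMem] at h0
    filter_upwards [huw, ae_restrict_of_ae h0, ae_restrict_mem hΩm] with x h1 h2 h3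
    by_contra h4
    exact h2 ⟨h3, by rw [mem_preimage, ← h1]; exact h4⟩

/-- The space `L²(Ω)` is infinite-dimensional. -/
theorem not_finiteDimensional_Lp (hd : 0 < d) (hΩ : IsOpen Ω) (hΩb : Bornology.IsBounded Ω)
    (hΩn : Ω.Nonempty) : ¬ FiniteDimensional ℝ (Lp ℝ 2 (volume.restrict Ω)) := by
  intro hfin
  have : Nonempty (Fin d) := ⟨⟨0, hd⟩⟩
  have hnt : Nontrivial (Space d) := inferInstance
  have hinf : Infinite Ω := (infinite_of_mem_nhds hΩn.some (hΩ.mem_nhds hΩn.some_mem)).to_subtype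
  -- Indicators of infinitely many disjoint nonempty open subsets are orthogonal and nonzero.
  obtain ⟨U, hUi, hUo, hUd⟩ := exists_seq_infinite_isOpen_pairwise_disjoint Ω
  let W : ℕ → Set (Space d) := fun n => (↑) '' U n
  have hWo : ∀ n, IsOpen (W n) := fun n => hΩ.isOpenMap_subtype_val _ (hUo n)
  have hWΩ : ∀ n, W n ⊆ Ω := fun n => by rintro _ ⟨x, -, rfl⟩; exact x.2
  have hWd : ∀ m n, m ≠ n → Disjoint (W m) (W n) := fun m n hmn =>
    (disjoint_image_iff Subtype.val_injective).2 (hUd hmn)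
  have hWfin : ∀ n, (volume.restrict Ω) (W n) ≠ ∞ := fun n =>
    ((Measure.restrict_apply_le _ _).trans_lt (hΩb.subset (hWΩ n)).measure_lt_top).ne
  let f : ℕ → Lp ℝ 2 (volume.restrict Ω) := fun n =>
    indicatorConstLp 2 (hWo n).measurableSet (hWfin n) (1 : ℝ)
  have hf : ∀ m n, m ≠ n → inner ℝ (f m) (f n) = 0 := by
    intro m n hmn
    rw [L2.inner_indicatorConstLp_one, setIntegral_congr_ae (g := fun _ => (0 : ℝ)) (hWo m).measurableSet]
    · simp
    · filter_upwards [indicatorConstLp_coeFn (p := 2) (hs := (hWo n).measurableSet)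
        (hμs := hWfin n) (c := (1 : ℝ))] with x hx hxm
      rw [hx, indicator_of_notMem (disjoint_left.1 (hWd m n hmn) hxm)]
  have hf0 : ∀ n, f n ≠ 0 := by
    intro n h0
    have h1 : ‖f n‖ = 0 := by rw [h0, norm_zero]
    rw [norm_indicatorConstLp (by norm_num) (by norm_num)] at h1
    have h2 : 0 < (volume.restrict Ω).real (W n) := by
      refine ENNReal.toReal_pos ?_ (hWfin n)
      rw [Measure.restrict_apply (hWo n).measurableSet, inter_eq_left.2 (hWΩ n)]
      exact ((hWo n).measure_pos _ ((hUi n).nonempty.image _)).ne'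
    have h3 : 0 < (volume.restrict Ω).real (W n) ^ (1 / (2 : ℝ≥0∞).toReal) := by positivity
    simp at h1 h3
    linarith
  have hli : LinearIndependent ℝ f := linearIndependent_of_ne_zero_of_inner_eq_zero hf0
    fun m n hmn => hf m n hmn
  exact not_finite_iff_infinite.2 inferInstance hli.finite

end EnergySpace

/-! ### Eigenfunctions as vectors of the energy space. -/

section Eigenfunctions

variable {d : ℕ} {ν : Space d → ℝ≥0} {Ω : Set (Space d)} {k : Space d → Space d → ℝ≥0} {Λ : ℝ≥0}
  {u v : Space d → ℝ}

theorem inner_of_represents (hk : IsEllipticKernel ν Λ k) {w w' : Ambient k Ω}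
    (hw : Represents w u) (hw' : Represents w' v) :
    inner ℝ w w' = (∫ x in Ω, u x * v x) + form k Ω u v := by
  rw [WithLp.prod_inner_apply, form_eq_integral hk]
  congr 1
  · rw [L2.inner_def]
    refine integral_congr_ae ?_
    filter_upwards [hw.1, hw'.1] with x h1 h2
    change inner ℝ (w.fst x) (w'.fst x) = _
    rw [h1, h2]
    simp [mul_comm]
  · rw [L2.inner_def]
    refine integral_congr_ae ?_
    filter_upwards [hw.2, hw'.2] with x h1 h2
    change inner ℝ (w.snd x) (w'.snd x) = _
    rw [h1, h2]
    simp [mul_comm]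

theorem Represents.congr {w : Ambient k Ω} (hw : Represents w u) (h : u =ᵐ[volume] v) :
    Represents w v :=
  ⟨hw.1.trans (ae_restrict_of_ae h),
    hw.2.trans (formMeasure_absolutelyContinuous.ae_le (diff_congr h))⟩

/-- Equality on `Ω` propagates to `ℝ^d` along the differences. Hence vectors of the energy space
correspond to functions modulo null sets of `ℝ^d`, as needed to count dimensions. -/
theorem Represents.ae_eq (hk : IsEllipticKernel ν Λ k) (hΛ : 1 ≤ Λ) (hsupp : HasFullSupport ν)
    (hΩ : IsOpen Ω) (hΩn : Ω.Nonempty) {w : Ambient k Ω} (hu : Represents w u)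
    (hv : Represents w v) : u =ᵐ[volume] v := by
  refine ae_of_ae_formMeasure hk hΛ hsupp hΩ hΩn (A := fun x => u x = v x)
    (hu.2.symm.trans hv.2) (hu.1.symm.trans hv.1) fun x y hx hxy => ?_
  simp only [diff] at hxy
  linarith

variable (hν : IsLevyDensity ν) (hk : IsEllipticKernel ν Λ k) (hΛ : 1 ≤ Λ)

/-- The function represented by an element of the energy space. -/
noncomputable def toFun (w : energySpace ν k Ω Λ hν hk hΛ) : Space d →ₘ[volume] ℝ :=
  AEEqFun.mk w.2.choose w.2.choose_spec.1.1.aestronglyMeasurable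

theorem toFun_spec (w : energySpace ν k Ω Λ hν hk hΛ) :
    MemV ν Ω (toFun hν hk hΛ w) ∧ Represents (w : Ambient k Ω) (toFun hν hk hΛ w) := by
  have h := AEEqFun.coeFn_mk w.2.choose w.2.choose_spec.1.1.aestronglyMeasurable
  exact ⟨w.2.choose_spec.1.congr h.symm, w.2.choose_spec.2.congr h.symm⟩

theorem toFun_eq (hsupp : HasFullSupport ν) (hΩ : IsOpen Ω) (hΩn : Ω.Nonempty)
    (w : energySpace ν k Ω Λ hν hk hΛ) (f : Space d →ₘ[volume] ℝ)
    (hf : Represents (w : Ambient k Ω) f) : toFun hν hk hΛ w = f :=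
  AEEqFun.ext ((toFun_spec hν hk hΛ w).2.ae_eq hk hΛ hsupp hΩ hΩn hf)

/-- The embedding of the energy space into the space of measurable functions. -/
noncomputable def toFunₗ (hsupp : HasFullSupport ν) (hΩ : IsOpen Ω) (hΩn : Ω.Nonempty) :
    energySpace ν k Ω Λ hν hk hΛ →ₗ[ℝ] (Space d →ₘ[volume] ℝ) where
  toFun := toFun hν hk hΛ
  map_add' w w' := by
    obtain ⟨-, h1⟩ := toFun_spec hν hk hΛ w
    obtain ⟨-, h2⟩ := toFun_spec hν hk hΛ w'
    refine toFun_eq hν hk hΛ hsupp hΩ hΩn _ _ (Represents.congr (u := ⇑(toFun hν hk hΛ w) +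
      ⇑(toFun hν hk hΛ w')) ⟨?_, ?_⟩ (AEEqFun.coeFn_add _ _).symm)
    · exact (Lp.coeFn_add _ _).trans (h1.1.add h2.1)
    · refine ((Lp.coeFn_add _ _).trans (h1.2.add h2.2)).trans (ae_of_all _ fun p => ?_)
      simp [diff]; ring
  map_smul' c w := by
    obtain ⟨-, h1⟩ := toFun_spec hν hk hΛ w
    refine toFun_eq hν hk hΛ hsupp hΩ hΩn _ _ (Represents.congr (u := c • ⇑(toFun hν hk hΛ w))
      ⟨?_, ?_⟩ (AEEqFun.coeFn_smul _ _).symm)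
    · exact (Lp.coeFn_smul _ _).trans (h1.1.const_smul c)
    · refine ((Lp.coeFn_smul _ _).trans (h1.2.const_smul c)).trans (ae_of_all _ fun p => ?_)
      simp [diff]; ring

theorem toFunₗ_injective (hsupp : HasFullSupport ν) (hΩ : IsOpen Ω) (hΩn : Ω.Nonempty) :
    Function.Injective (toFunₗ hν hk hΛ hsupp hΩ hΩn) := by
  rw [injective_iff_map_eq_zero]
  intro w hw
  obtain ⟨-, h1, h2⟩ := toFun_spec hν hk hΛ w
  have h0 : (⇑(toFun hν hk hΛ w) : Space d → ℝ) =ᵐ[volume] 0 := by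
    have : toFun hν hk hΛ w = 0 := hw
    rw [this]; exact AEEqFun.coeFn_zero
  have e1 : (w : Ambient k Ω).fst = 0 := by
    refine Lp.ext ((h1.trans (ae_restrict_of_ae h0)).trans (Lp.coeFn_zero _ _ _).symm)
  have e2 : (w : Ambient k Ω).snd = 0 := by
    have h3 : diff (toFun hν hk hΛ w) =ᵐ[formMeasure k Ω] diff 0 :=
      formMeasure_absolutelyContinuous.ae_le (diff_congr h0)
    refine Lp.ext ((h2.trans h3).trans ?_)
    refine EventuallyEq.trans (ae_of_all _ fun p => ?_) (Lp.coeFn_zero _ _ _).symm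
    simp [diff]
  refine Subtype.ext ?_
  rw [← WithLp.toLp_ofLp 2 (w : Ambient k Ω)]
  have : WithLp.ofLp (w : Ambient k Ω) = 0 := Prod.ext e1 e2
  rw [this]; rfl

/-- Restriction to `Ω` as a map from the energy space to `L²(Ω)`. -/
noncomputable def restrictL : energySpace ν k Ω Λ hν hk hΛ →L[ℝ] Lp ℝ 2 (volume.restrict Ω) :=
  (WithLp.fstL 2 ℝ _ _).comp (energySpace ν k Ω Λ hν hk hΛ).subtypeL

theorem restrictL_ae_eq (w : energySpace ν k Ω Λ hν hk hΛ) :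
    restrictL hν hk hΛ w =ᵐ[volume.restrict Ω] toFun hν hk hΛ w :=
  (toFun_spec hν hk hΛ w).2.1

theorem inner_restrictL (w : energySpace ν k Ω Λ hν hk hΛ) {w' : energySpace ν k Ω Λ hν hk hΛ}
    (hw : Represents (w : Ambient k Ω) u) (hw' : Represents (w' : Ambient k Ω) v) :
    inner ℝ (restrictL hν hk hΛ w) (restrictL hν hk hΛ w') = ∫ x in Ω, u x * v x := by
  rw [L2.inner_def]
  refine integral_congr_ae ?_
  filter_upwards [hw.1, hw'.1] with x h1 h2
  change inner ℝ ((w : Ambient k Ω).fst x) ((w' : Ambient k Ω).fst x) = _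
  rw [h1, h2]
  simp [mul_comm]

theorem isCompactOperator_restrictL
    (hclass : ClassA1 ν Ω ∨ ClassA2 ν Ω ∨ ClassA3 ν Ω) :
    IsCompactOperator (restrictL (Ω := Ω) hν hk hΛ) := by
  -- On the unit ball the `L²(Ω)` part is at most `1`, and the `ν`-energy is at most `2Λ` times the
  -- form part.
  have htb := (totallyBounded_of_class hclass (R := 1 + 2 * Λ) (by finiteness)).closure
  refine (isCompactOperator_iff_image_closedBall_subset_compact
    (restrictL (Ω := Ω) hν hk hΛ : energySpace ν k Ω Λ hν hk hΛ →ₗ[ℝ] Lp ℝ 2 (volume.restrict Ω))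
    one_pos).2 ⟨_, htb.isCompact_of_isClosed isClosed_closure, ?_⟩
  rintro _ ⟨w, hw, rfl⟩
  refine subset_closure ?_
  obtain ⟨hm, h1, h2⟩ := toFun_spec hν hk hΛ w
  have hw1 : ‖(w : Ambient k Ω)‖ ^ 2 ≤ 1 := by
    have : ‖w‖ ≤ 1 := by simpa using hw
    exact pow_le_one₀ (norm_nonneg _) this
  rw [WithLp.prod_norm_sq_eq_of_L2] at hw1
  have hb : ∀ {α : Type} [MeasurableSpace α] {σ : Measure α} (f : Lp ℝ 2 σ), ‖f‖ ^ 2 ≤ 1 →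
      ∫⁻ x, ENNReal.ofReal (f x ^ 2) ∂σ ≤ 1 := by
    intro α _ σ f hf
    rw [lintegral_sq_eq, ← ENNReal.ofReal_toReal (Lp.eLpNorm_ne_top f), ← Lp.norm_def,
      ← ENNReal.ofReal_pow (norm_nonneg _)]
    exact ENNReal.ofReal_le_one.2 hf
  have hb1 := hb (w : Ambient k Ω).fst (by nlinarith [sq_nonneg ‖(w : Ambient k Ω).snd‖])
  have hb2 := hb (w : Ambient k Ω).snd (by nlinarith [sq_nonneg ‖(w : Ambient k Ω).fst‖])
  change normSqH ν Ω (w : Ambient k Ω).fst ≤ _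
  refine add_le_add hb1 ?_
  rw [energyOn_congr h1 h1]
  calc energyOn ν Ω Ω (toFun hν hk hΛ w) ≤ energyOn ν Ω univ (toFun hν hk hΛ w) :=
        energyOn_mono subset_rfl (subset_univ _)
    _ ≤ _ := energyOn_le_lintegral_diff_sq hν hk hΛ hm.1
    _ ≤ 2 * Λ * 1 := by
        gcongr
        refine le_trans (le_of_eq (lintegral_congr_ae ?_)) hb2
        filter_upwards [h2] with p hp
        rw [hp]
    _ = _ := mul_one _

/-- The weak formulation of the eigenvalue problem in the energy space. -/
def IsEigenvector (r : ℝ) (w : energySpace ν k Ω Λ hν hk hΛ) : Prop :=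
  ∀ v : energySpace ν k Ω Λ hν hk hΛ, inner ℝ w v =
    (1 + r) * inner ℝ (restrictL hν hk hΛ w) (restrictL hν hk hΛ v)

theorem IsEigenvector.isNeumannEigenfunction (hsupp : HasFullSupport ν) (hΩ : IsOpen Ω)
    (hΩn : Ω.Nonempty) {r : ℝ} {w : energySpace ν k Ω Λ hν hk hΛ}
    (hw : IsEigenvector hν hk hΛ r w) (h0 : w ≠ 0) :
    IsNeumannEigenfunction ν k Ω r (toFun hν hk hΛ w) := by
  obtain ⟨hm, hr⟩ := toFun_spec hν hk hΛ w
  refine ⟨hm, fun hz => h0 ?_, fun v hv => ?_⟩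
  · refine toFunₗ_injective hν hk hΛ hsupp hΩ hΩn ?_
    rw [map_zero]
    exact AEEqFun.ext (hz.trans AEEqFun.coeFn_zero.symm)
  · obtain ⟨w', hw', hrv⟩ := exists_mem_energySpace hν hk hΛ hv
    have h1 := hw ⟨w', hw'⟩
    rw [inner_restrictL hν hk hΛ w (w' := ⟨w', hw'⟩) hr hrv, Submodule.coe_inner,
      inner_of_represents hk hr hrv] at h1
    linarith

theorem IsNeumannEigenfunction.exists_isEigenvector {r : ℝ}
    (hu : IsNeumannEigenfunction ν k Ω r u) : ∃ w : energySpace ν k Ω Λ hν hk hΛ,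
      Represents (w : Ambient k Ω) u ∧ IsEigenvector hν hk hΛ r w := by
  obtain ⟨w, hw, hr⟩ := exists_mem_energySpace hν hk hΛ hu.1
  refine ⟨⟨w, hw⟩, hr, fun v => ?_⟩
  obtain ⟨hmv, hrv⟩ := toFun_spec hν hk hΛ v
  rw [inner_restrictL hν hk hΛ ⟨w, hw⟩ (w' := v) hr hrv, Submodule.coe_inner,
    inner_of_represents hk hr hrv, hu.2.2 _ hmv]
  ring

end Eigenfunctions

/-! ### The abstract weak eigenvalue problem for a compact operator. -/

section WeakEigenvectors

open ContinuousLinearMap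

variable {V H : Type*} [NormedAddCommGroup V] [InnerProductSpace ℝ V]
  [NormedAddCommGroup H] [InnerProductSpace ℝ H]

/-- A compact operator `J : V → H` with dense range, `H` infinite-dimensional, gives an orthonormal
basis of `H` consisting of images of solutions of `⟪w, v⟫ = (1 + μ) ⟪J w, J v⟫`. -/
theorem exists_hilbertBasis_weak_eigenvectors [CompleteSpace V] [CompleteSpace H] {J : V →L[ℝ] H}
    (hc : IsCompactOperator J) (hd : ∀ f, (∀ w, inner ℝ f (J w) = 0) → f = 0)
    (hinf : ¬ FiniteDimensional ℝ H) :
    ∃ (b : HilbertBasis ℕ ℝ H) (w : ℕ → V) (μ : ℕ → ℝ), (∀ n, J (w n) = b n) ∧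
      (∀ n v, inner ℝ (w n) v = (1 + μ n) * inner ℝ (J (w n)) (J v)) ∧
      Monotone μ ∧ Tendsto μ atTop atTop := by
  set T : H →L[ℝ] H := J ∘L adjoint J with hT
  have hTc : IsCompactOperator T := hc.comp_clm (adjoint J)
  have hTi : ∀ f g, inner ℝ (T f) g = inner ℝ (adjoint J f) (adjoint J g) := fun f g => by
    rw [hT, ContinuousLinearMap.comp_apply, ← adjoint_inner_right]
  have hTs : T.IsSymmetric := fun f g => by
    rw [ContinuousLinearMap.coe_coe, hTi, real_inner_comm, ← hTi, real_inner_comm]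
  have hTp : ∀ f, f ≠ 0 → 0 < inner ℝ (T f) f := by
    intro f hf
    rw [hTi, real_inner_self_eq_norm_sq]
    refine pow_pos (norm_pos_iff.2 fun h0 => hf (hd f fun w => ?_)) 2
    rw [← adjoint_inner_left, h0, inner_zero_left]
  obtain ⟨b, l, hbl, hl, hanti, hlim⟩ := exists_hilbertBasis_antitone_eigenvalues hTc hTs hTp hinf
  have hJw : ∀ n, J ((l n)⁻¹ • adjoint J (b n)) = b n := by
    intro n
    rw [map_smul, ← ContinuousLinearMap.comp_apply, ← hT, hbl, smul_smul, inv_mul_cancel₀ (hl n).ne',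
      one_smul]
  -- By adjointness `⟪w n, v⟫ = (l n)⁻¹ ⟪b n, J v⟫`, which forces `1 + μ n = (l n)⁻¹`.
  refine ⟨b, fun n => (l n)⁻¹ • adjoint J (b n), fun n => (l n)⁻¹ - 1, hJw, ?_, ?_, ?_⟩
  · intro n v
    rw [hJw, real_inner_smul_left, adjoint_inner_left]
    ring
  · intro m n hmn
    exact sub_le_sub_right (inv_anti₀ (hl n) (hanti hmn)) 1
  · refine tendsto_atTop_add_const_right _ _ (tendsto_inv_nhdsGT_zero.comp ?_)
    exact tendsto_nhdsWithin_iff.2 ⟨hlim, Eventually.of_forall hl⟩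

variable {J : V →L[ℝ] H} {b : HilbertBasis ℕ ℝ H} {w : ℕ → V} {μ : ℕ → ℝ} {r : ℝ} {v : V}

/-- Testing each equation with the other solution gives `(μ n - r) ⟪b n, J v⟫ = 0`. -/
theorem inner_eq_zero_of_weak_eigenvector (hJw : ∀ n, J (w n) = b n)
    (hw : ∀ n v, inner ℝ (w n) v = (1 + μ n) * inner ℝ (J (w n)) (J v))
    (hv : ∀ z, inner ℝ v z = (1 + r) * inner ℝ (J v) (J z)) {n : ℕ} (hn : μ n ≠ r) :
    inner ℝ (b n) (J v) = 0 := by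
  have h1 := hw n v
  have h2 := hv (w n)
  rw [real_inner_comm, h1, real_inner_comm (J (w n)), hJw] at h2
  have h3 : (μ n - r) * inner ℝ (b n) (J v) = 0 := by linarith
  exact (mul_eq_zero.1 h3).resolve_left (sub_ne_zero.2 hn)

theorem eq_zero_of_forall_inner_basis (b : HilbertBasis ℕ ℝ H) {f : H}
    (h : ∀ n, inner ℝ (b n) f = 0) : f = 0 := by
  refine b.repr.injective (lp.ext (funext fun n => ?_))
  rw [b.repr_apply_apply, h, map_zero]
  rfl

/-- Subtract from `v` its components along the `w n` with `μ n = r`. The remainder solves the same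
equation and has image zero under `J`; tested against itself it vanishes, although `J` need not be
injective. -/
theorem weak_eigenvector_mem_span (hJw : ∀ n, J (w n) = b n)
    (hw : ∀ n v, inner ℝ (w n) v = (1 + μ n) * inner ℝ (J (w n)) (J v))
    (hv : ∀ z, inner ℝ v z = (1 + r) * inner ℝ (J v) (J z)) (hfin : {n | μ n = r}.Finite) :
    v ∈ Submodule.span ℝ (range fun n : {n | μ n = r} => w n) := by
  have := hfin.fintype
  set s := ∑ n : {n | μ n = r}, inner ℝ (b n) (J v) • w n with hs
  have hsv : ∀ z, inner ℝ (v - s) z = (1 + r) * inner ℝ (J (v - s)) (J z) := by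
    intro z
    rw [hs, inner_sub_left, sum_inner, map_sub, map_sum, inner_sub_left, sum_inner, hv z,
      mul_sub, Finset.mul_sum]
    congr 1
    refine Finset.sum_congr rfl fun n _ => ?_
    have hn : μ n = r := n.2
    rw [map_smul, real_inner_smul_left, real_inner_smul_left, hw n z, hn]
    ring
  have hJ0 : J (v - s) = 0 := by
    refine eq_zero_of_forall_inner_basis b fun m => ?_
    by_cases hm : μ m = r
    · rw [hs, map_sub, map_sum, inner_sub_right, inner_sum,
        Finset.sum_eq_single (⟨m, hm⟩ : {n | μ n = r})]
      · rw [map_smul, real_inner_smul_right, hJw, real_inner_self_eq_norm_sq, b.orthonormal.1 m]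
        ring
      · intro n _ hn
        rw [map_smul, real_inner_smul_right, hJw,
          b.orthonormal.2 (fun h => hn (Subtype.ext h.symm)), mul_zero]
      · simp
    · exact inner_eq_zero_of_weak_eigenvector hJw hw hsv hm
  have h0 := hsv (v - s)
  rw [hJ0, inner_zero_left, mul_zero] at h0
  rw [sub_eq_zero.1 (inner_self_eq_zero.1 h0)]
  exact Submodule.sum_mem _ fun n _ => Submodule.smul_mem _ _ (Submodule.subset_span ⟨n, rfl⟩)

theorem linearIndependent_of_map_eq_basis (hJw : ∀ n, J (w n) = b n) : LinearIndependent ℝ w := by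
  refine LinearIndependent.of_comp (J : V →ₗ[ℝ] H) ?_
  have : ⇑(J : V →ₗ[ℝ] H) ∘ w = b := funext hJw
  rw [this]
  exact b.orthonormal.linearIndependent

end WeakEigenvectors

/-! ### The Neumann eigenbasis and its multiplicities. -/

section Main

variable {d : ℕ} {ν : Space d → ℝ≥0} {Ω : Set (Space d)} {k : Space d → Space d → ℝ≥0} {Λ : ℝ≥0}
  {u v : Space d → ℝ}

/-- In dimension zero the space is a point of finite volume, so `ν` would be integrable. -/
theorem ClassBase.dim_pos (hb : ClassBase ν Ω) : 0 < d := by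
  rcases Nat.eq_zero_or_pos d with rfl | h
  · exfalso
    have h1 := hb.nonintegrable
    have h2 : ∀ h : Space 0, (ν h : ℝ≥0∞) = ν 0 := fun h => by rw [Subsingleton.elim h 0]
    simp_rw [h2] at h1
    rw [lintegral_const] at h1
    refine absurd h1 (ENNReal.mul_ne_top ENNReal.coe_ne_top ?_)
    exact (subsingleton_univ.finite.isCompact.measure_lt_top).ne
  · exact h

variable (hν : IsLevyDensity ν) (hk : IsEllipticKernel ν Λ k) (hΛ : 1 ≤ Λ)

theorem eq_zero_of_forall_inner_restrictL (hb : ClassBase ν Ω)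
    (f : Lp ℝ 2 (volume.restrict Ω))
    (h : ∀ w, inner ℝ f (restrictL (Ω := Ω) hν hk hΛ w) = 0) : f = 0 := by
  refine eq_zero_of_forall_integral_memV hb f fun v hv => ?_
  obtain ⟨w, hw, hr⟩ := exists_mem_energySpace hν hk hΛ hv
  rw [← h ⟨w, hw⟩, L2.inner_def]
  refine integral_congr_ae ?_
  filter_upwards [hr.1] with x h1
  change _ = inner ℝ (f x) (w.fst x)
  rw [h1]
  simp [mul_comm]

/-- An orthonormal basis of `L²(Ω)` given by restrictions of solutions of the eigenvalue problem. -/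
theorem exists_eigenbasis (hclass : ClassA1 ν Ω ∨ ClassA2 ν Ω ∨ ClassA3 ν Ω) (hb : ClassBase ν Ω)
    (hsupp : HasFullSupport ν) (hΩn : Ω.Nonempty) :
    ∃ (b : HilbertBasis ℕ ℝ (Lp ℝ 2 (volume.restrict Ω)))
      (w : ℕ → energySpace ν k Ω Λ hν hk hΛ) (μ : ℕ → ℝ),
      (∀ n, restrictL hν hk hΛ (w n) = b n) ∧ (∀ n, IsEigenvector hν hk hΛ (μ n) (w n)) ∧
      Monotone μ ∧ Tendsto μ atTop atTop := by
  have : CompleteSpace (energySpace ν k Ω Λ hν hk hΛ) :=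
    (isClosed_energySpace hν hk hΛ hsupp hb.isOpen hΩn).completeSpace_coe
  exact exists_hilbertBasis_weak_eigenvectors (isCompactOperator_restrictL hν hk hΛ hclass)
    (eq_zero_of_forall_inner_restrictL hν hk hΛ hb)
    (not_finiteDimensional_Lp hb.dim_pos hb.isOpen hb.isBounded hΩn)

theorem form_self_nonneg (u : Space d → ℝ) : 0 ≤ form k Ω u u := by
  refine mul_nonneg (by norm_num) (integral_nonneg fun p => ?_)
  exact mul_nonneg (mul_self_nonneg _) (NNReal.coe_nonneg _)

theorem exists_ae_eq_const_of_form_eq_zero (hν : IsLevyDensity ν) (hk : IsEllipticKernel ν Λ k)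
    (hΛ : 1 ≤ Λ) (hb : ClassBase ν Ω) (hsupp : HasFullSupport ν)
    (hu : MemV ν Ω u) (h : form k Ω u u = 0) : ∃ c : ℝ, u =ᵐ[volume.restrict Ω] fun _ => c := by
  refine exists_ae_eq_const hb hsupp hu.1 (le_antisymm ?_ zero_le)
  refine (energyOn_le_lintegral_diff_sq hν hk hΛ hu.1).trans ?_
  obtain ⟨-, -, h2⟩ := (memV_iff hν hk hΛ).1 hu
  rw [form_eq_integral hk, integral_eq_zero_iff_of_nonneg (fun p => mul_self_nonneg _)
    (h2.integrable_mul h2)] at h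
  rw [lintegral_congr_ae (g := fun _ => 0)]
  · simp
  · filter_upwards [h] with p hp
    have : diff u p * diff u p = 0 := hp
    rw [mul_self_eq_zero.1 this]
    simp

theorem exists_neumann_eigenbasis (hΩ : Ω.Nonempty)
    (hsupp : HasFullSupport ν)
    (hclass : ClassA1 ν Ω ∨ ClassA2 ν Ω ∨
      ClassA3 ν Ω)
    (hΛ : 1 ≤ Λ)
    (hk : IsEllipticKernel ν Λ k) :
    ∃ (φ : ℕ → Space d → ℝ) (μ : ℕ → ℝ),
      (∀ n, IsNeumannEigenfunction ν k Ω (μ n) (φ n)) ∧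
      (∃ b : HilbertBasis ℕ ℝ (Lp ℝ 2 (volume.restrict Ω)),
        ∀ n, b n =ᵐ[volume.restrict Ω] φ n) ∧
      μ 0 = 0 ∧ 0 < μ 1 ∧ Monotone μ ∧ Tendsto μ atTop atTop ∧
      (∀ r : ℝ, FiniteDimensional ℝ (eigenspace ν k Ω r) ∧
        Module.finrank ℝ (eigenspace ν k Ω r) = {n | μ n = r}.ncard) := by
  have hb : ClassBase ν Ω := by
    rcases hclass with h | h | h <;> exact h.toClassBase
  have hν := hb.levyDensity
  have hΩo := hb.isOpen
  obtain ⟨b, w, μ, hJw, hev, hmono, hlim⟩ := exists_eigenbasis hν hk hΛ hclass hb hsupp hΩ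
  have hw0 : ∀ n, w n ≠ 0 := fun n h0 => by
    have := b.orthonormal.1 n
    rw [← hJw, h0, map_zero, norm_zero] at this
    exact zero_ne_one this
  set φ : ℕ → Space d →ₘ[volume] ℝ := fun n => toFun hν hk hΛ (w n) with hφ
  have hφe : ∀ n, IsNeumannEigenfunction ν k Ω (μ n) (φ n) := fun n =>
    (hev n).isNeumannEigenfunction hν hk hΛ hsupp hΩo hΩ (hw0 n)
  have hbφ : ∀ n, b n =ᵐ[volume.restrict Ω] φ n := fun n => by
    rw [← hJw]; exact restrictL_ae_eq hν hk hΛ (w n)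
  have hint : ∀ m n, ∫ x in Ω, φ m x * φ n x = inner ℝ (b m) (b n) := fun m n => by
    rw [← hJw, ← hJw]
    exact (inner_restrictL hν hk hΛ (w m) (toFun_spec hν hk hΛ (w m)).2
      (toFun_spec hν hk hΛ (w n)).2).symm
  have hform : ∀ n, form k Ω (φ n) (φ n) = μ n := fun n => by
    rw [(hφe n).2.2 _ (hφe n).1, hint, real_inner_self_eq_norm_sq, b.orthonormal.1 n]
    ring
  have hμnn : ∀ n, 0 ≤ μ n := fun n => hform n ▸ form_self_nonneg _
  have hconst : ∃ v : energySpace ν k Ω Λ hν hk hΛ, IsEigenvector hν hk hΛ 0 v ∧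
      restrictL hν hk hΛ v ≠ 0 := by
    have h1 : IsNeumannEigenfunction ν k Ω 0 (fun _ => (1 : ℝ)) := by
      refine ⟨memV_const hν hb.isBounded 1, fun h => ?_, fun v _ => by simp [form]⟩
      have h0 := (ae_restrict_of_ae (s := Ω) h)
      have : (volume.restrict Ω) ≠ 0 := by
        rw [Ne, Measure.restrict_eq_zero]; exact (hΩo.measure_pos _ hΩ).ne'
      have := ae_neBot.2 this
      obtain ⟨x, hx⟩ := h0.exists
      exact one_ne_zero hx
    obtain ⟨v, hr, hv⟩ := h1.exists_isEigenvector hν hk hΛ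
    refine ⟨v, hv, fun h0 => ?_⟩
    have hJ : restrictL hν hk hΛ v =ᵐ[volume.restrict Ω] fun _ => (1 : ℝ) := hr.1
    rw [h0] at hJ
    have : (volume.restrict Ω) ≠ 0 := by
      rw [Ne, Measure.restrict_eq_zero]; exact (hΩo.measure_pos _ hΩ).ne'
    have := ae_neBot.2 this
    obtain ⟨x, hx1, hx2⟩ := (hJ.and (Lp.coeFn_zero ℝ 2 (volume.restrict Ω))).exists
    rw [hx2] at hx1
    exact zero_ne_one hx1
  -- If `μ 0 > 0`, every `μ n` is positive, and the constant solution for eigenvalue `0` would be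
  -- orthogonal to the whole basis.
  have hμ0 : μ 0 = 0 := by
    obtain ⟨v, hv, hv0⟩ := hconst
    by_contra hne
    refine hv0 (eq_zero_of_forall_inner_basis b fun n =>
      inner_eq_zero_of_weak_eigenvector hJw hev hv fun hn => hne ?_)
    exact le_antisymm ((hmono (Nat.zero_le n)).trans hn.le) (hμnn 0)
  -- If `μ 1 = 0`, both `b 0` and `b 1` would be constant on `Ω`, hence proportional and not
  -- orthogonal.
  have hμ1 : 0 < μ 1 := by
    refine (hμnn 1).lt_of_ne fun h1 => ?_
    have hc : ∀ n, μ n = 0 → ∃ c : ℝ, b n =ᵐ[volume.restrict Ω] fun _ => c := fun n hn => by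
      obtain ⟨c, hc⟩ := exists_ae_eq_const_of_form_eq_zero hν hk hΛ hb hsupp (hφe n).1
        (by rw [hform, hn])
      exact ⟨c, (hbφ n).trans hc⟩
    obtain ⟨c₀, hc₀⟩ := hc 0 hμ0
    obtain ⟨c₁, hc₁⟩ := hc 1 h1.symm
    have hnz : ∀ n (c : ℝ), b n =ᵐ[volume.restrict Ω] (fun _ => c) → c ≠ 0 := by
      rintro n c hbc rfl
      have : b n = 0 := Lp.ext (hbc.trans (Lp.coeFn_zero ℝ 2 (volume.restrict Ω)).symm)
      have h2 := b.orthonormal.1 n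
      rw [this, norm_zero] at h2
      exact zero_ne_one h2
    have hlin : b 0 = (c₀ / c₁) • b 1 := by
      refine Lp.ext ?_
      filter_upwards [hc₀, hc₁, Lp.coeFn_smul (c₀ / c₁) (b 1)] with x h1 h2 h3
      rw [h1, h3, Pi.smul_apply, h2, smul_eq_mul, div_mul_cancel₀ _ (hnz 1 c₁ hc₁)]
    have h01 : inner ℝ (b 0) (b 1) = 0 := b.orthonormal.2 zero_ne_one
    rw [hlin, real_inner_smul_left, real_inner_self_eq_norm_sq, b.orthonormal.1 1] at h01
    have := div_ne_zero (hnz 0 c₀ hc₀) (hnz 1 c₁ hc₁)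
    simp at h01
    exact h01.elim (hnz 0 c₀ hc₀) (hnz 1 c₁ hc₁)
  refine ⟨fun n => φ n, μ, hφe, ⟨b, hbφ⟩, hμ0, hμ1, hmono, hlim, fun r => ?_⟩
  have hfin : {n | μ n = r}.Finite := by
    obtain ⟨N, hN⟩ := eventually_atTop.1 (hlim.eventually_gt_atTop r)
    refine (finite_lt_nat N).subset fun n hn => ?_
    by_contra hlt
    exact (hN n (not_lt.1 hlt)).ne' hn
  have := hfin.fintype
  have hspan : eigenspace ν k Ω r = Submodule.span ℝ
      (range fun n : {n | μ n = r} => toFunₗ hν hk hΛ hsupp hΩo hΩ (w n)) := by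
    refine le_antisymm (Submodule.span_le.2 fun f hf => ?_) (Submodule.span_mono ?_)
    · have hf : IsNeumannEigenfunction ν k Ω r f := hf
      obtain ⟨v, hr, hv⟩ := hf.exists_isEigenvector hν hk hΛ
      have hfv : toFunₗ hν hk hΛ hsupp hΩo hΩ v = f := toFun_eq hν hk hΛ hsupp hΩo hΩ v f hr
      have hm := Submodule.mem_map_of_mem (f := toFunₗ hν hk hΛ hsupp hΩo hΩ)
        (weak_eigenvector_mem_span hJw hev hv hfin)
      rwa [Submodule.map_span, ← range_comp, hfv] at hm
    · rintro _ ⟨⟨n, rfl⟩, rfl⟩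
      exact hφe n
  have hli : LinearIndependent ℝ
      fun n : {n | μ n = r} => toFunₗ hν hk hΛ hsupp hΩo hΩ (w n) :=
    ((linearIndependent_of_map_eq_basis hJw).comp _ Subtype.val_injective).map' _
      (LinearMap.ker_eq_bot.2 (toFunₗ_injective hν hk hΛ hsupp hΩo hΩ))
  rw [hspan]
  refine ⟨FiniteDimensional.span_of_finite ℝ (finite_range _), ?_⟩
  rw [finrank_span_eq_card hli, ← Nat.card_coe_set_eq, Nat.card_eq_fintype_card]

end Main

end NonlocalNeumann

theorem mainTheorem6 {d : ℕ} (Ω : Set (NonlocalNeumann.Space d))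
    (ν : NonlocalNeumann.Space d → ℝ≥0)
    (k : NonlocalNeumann.Space d → NonlocalNeumann.Space d → ℝ≥0) (Λ : ℝ≥0)
    (hΩ : Ω.Nonempty)
    (hsupp : NonlocalNeumann.HasFullSupport ν)
    (hclass : NonlocalNeumann.ClassA1 ν Ω ∨ NonlocalNeumann.ClassA2 ν Ω ∨
      NonlocalNeumann.ClassA3 ν Ω)
    (hΛ : 1 ≤ Λ)
    (hk : NonlocalNeumann.IsEllipticKernel ν Λ k) :
    ∃ (φ : ℕ → NonlocalNeumann.Space d → ℝ) (μ : ℕ → ℝ),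
      (∀ n, NonlocalNeumann.IsNeumannEigenfunction ν k Ω (μ n) (φ n)) ∧
      (∃ b : HilbertBasis ℕ ℝ (Lp ℝ 2 (volume.restrict Ω)),
        ∀ n, b n =ᵐ[volume.restrict Ω] φ n) ∧
      μ 0 = 0 ∧ 0 < μ 1 ∧ Monotone μ ∧ Tendsto μ atTop atTop ∧
      (∀ r : ℝ, FiniteDimensional ℝ (NonlocalNeumann.eigenspace ν k Ω r) ∧
        Module.finrank ℝ (NonlocalNeumann.eigenspace ν k Ω r) = {n | μ n = r}.ncard) :=
  NonlocalNeumann.exists_neumann_eigenbasis hΩ hsupp hclass hΛ hk
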